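/- Let $a_1,a_2,a_3>0$, $\beta\in\mathbb R$, $\mu>0$. Let $\mathcal G$ be the metric graph with vertices $v_{k,\ell}=(ka_1,\ell a_2,0)$ and $v_{k,\ell}^\pm=(ka_1,\ell a_2,\pm a_3/2)$, $(k,\ell)\in\mathbb Z^2$, and edges $e_{k+\frac12,\ell}=(v_{k,\ell},v_{k+1,\ell})$, $e_{k,\ell+\frac12}=(v_{k,\ell},v_{k,\ell+1})$, $e_{k,\ell}^\pm=(v_{k,\ell},v_{k,\ell}^\pm)$, parametrized by $x_1$, $x_2$, $x_3$ respectively; restrictions of a function $u$ to the edges carry the same indices. Let $w^\mu_{0,0}=\mu$ and $w^\mu_{k,\ell}=1$ for $(k,\ell)\ne(0,0)$. Let $L_2^\mu(\mathcal G)$ be the Hilbert space with norm $$\|u\|^2=\sum_{(k,\ell)\in\mathbb Z^2}\Big(w^\mu_{k,\ell}\sum_\pm\|u^\pm_{k,\ell}\|^2_{L_2(e^\pm_{k,\ell})}+\|u_{k+\frac12,\ell}\|^2_{L_2(e_{k+\frac12,\ell})}+\|u_{k,\ell+\frac12}\|^2_{L_2(e_{k,\ell+\frac12})}\Big),$$ and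 let $H^2(\mathcal G)$ be the space of continuous functions on $\mathcal G$ that are $H^2$ on every edge with $\sum_e\|u\|^2_{H^2(e)}<\infty$. The operator $\mathcal A^\mu(\beta)$ in $L_2^\mu(\mathcal G)$ is $\mathcal A^\mu(\beta)u=-u''$ on every edge, with domain the set of $u\in H^2(\mathcal G)$ such that for all $(k,\ell)\in\mathbb Z^2$: $u^+_{k,\ell}(a_3/2)=e^{-i\beta}u^-_{k,\ell}(-a_3/2)$, $(u^+_{k,\ell})'(a_3/2)=e^{-i\beta}(u^-_{k,\ell})'(-a_3/2)$, and $$u'_{k+\frac12,\ell}(ka_1)-u'_{k-\frac12,\ell}(ka_1)+u'_{k,\ell+\frac12}(\ell a_2)-u'_{k,\ell-\frac12}(\ell a_2)+w^\mu_{k,\ell}\big((u^+_{k,\ell})'(0)-(u^-_{k,\ell})'(0)\big)=0.$$ Write $\mathcal A(\beta)=\mathcal A^1(\beta)$. A gap of $\mathcal A(\beta)$ is an open interval $(a,b)$, $a<b$, with $[a,b]\cap\sigma(\mathcal A(\beta))=\{a,b\}$. Let $\sigma_i=\{(\pi n/a_i)^2 : n\in\mathbb Z\}$ for $i=1,2$;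 let $\mathcal W(\beta)=\{\pi n/a_3 : n\ge1\}$ if $\beta\notin\{0,\pi\}$ and $\mathcal W(\beta)=\{\beta/a_3+(2n+1)\pi/a_3 : n\ge0\}$ if $\beta\in\{0,\pi\}$. A gap $(\omega_b^2,\omega_t^2)$ of $\mathcal A(\beta)$, $\omega_b,\omega_t\ge0$, is - of type (i) if $\omega_b^2\notin\sigma_1\cup\sigma_2$, $\omega_t^2\notin\sigma_1\cup\sigma_2$ and $(\omega_b,\omega_t)\cap\mathcal W(\beta)$ consists of exactly one point, denoted $\omega_0$; - of type (ii) if $\omega_b^2\in\sigma_1\cup\sigma_2$, $\omega_t^2\notin\sigma_1\cup\sigma_2$ and $(\omega_b,\omega_t)\cap\mathcal W(\beta)=\varnothing$; - of type (iii) if $\omega_b^2\notin\sigma_1\cup\sigma_2$, $\omega_t^2\in\sigma_1\cup\sigma_2$ and $(\omega_b,\omega_t)\cap\mathcal W(\beta)=\varnothing$. If $\mu>1$, then $\mathcal A^\mu(\beta)$ has no eigenvalue outside its essential spectrum $\sigma_{ess}(\mathcal A^\mu(\beta))$, and none outside $\sigma(\mathcal A(\beta))$; in particular it has no eigenvalue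 in any gap of $\mathcal A(\beta)$. If $0<\mu<1$ and $(\omega_b^2,\omega_t^2)$ is a gap of $\mathcal A(\beta)$, then: (a) if the gap is of type (i), $\mathcal A^\mu(\beta)$ has at least two eigenvalues $\omega_1^2$, $\omega_2^2$ with $\omega_b<\omega_1<\omega_0<\omega_2<\omega_t$; (b) if the gap is of type (ii) or (iii), $\mathcal A^\mu(\beta)$ has at least one eigenvalue $\omega_1^2$ with $\omega_b<\omega_1<\omega_t$. -/

import Mathlib

open MeasureTheory Filter Topology Set
open scoped ENNReal

/-! ### Spectral notions for unbounded operators on a complex Hilbert space -/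

namespace UnboundedOp

variable {H : Type*} [NormedAddCommGroup H] [InnerProductSpace ℂ H]

/-- `z` is an eigenvalue of the unbounded operator `T`. -/
def IsEigenvalue (T : H →ₗ.[ℂ] H) (z : ℂ) : Prop :=
  ∃ u : T.domain, u ≠ 0 ∧ T u = z • (u : H)

/-- The resolvent set: `T - z : D(T) → H` is a bijection with bounded inverse. -/
def resolventSet (T : H →ₗ.[ℂ] H) : Set ℂ :=
  {z | (Function.Bijective fun u : T.domain => T u - z • (u : H)) ∧
    ∃ C : ℝ, ∀ u : T.domain, ‖(u : H)‖ ≤ C * ‖T u - z • (u : H)‖}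

/-- The spectrum, the complement of the resolvent set. -/
def spectrum (T : H →ₗ.[ℂ] H) : Set ℂ := (resolventSet T)ᶜ

/-- The essential spectrum (of a self-adjoint operator), through singular Weyl sequences:
normalized vectors of the domain that tend weakly to `0` and with `(T - z) u n → 0`. -/
def essSpectrum (T : H →ₗ.[ℂ] H) : Set ℂ :=
  {z | ∃ u : ℕ → T.domain, (∀ n, ‖(u n : H)‖ = 1) ∧
    (∀ v : H, Tendsto (fun n => inner ℂ v (u n : H)) atTop (𝓝 0)) ∧
    Tendsto (fun n => T (u n) - z • (u n : H)) atTop (𝓝 0)}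

/-- The open interval `(a, b)` is a gap of `T`: the intersection of `[a, b]` with the
spectrum of `T` is reduced to `{a, b}`. -/
def IsSpectralGap (T : H →ₗ.[ℂ] H) (a b : ℝ) : Prop :=
  a < b ∧ {x : ℝ | x ∈ Icc a b ∧ (x : ℂ) ∈ spectrum T} = {a, b}

end UnboundedOp

/-! ### The metric graph -/

namespace LimitGraph

/-- The edges. For `k l : ℤ`:
`e₁ k l` joins `(k a₁, l a₂, 0)` to `((k+1) a₁, l a₂, 0)`, with coordinate `x₁`;
`e₂ k l` joins `(k a₁, l a₂, 0)` to `(k a₁, (l+1) a₂, 0)`, with coordinate `x₂`;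
`ePlus k l` joins `(k a₁, l a₂, 0)` to `(k a₁, l a₂, a₃/2)`, with coordinate `x₃`;
`eMinus k l` joins `(k a₁, l a₂, -a₃/2)` to `(k a₁, l a₂, 0)`, with coordinate `x₃`. -/
inductive Edge : Type
  | e₁ (k l : ℤ)
  | e₂ (k l : ℤ)
  | ePlus (k l : ℤ)
  | eMinus (k l : ℤ)

/-- The smallest value of the coordinate on an edge. -/
noncomputable def Edge.lo (a₁ a₂ a₃ : ℝ) : Edge → ℝ
  | .e₁ k _ => k * a₁
  | .e₂ _ l => l * a₂
  | .ePlus _ _ => 0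
  | .eMinus _ _ => -(a₃ / 2)

/-- The largest value of the coordinate on an edge. -/
noncomputable def Edge.hi (a₁ a₂ a₃ : ℝ) : Edge → ℝ
  | .e₁ k _ => (k + 1) * a₁
  | .e₂ _ l => (l + 1) * a₂
  | .ePlus _ _ => a₃ / 2
  | .eMinus _ _ => 0

/-- The weight at the vertex `(k a₁, l a₂, 0)`. -/
noncomputable def vertexWeight (μ : ℝ) (k l : ℤ) : ℝ := if k = 0 ∧ l = 0 then μ else 1

/-- The weight of an edge in the norm of `L₂^μ`. -/
noncomputable def Edge.weight (μ : ℝ) : Edge → ℝ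
  | .e₁ _ _ => 1
  | .e₂ _ _ => 1
  | .ePlus k l => vertexWeight μ k l
  | .eMinus k l => vertexWeight μ k l

/-- Length measure on an edge. -/
noncomputable def edgeVolume (a₁ a₂ a₃ : ℝ) (e : Edge) : Measure ℝ :=
  volume.restrict (Icc (e.lo a₁ a₂ a₃) (e.hi a₁ a₂ a₃))

/-- Weighted length measure on an edge. -/
noncomputable def edgeMeasure (a₁ a₂ a₃ μ : ℝ) (e : Edge) : Measure ℝ :=
  ENNReal.ofReal (e.weight μ) • edgeVolume a₁ a₂ a₃ e

/-- The Hilbert space `L₂^μ(𝒢)`: the Hilbert sum of the weighted `L₂` spaces of the edges. -/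
abbrev L2G (a₁ a₂ a₃ μ : ℝ) : Type :=
  lp (fun e : Edge => Lp ℂ 2 (edgeMeasure a₁ a₂ a₃ μ e)) 2

/-- A function on the edges of the graph, in coordinates, with
`∑_e ‖W_e‖²_{L₂(e)} < ∞` (without weight). -/
def SqIntegrable (a₁ a₂ a₃ : ℝ) (W : Edge → ℝ → ℂ) : Prop :=
  (∀ e, MemLp (W e) 2 (edgeVolume a₁ a₂ a₃ e)) ∧
    Summable fun e => ∫ x, ‖W e x‖ ^ 2 ∂(edgeVolume a₁ a₂ a₃ e)

/-- `U` is an `H²` function on the interval `[lo, hi]` with derivative `V` and second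
derivative `G ∈ L₂(lo, hi)`: it is `C¹`, with `V` absolutely continuous and `V' = G` a.e. -/
structure IsH2On (lo hi : ℝ) (U V G : ℝ → ℂ) : Prop where
  memLp : MemLp G 2 (volume.restrict (Icc lo hi))
  cont : ContinuousOn U (Icc lo hi)
  cont_deriv : ContinuousOn V (Icc lo hi)
  eq_integral : ∀ x ∈ Icc lo hi, U x = U lo + ∫ t in lo..x, V t
  deriv_eq_integral : ∀ x ∈ Icc lo hi, V x = V lo + ∫ t in lo..x, G t

/-- `U` is a function of `H²(𝒢)` with edgewise derivatives `V` and `G`: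
it is `H²` on every edge, `∑_e ‖U_e‖²_{H²(e)} < ∞`, and `U` takes one value
at each vertex (continuity on the graph). -/
structure IsH2Graph (a₁ a₂ a₃ : ℝ) (U V G : Edge → ℝ → ℂ) : Prop where
  edge : ∀ e : Edge, IsH2On (e.lo a₁ a₂ a₃) (e.hi a₁ a₂ a₃) (U e) (V e) (G e)
  sq : SqIntegrable a₁ a₂ a₃ U
  sq_deriv : SqIntegrable a₁ a₂ a₃ V
  sq_deriv2 : SqIntegrable a₁ a₂ a₃ G
  vertex : ∀ k l : ℤ, ∃ p : ℂ,
    U (.e₁ k l) (k * a₁) = p ∧ U (.e₁ (k - 1) l) (k * a₁) = p ∧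
    U (.e₂ k l) (l * a₂) = p ∧ U (.e₂ k (l - 1)) (l * a₂) = p ∧
    U (.ePlus k l) 0 = p ∧ U (.eMinus k l) 0 = p

/-- `U`, with edgewise derivatives `V` and `G`, belongs to the domain of the operator:
`U ∈ H²(𝒢)`, it is `β`-quasi-periodic, and it satisfies the weighted Kirchhoff conditions. -/
structure IsInDomain (a₁ a₂ a₃ β μ : ℝ) (U V G : Edge → ℝ → ℂ) : Prop where
  h2 : IsH2Graph a₁ a₂ a₃ U V G
  quasiPer : ∀ k l : ℤ, U (.ePlus k l) (a₃ / 2) =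
    Complex.exp (-(Complex.I * β)) * U (.eMinus k l) (-(a₃ / 2))
  quasiPer_deriv : ∀ k l : ℤ, V (.ePlus k l) (a₃ / 2) =
    Complex.exp (-(Complex.I * β)) * V (.eMinus k l) (-(a₃ / 2))
  kirchhoff : ∀ k l : ℤ,
    V (.e₁ k l) (k * a₁) - V (.e₁ (k - 1) l) (k * a₁)
      + V (.e₂ k l) (l * a₂) - V (.e₂ k (l - 1)) (l * a₂)
      + (vertexWeight μ k l : ℂ) * (V (.ePlus k l) 0 - V (.eMinus k l) 0) = 0

/-- The pair `(u, f)` of elements of `L₂^μ(𝒢)` lies in the graph of the operator: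
`u` is represented by a function of the domain whose second derivative is `-f`. -/
def IsOpPair (a₁ a₂ a₃ β μ : ℝ) (u f : L2G a₁ a₂ a₃ μ) : Prop :=
  ∃ U V G : Edge → ℝ → ℂ, IsInDomain a₁ a₂ a₃ β μ U V G ∧
    (∀ e, (u e : ℝ → ℂ) =ᵐ[edgeMeasure a₁ a₂ a₃ μ e] U e) ∧
    (∀ e, (f e : ℝ → ℂ) =ᵐ[edgeMeasure a₁ a₂ a₃ μ e] fun x => -G e x)

section Helpers

variable {a₁ a₂ a₃ β μ : ℝ}

theorem SqIntegrable.add {W W' : Edge → ℝ → ℂ} (h : SqIntegrable a₁ a₂ a₃ W)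
    (h' : SqIntegrable a₁ a₂ a₃ W') : SqIntegrable a₁ a₂ a₃ (W + W') := by
  refine ⟨fun e => (h.1 e).add (h'.1 e), ?_⟩
  refine Summable.of_nonneg_of_le (fun e => integral_nonneg fun x => by positivity)
    (fun e => ?_) ((h.2.mul_left 2).add (h'.2.mul_left 2))
  have i1 := (h.1 e).integrable_norm_pow (p := 2) (by norm_num)
  have i2 := (h'.1 e).integrable_norm_pow (p := 2) (by norm_num)
  have i3 := ((h.1 e).add (h'.1 e)).integrable_norm_pow (p := 2) (by norm_num)
  rw [← integral_const_mul, ← integral_const_mul,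
    ← integral_add (i1.const_mul 2) (i2.const_mul 2)]
  refine integral_mono i3 ((i1.const_mul 2).add (i2.const_mul 2)) fun x => ?_
  have h1 : ‖W e x + W' e x‖ ≤ ‖W e x‖ + ‖W' e x‖ := norm_add_le _ _
  have h0 := norm_nonneg (W e x + W' e x)
  simp only [Pi.add_apply]
  nlinarith [sq_nonneg (‖W e x‖ - ‖W' e x‖), norm_nonneg (W e x), norm_nonneg (W' e x)]

theorem SqIntegrable.smul {W : Edge → ℝ → ℂ} (h : SqIntegrable a₁ a₂ a₃ W) (c : ℂ) :
    SqIntegrable a₁ a₂ a₃ (c • W) := by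
  refine ⟨fun e => (h.1 e).const_smul c, (h.2.mul_left (‖c‖ ^ 2)).congr fun e => ?_⟩
  rw [← integral_const_mul]
  simp [mul_pow]

theorem IsH2On.intervalIntegrable {lo hi x : ℝ} {U V G : ℝ → ℂ} (h : IsH2On lo hi U V G)
    (hx : x ∈ Icc lo hi) : IntervalIntegrable G volume lo x := by
  have : IntegrableOn G (Icc lo hi) := h.memLp.integrable (by norm_num)
  rw [intervalIntegrable_iff_integrableOn_Icc_of_le hx.1]
  exact this.mono_set (Icc_subset_Icc_right hx.2)

theorem IsH2On.intervalIntegrable_deriv {lo hi x : ℝ} {U V G : ℝ → ℂ}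
    (h : IsH2On lo hi U V G) (hx : x ∈ Icc lo hi) : IntervalIntegrable V volume lo x := by
  refine ContinuousOn.intervalIntegrable ?_
  rw [uIcc_of_le hx.1]
  exact h.cont_deriv.mono (Icc_subset_Icc_right hx.2)

theorem IsH2On.add {lo hi : ℝ} {U V G U' V' G' : ℝ → ℂ} (h : IsH2On lo hi U V G)
    (h' : IsH2On lo hi U' V' G') : IsH2On lo hi (U + U') (V + V') (G + G') where
  memLp := h.memLp.add h'.memLp
  cont := h.cont.add h'.cont
  cont_deriv := h.cont_deriv.add h'.cont_deriv
  eq_integral x hx := by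
    simp only [Pi.add_apply]
    rw [intervalIntegral.integral_add (h.intervalIntegrable_deriv hx)
      (h'.intervalIntegrable_deriv hx), h.eq_integral x hx, h'.eq_integral x hx]
    ring
  deriv_eq_integral x hx := by
    simp only [Pi.add_apply]
    rw [intervalIntegral.integral_add (h.intervalIntegrable hx)
      (h'.intervalIntegrable hx), h.deriv_eq_integral x hx, h'.deriv_eq_integral x hx]
    ring

theorem IsH2On.smul {lo hi : ℝ} {U V G : ℝ → ℂ} (h : IsH2On lo hi U V G) (c : ℂ) :
    IsH2On lo hi (c • U) (c • V) (c • G) where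
  memLp := h.memLp.const_smul c
  cont := h.cont.const_smul c
  cont_deriv := h.cont_deriv.const_smul c
  eq_integral x hx := by
    simp only [Pi.smul_apply, intervalIntegral.integral_smul]
    rw [h.eq_integral x hx, smul_add]
  deriv_eq_integral x hx := by
    simp only [Pi.smul_apply, intervalIntegral.integral_smul]
    rw [h.deriv_eq_integral x hx, smul_add]

theorem IsInDomain.add {U V G U' V' G' : Edge → ℝ → ℂ}
    (h : IsInDomain a₁ a₂ a₃ β μ U V G) (h' : IsInDomain a₁ a₂ a₃ β μ U' V' G') :
    IsInDomain a₁ a₂ a₃ β μ (U + U') (V + V') (G + G') where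
  h2 :=
    { edge := fun e => (h.h2.edge e).add (h'.h2.edge e)
      sq := h.h2.sq.add h'.h2.sq
      sq_deriv := h.h2.sq_deriv.add h'.h2.sq_deriv
      sq_deriv2 := h.h2.sq_deriv2.add h'.h2.sq_deriv2
      vertex := fun k l => by
        obtain ⟨p, h1, h2, h3, h4, h5, h6⟩ := h.h2.vertex k l
        obtain ⟨q, g1, g2, g3, g4, g5, g6⟩ := h'.h2.vertex k l
        refine ⟨p + q, ?_⟩
        simp only [Pi.add_apply]
        simp [h1, h2, h3, h4, h5, h6, g1, g2, g3, g4, g5, g6] }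
  quasiPer k l := by
    simp only [Pi.add_apply]
    rw [h.quasiPer, h'.quasiPer, mul_add]
  quasiPer_deriv k l := by
    simp only [Pi.add_apply]
    rw [h.quasiPer_deriv, h'.quasiPer_deriv, mul_add]
  kirchhoff k l := by
    simp only [Pi.add_apply]
    linear_combination h.kirchhoff k l + h'.kirchhoff k l

theorem IsInDomain.smul {U V G : Edge → ℝ → ℂ}
    (h : IsInDomain a₁ a₂ a₃ β μ U V G) (c : ℂ) :
    IsInDomain a₁ a₂ a₃ β μ (c • U) (c • V) (c • G) where
  h2 :=
    { edge := fun e => (h.h2.edge e).smul c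
      sq := h.h2.sq.smul c
      sq_deriv := h.h2.sq_deriv.smul c
      sq_deriv2 := h.h2.sq_deriv2.smul c
      vertex := fun k l => by
        obtain ⟨p, h1, h2, h3, h4, h5, h6⟩ := h.h2.vertex k l
        refine ⟨c * p, ?_⟩
        simp only [Pi.smul_apply, smul_eq_mul]
        simp [h1, h2, h3, h4, h5, h6] }
  quasiPer k l := by
    simp only [Pi.smul_apply, smul_eq_mul]
    rw [h.quasiPer]; ring
  quasiPer_deriv k l := by
    simp only [Pi.smul_apply, smul_eq_mul]
    rw [h.quasiPer_deriv]; ring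
  kirchhoff k l := by
    simp only [Pi.smul_apply, smul_eq_mul]
    linear_combination c * h.kirchhoff k l

theorem isInDomain_zero : IsInDomain a₁ a₂ a₃ β μ 0 0 0 := by
  have hsq : SqIntegrable a₁ a₂ a₃ 0 :=
    ⟨fun e => MemLp.zero, by simp⟩
  refine ⟨⟨fun e => ⟨MemLp.zero, continuousOn_const, continuousOn_const, ?_, ?_⟩,
    hsq, hsq, hsq, fun k l => ⟨0, by simp⟩⟩, by simp, by simp, by simp⟩ <;> simp

/-- A primitive that vanishes identically has an a.e. vanishing density. -/
theorem ae_zero_of_primitive {lo hi : ℝ} (hlh : lo ≤ hi) {g : ℝ → ℂ}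
    (hg : IntervalIntegrable g volume lo hi)
    (h : ∀ x ∈ Icc lo hi, ∫ t in lo..x, g t = 0) :
    g =ᵐ[volume.restrict (Icc lo hi)] 0 := by
  rw [← restrict_Ioo_eq_restrict_Icc, EventuallyEq, ae_restrict_iff' measurableSet_Ioo]
  filter_upwards [hg.ae_hasDerivAt_integral] with x hx hxI
  have hxc : x ∈ Icc lo hi := Ioo_subset_Icc_self hxI
  have h1 := hx (by rwa [uIcc_of_le hlh]) lo left_mem_uIcc
  have h2 : (fun _ : ℝ => (0 : ℂ)) =ᶠ[𝓝 x] fun y => ∫ t in lo..y, g t := by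
    filter_upwards [Ioo_mem_nhds hxI.1 hxI.2] with y hy
    exact (h y (Ioo_subset_Icc_self hy)).symm
  exact h1.unique ((hasDerivAt_const x (0 : ℂ)).congr_of_eventuallyEq h2.symm)

theorem IsH2On.second_deriv_ae_zero {lo hi : ℝ} {U V G : ℝ → ℂ} (h : IsH2On lo hi U V G)
    (hU : U =ᵐ[volume.restrict (Icc lo hi)] 0) : G =ᵐ[volume.restrict (Icc lo hi)] 0 := by
  rcases lt_or_ge lo hi with hlt | hge
  · have hlo : lo ∈ Icc lo hi := left_mem_Icc.2 hlt.le
    have hhi : hi ∈ Icc lo hi := right_mem_Icc.2 hlt.le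
    have hU0 : EqOn U 0 (Icc lo hi) :=
      Measure.eqOn_Icc_of_ae_eq _ hlt.ne hU h.cont continuousOn_const
    have hV : V =ᵐ[volume.restrict (Icc lo hi)] 0 := by
      refine ae_zero_of_primitive hlt.le (h.intervalIntegrable_deriv hhi) fun x hx => ?_
      have := h.eq_integral x hx
      rw [hU0 hx, hU0 hlo] at this
      simpa using this.symm
    have hV0 : EqOn V 0 (Icc lo hi) :=
      Measure.eqOn_Icc_of_ae_eq _ hlt.ne hV h.cont_deriv continuousOn_const
    refine ae_zero_of_primitive hlt.le (h.intervalIntegrable hhi) fun x hx => ?_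
    have := h.deriv_eq_integral x hx
    rw [hV0 hx, hV0 hlo] at this
    simpa using this.symm
  · have : volume.restrict (Icc lo hi) = 0 := by
      rw [Measure.restrict_eq_zero, Real.volume_Icc, ENNReal.ofReal_eq_zero]
      linarith
    rw [this]
    simp [EventuallyEq]

theorem Edge.weight_pos (hμ : 0 < μ) (e : Edge) : 0 < e.weight μ := by
  cases e <;> simp only [Edge.weight, vertexWeight] <;> first | exact one_pos | skip
  all_goals split_ifs <;> [exact hμ; exact one_pos]

theorem ae_edgeMeasure (hμ : 0 < μ) (e : Edge) :
    ae (edgeMeasure a₁ a₂ a₃ μ e) = ae (edgeVolume a₁ a₂ a₃ e) :=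
  Measure.ae_ennreal_smul_measure_eq
    (by simpa [ENNReal.ofReal_eq_zero] using Edge.weight_pos hμ e) _

end Helpers

/-- The graph of the operator, as a subspace of `L₂^μ(𝒢) × L₂^μ(𝒢)`. -/
def opGraph (a₁ a₂ a₃ β μ : ℝ) :
    Submodule ℂ (L2G a₁ a₂ a₃ μ × L2G a₁ a₂ a₃ μ) where
  carrier := {p | IsOpPair a₁ a₂ a₃ β μ p.1 p.2}
  zero_mem' := by
    refine ⟨0, 0, 0, isInDomain_zero, fun e => ?_, fun e => ?_⟩
    · exact Lp.coeFn_zero _ _ _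
    · filter_upwards [Lp.coeFn_zero ℂ 2 (edgeMeasure a₁ a₂ a₃ μ e)] with x hx
      simpa using hx
  add_mem' := by
    rintro p q ⟨U, V, G, hd, hu, hf⟩ ⟨U', V', G', hd', hu', hf'⟩
    refine ⟨U + U', V + V', G + G', hd.add hd', fun e => ?_, fun e => ?_⟩
    · exact (Lp.coeFn_add (p.1 e) (q.1 e)).trans ((hu e).add (hu' e))
    · filter_upwards [Lp.coeFn_add (p.2 e) (q.2 e), hf e, hf' e] with x h1 h2 h3
      have h4 : ((p + q).2 e : ℝ → ℂ) x = (p.2 e : ℝ → ℂ) x + (q.2 e : ℝ → ℂ) x := h1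
      rw [h4, h2, h3]
      simp only [Pi.add_apply]
      ring
  smul_mem' := by
    rintro c p ⟨U, V, G, hd, hu, hf⟩
    refine ⟨c • U, c • V, c • G, hd.smul c, fun e => ?_, fun e => ?_⟩
    · exact (Lp.coeFn_smul c (p.1 e)).trans ((hu e).const_smul c)
    · filter_upwards [Lp.coeFn_smul c (p.2 e), hf e] with x h1 h2
      have h4 : ((c • p).2 e : ℝ → ℂ) x = c • (p.2 e : ℝ → ℂ) x := h1
      rw [h4, h2]
      simp

/-- The operator `𝒜^μ(β)` in `L₂^μ(𝒢)`, that is, `-d²/dx²` on every edge, with domain the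
`β`-quasi-periodic functions of `H²(𝒢)` that satisfy the weighted Kirchhoff conditions. -/
noncomputable def limitOp (a₁ a₂ a₃ β μ : ℝ) : L2G a₁ a₂ a₃ μ →ₗ.[ℂ] L2G a₁ a₂ a₃ μ :=
  (opGraph a₁ a₂ a₃ β μ).toLinearPMap

theorem snd_eq_zero_of_mem_opGraph {a₁ a₂ a₃ β μ : ℝ} (hμ : 0 < μ)
    (p : L2G a₁ a₂ a₃ μ × L2G a₁ a₂ a₃ μ) (hp : p ∈ opGraph a₁ a₂ a₃ β μ)
    (h0 : p.1 = 0) : p.2 = 0 := by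
  obtain ⟨U, V, G, hd, hu, hf⟩ := hp
  refine lp.ext (funext fun e => Lp.ext ?_)
  have hU : U e =ᵐ[edgeMeasure a₁ a₂ a₃ μ e] 0 := by
    refine (hu e).symm.trans ?_
    rw [h0]
    exact Lp.coeFn_zero _ _ _
  rw [EventuallyEq, ae_edgeMeasure hμ] at hU
  have hG := (hd.h2.edge e).second_deriv_ae_zero hU
  have hG' : G e =ᵐ[edgeMeasure a₁ a₂ a₃ μ e] 0 := by
    rw [EventuallyEq, ae_edgeMeasure hμ]
    exact hG
  filter_upwards [hf e, hG', Lp.coeFn_zero ℂ 2 (edgeMeasure a₁ a₂ a₃ μ e)] with x h1 h2 h3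
  have h4 : ((0 : L2G a₁ a₂ a₃ μ) e : ℝ → ℂ) x = 0 := h3
  rw [h4, h1, h2]
  simp

/-- For `μ > 0` the operator is single-valued, and its graph is the expected one:
`u` is in the domain and `𝒜^μ(β) u = f` if and only if `IsOpPair u f`. -/
theorem mem_graph_limitOp {a₁ a₂ a₃ β μ : ℝ} (hμ : 0 < μ) (u f : L2G a₁ a₂ a₃ μ) :
    (u, f) ∈ (limitOp a₁ a₂ a₃ β μ).graph ↔ IsOpPair a₁ a₂ a₃ β μ u f := by
  rw [limitOp, Submodule.toLinearPMap_graph_eq _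
    fun p hp h0 => snd_eq_zero_of_mem_opGraph hμ p hp h0]
  exact Iff.rfl

/-! ### The classification of the gaps -/

/-- The set `{(π n / a)², n ∈ ℤ}`. -/
def sigmaSet (a : ℝ) : Set ℝ := {x | ∃ n : ℤ, x = (Real.pi * n / a) ^ 2}

/-- The set `𝒲(β)`: the numbers `π n / a₃`, `n ≥ 1`, if `β ∉ {0, π}`, and the numbers
`β / a₃ + (2 n + 1) π / a₃`, `n ≥ 0`, if `β ∈ {0, π}`. -/
def W (a₃ β : ℝ) : Set ℝ :=
  {x | (β ≠ 0 ∧ β ≠ Real.pi ∧ ∃ n : ℕ, 1 ≤ n ∧ x = Real.pi * n / a₃) ∨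
    ((β = 0 ∨ β = Real.pi) ∧ ∃ n : ℕ, x = β / a₃ + (2 * n + 1) * Real.pi / a₃)}

/-- `(ω_b², ω_t²)` satisfies the conditions of type (i), where `ω₀` is the unique element of
`(ω_b, ω_t) ∩ 𝒲(β)`. -/
def IsTypeI (a₁ a₂ a₃ β ωb ωt ω₀ : ℝ) : Prop :=
  ωb ^ 2 ∉ sigmaSet a₁ ∪ sigmaSet a₂ ∧ ωt ^ 2 ∉ sigmaSet a₁ ∪ sigmaSet a₂ ∧
    Ioo ωb ωt ∩ W a₃ β = {ω₀}

/-- `(ω_b², ω_t²)` satisfies the conditions of type (ii). -/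
def IsTypeII (a₁ a₂ a₃ β ωb ωt : ℝ) : Prop :=
  ωb ^ 2 ∈ sigmaSet a₁ ∪ sigmaSet a₂ ∧ ωt ^ 2 ∉ sigmaSet a₁ ∪ sigmaSet a₂ ∧
    W a₃ β ∩ Ioo ωb ωt = ∅

/-- `(ω_b², ω_t²)` satisfies the conditions of type (iii). -/
def IsTypeIII (a₁ a₂ a₃ β ωb ωt : ℝ) : Prop :=
  ωb ^ 2 ∉ sigmaSet a₁ ∪ sigmaSet a₂ ∧ ωt ^ 2 ∈ sigmaSet a₁ ∪ sigmaSet a₂ ∧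
    W a₃ β ∩ Ioo ωb ωt = ∅

end LimitGraph

/-! Reduction to the lattice. Let `p` be the vertex values of a solution of `-u'' = ω² u` satisfying
the vertex conditions. As long as `sin (ω a₁)`, `sin (ω a₂)` and `sin (ω a₃)` do not vanish, `p`
determines the solution on every edge, and the Kirchhoff conditions become `T p = (g + C) p + (μ -
1) g p(0) δ₀` on `ℤ²`. Here `T` hops to the neighbours with amplitudes `1 / (2 sin (ω a₁))` and `1 /
(2 sin (ω a₂))`, `g` is `verticalTerm`, `C` is `bandCenter`, and `‖T‖` is at most `R`, which is
`bandRadius`. The bands are given by `|g + C| ≤ R`, together with the zeros of `sin (ω a₁)` and `sin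
(ω a₂)`; multiplying by `sin (ω a₃)` covers the zeros of that sine as well.

Bands. At a band frequency there is a bounded wave for `μ = 1` (a Bloch wave, or a sine wave
vanishing at all vertices). Cut off on larger and larger plateaus that recede from the origin, it
yields a singular sequence for every `μ > 0`; this is `mem_essSpectrum_of_band`. Off the bands, `T -
(g + C)` is invertible, hence `𝒜(β) - ω²` is bounded below (`exists_norm_le`). Self-adjointness is
not needed: an end point of a gap is a limit of resolvent points, so a bound from below there would
put it in the resolvent set (`mem_resolventSet_of_approx`). Hence an end point outside `σ₁ ∪ σ₂`
satisfies the band condition.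

Case `μ > 1`. The energy identity shows that an eigenvalue is `ω²` with `ω > 0`. Off the bands `|C|
< R < |g + C|`, so `g` has the sign of `g + C`; pairing the lattice equation with `p`, the defect
term only increases the modulus of the right side, which already exceeds `R ‖p‖²`, so `p = 0`
(`vertexValue_eq_zero`).

Case `μ < 1`. A change of signs makes the amplitudes positive. With `E = g + C` and `G` the value at
the origin of `(E - T)⁻¹ δ₀`, the equation has a nonzero square summable solution as soon as `(1 -
μ) g G = 1`. Consider an interval of the gap between a singular point `α` and a regular band edge `τ
> α`. There `g` decreases and `R - C` increases, so `E > R` and `g > 0`. Near `τ`, `E - R` tends to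
`0` and `G` blows up because the walk on `ℤ²` is recurrent (`exists_le_green`). Near `α`, either `g`
is unbounded, and `G ≤ 1 / (E - R)` makes the product at most `1`, or an amplitude blows up while
`g` stays bounded, and `G` becomes small. The intermediate value theorem gives `ω`
(`exists_vertexEquation`); the reflection `ω ↦ -ω` treats `τ < α`. In type (i), `ω₀` is a pole of
`g` and splits the gap into two such intervals; in types (ii) and (iii) the whole gap is one. -/

set_option autoImplicit false

/-! ### Spectrum, essential spectrum and perturbation of the resolvent. -/

namespace UnboundedOp

variable {H : Type*} [NormedAddCommGroup H] [InnerProductSpace ℂ H]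

theorem essSpectrum_subset_spectrum (T : H →ₗ.[ℂ] H) : essSpectrum T ⊆ spectrum T := by
  rintro z ⟨u, hu1, -, hu3⟩ ⟨-, C, hC⟩
  have h0 : Tendsto (fun n => C * ‖T (u n) - z • (u n : H)‖) atTop (𝓝 0) := by
    simpa using hu3.norm.const_mul C
  have h1 : (1 : ℝ) ≤ 0 := ge_of_tendsto' h0 fun n => by simpa [hu1 n] using hC (u n)
  linarith

/-- A limit of resolvent points at which `T - z` is bounded below is a resolvent point. -/
theorem mem_resolventSet_of_approx [CompleteSpace H] (T : H →ₗ.[ℂ] H) {z : ℂ} {C : ℝ}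
    (hC : ∀ u : T.domain, ‖(u : H)‖ ≤ C * ‖T u - z • (u : H)‖)
    (hz : ∀ ε > 0, ∃ z' ∈ resolventSet T, ‖z' - z‖ < ε) : z ∈ resolventSet T := by
  set K : ℝ := max C 1 with hK
  have hK1 : 1 ≤ K := le_max_right _ _
  have hKC : ∀ u : T.domain, ‖(u : H)‖ ≤ K * ‖T u - z • (u : H)‖ := fun u =>
    (hC u).trans (mul_le_mul_of_nonneg_right (le_max_left _ _) (norm_nonneg _))
  -- With `K |z' - z| ≤ 1/4`, the lower bound at `z` passes to `z'` with constant `2 K`, and the map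
  -- below contracts with factor `1/2`.
  obtain ⟨z', ⟨⟨hinj, hsurj⟩, -⟩, hzz⟩ := hz (1 / (4 * K)) (by positivity)
  have hKz : K * ‖z' - z‖ ≤ 1 / 4 := by
    have := mul_le_mul_of_nonneg_left hzz.le (by linarith : 0 ≤ K)
    have h4 : K * (1 / (4 * K)) = 1 / 4 := by field_simp
    linarith
  have hbd : ∀ u : T.domain, ‖(u : H)‖ ≤ 2 * K * ‖T u - z' • (u : H)‖ := by
    intro u
    have h1 : T u - z • (u : H) = (T u - z' • (u : H)) + (z' - z) • (u : H) := by module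
    have h2 := hKC u
    rw [h1] at h2
    have h3 := norm_add_le (T u - z' • (u : H)) ((z' - z) • (u : H))
    rw [norm_smul] at h3
    have h4 := mul_le_mul_of_nonneg_left h3 (by linarith : 0 ≤ K)
    have h5 := mul_le_mul_of_nonneg_right hKz (norm_nonneg (u : H))
    nlinarith [norm_nonneg (u : H)]
  refine ⟨⟨fun u v huv => ?_, fun f => ?_⟩, C, hC⟩
  · have h := hKC (u - v)
    have h0 : T (u - v) - z • ((u - v : T.domain) : H) = 0 := by
      have : T u - z • (u : H) = T v - z • (v : H) := huv
      rw [LinearPMap.map_sub, Submodule.coe_sub, smul_sub]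
      rw [sub_sub_sub_comm, this, sub_self]
    rw [h0, norm_zero, mul_zero] at h
    have : ((u - v : T.domain) : H) = 0 := norm_le_zero_iff.1 h
    exact sub_eq_zero.1 (Subtype.ext this)
  · choose r hr using hsurj
    simp only at hr
    have hlip : ∀ a b : H, ‖(r a : H) - r b‖ ≤ 2 * K * ‖a - b‖ := by
      intro a b
      have h := hbd (r a - r b)
      have h0 : T (r a - r b) - z' • ((r a - r b : T.domain) : H) = a - b := by
        rw [LinearPMap.map_sub, Submodule.coe_sub, smul_sub]
        rw [sub_sub_sub_comm, hr a, hr b]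
      rw [h0] at h
      simpa using h
    -- Here `r` is the resolvent at `z'`. At a fixed point `h` one has `(T - z) (r h) = h + (z' - z)
    -- (r h) = f`; this replaces the Neumann series.
    have hcontr : ContractingWith (1 / 2) fun h : H => f - (z' - z) • (r h : H) := by
      refine ⟨by norm_num, LipschitzWith.of_dist_le_mul fun a b => ?_⟩
      rw [dist_eq_norm, dist_eq_norm]
      have h0 : f - (z' - z) • (r a : H) - (f - (z' - z) • (r b : H))
          = -((z' - z) • ((r a : H) - r b)) := by module
      rw [h0, norm_neg, norm_smul]
      have h1 := mul_le_mul_of_nonneg_left (hlip a b) (norm_nonneg (z' - z))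
      have h2 := mul_le_mul_of_nonneg_right hKz (norm_nonneg (a - b))
      norm_num
      nlinarith
    have hfix := hcontr.fixedPoint_isFixedPt
    set h := ContractingWith.fixedPoint _ hcontr
    refine ⟨r h, ?_⟩
    have h1 : f - (z' - z) • (r h : H) = h := hfix
    show T (r h) - z • (r h : H) = f
    have h2 : T (r h) - z • (r h : H) = (T (r h) - z' • (r h : H)) + (z' - z) • (r h : H) := by
      module
    rw [h2, hr h]
    exact (sub_eq_iff_eq_add.1 h1).symm

end UnboundedOp

/-! ### Norms in the weighted space, and the operator read through its graph. -/

namespace LimitGraph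

variable {a₁ a₂ a₃ β μ : ℝ}

theorem memLp_edgeMeasure {W : ℝ → ℂ} {e : Edge} (h : MemLp W 2 (edgeVolume a₁ a₂ a₃ e)) :
    MemLp W 2 (edgeMeasure a₁ a₂ a₃ μ e) :=
  h.smul_measure ENNReal.ofReal_ne_top

theorem norm_sq_edge (hμ : 0 < μ) {e : Edge} (u : Lp ℂ 2 (edgeMeasure a₁ a₂ a₃ μ e))
    {W : ℝ → ℂ} (h : (u : ℝ → ℂ) =ᵐ[edgeMeasure a₁ a₂ a₃ μ e] W) :
    ‖u‖ ^ 2 = e.weight μ * ∫ x, ‖W x‖ ^ 2 ∂(edgeVolume a₁ a₂ a₃ e) := by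
  have h1 : ‖u‖ ^ 2 = RCLike.re (inner ℂ u u) := norm_sq_eq_re_inner (𝕜 := ℂ) u
  rw [h1, L2.inner_def]
  have h2 : ∫ x, inner ℂ ((u : ℝ → ℂ) x) ((u : ℝ → ℂ) x) ∂(edgeMeasure a₁ a₂ a₃ μ e)
      = ∫ x, ((‖W x‖ ^ 2 : ℝ) : ℂ) ∂(edgeMeasure a₁ a₂ a₃ μ e) := by
    refine integral_congr_ae ?_
    filter_upwards [h] with x hx
    rw [hx, inner_self_eq_norm_sq_to_K]
    push_cast
    rfl
  rw [h2, integral_complex_ofReal, edgeMeasure, integral_smul_measure,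
    ENNReal.toReal_ofReal (Edge.weight_pos hμ e).le]
  simp

theorem hasSum_norm_sq (hμ : 0 < μ) (u : L2G a₁ a₂ a₃ μ) {W : Edge → ℝ → ℂ}
    (h : ∀ e, (u e : ℝ → ℂ) =ᵐ[edgeMeasure a₁ a₂ a₃ μ e] W e) :
    HasSum (fun e => e.weight μ * ∫ x, ‖W e x‖ ^ 2 ∂(edgeVolume a₁ a₂ a₃ e)) (‖u‖ ^ 2) := by
  have h1 := lp.hasSum_norm (p := 2) (by norm_num) u
  have h2 : ∀ e, ‖u e‖ ^ (2 : ℝ≥0∞).toReal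
      = e.weight μ * ∫ x, ‖W e x‖ ^ 2 ∂(edgeVolume a₁ a₂ a₃ e) := fun e => by
    rw [← norm_sq_edge hμ (u e) (h e)]
    norm_num
  simp_rw [h2] at h1
  simpa using h1

theorem Edge.weight_le (e : Edge) : e.weight μ ≤ max μ 1 := by
  cases e <;> simp only [Edge.weight, vertexWeight] <;> (try split_ifs) <;> simp

theorem Edge.min_le_weight (e : Edge) : min μ 1 ≤ e.weight μ := by
  cases e <;> simp only [Edge.weight, vertexWeight] <;> (try split_ifs) <;> simp

theorem exists_L2G (hμ : 0 < μ) {W : Edge → ℝ → ℂ} (h : SqIntegrable a₁ a₂ a₃ W) :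
    ∃ u : L2G a₁ a₂ a₃ μ, ∀ e, (u e : ℝ → ℂ) =ᵐ[edgeMeasure a₁ a₂ a₃ μ e] W e := by
  have hm : Memℓp (fun e => (memLp_edgeMeasure (μ := μ) (h.1 e)).toLp (W e)) 2 := by
    refine memℓp_gen ?_
    refine Summable.of_nonneg_of_le (fun e => by positivity) (fun e => ?_)
      (h.2.mul_left (max μ 1))
    have := norm_sq_edge hμ ((memLp_edgeMeasure (μ := μ) (h.1 e)).toLp (W e))
      (MemLp.coeFn_toLp _)
    rw [ENNReal.toReal_ofNat, Real.rpow_two, this]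
    exact mul_le_mul_of_nonneg_right (Edge.weight_le e) (integral_nonneg fun x => by positivity)
  exact ⟨⟨_, hm⟩, fun e => MemLp.coeFn_toLp (memLp_edgeMeasure (h.1 e))⟩

theorem isEigenvalue_of_isOpPair (hμ : 0 < μ) {z : ℂ} {u : L2G a₁ a₂ a₃ μ} (hu : u ≠ 0)
    (h : IsOpPair a₁ a₂ a₃ β μ u (z • u)) :
    UnboundedOp.IsEigenvalue (limitOp a₁ a₂ a₃ β μ) z := by
  rw [← mem_graph_limitOp hμ, LinearPMap.mem_graph_iff] at h
  obtain ⟨v, hv1, hv2⟩ := h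
  simp only at hv1 hv2
  refine ⟨v, fun h0 => hu (by rw [← hv1, h0]; rfl), by rw [hv2, hv1]⟩

theorem isOpPair_of_domain (hμ : 0 < μ) (u : (limitOp a₁ a₂ a₃ β μ).domain) :
    IsOpPair a₁ a₂ a₃ β μ u (limitOp a₁ a₂ a₃ β μ u) := by
  rw [← mem_graph_limitOp hμ]
  exact (limitOp a₁ a₂ a₃ β μ).mem_graph u

theorem exists_domain_of_isOpPair (hμ : 0 < μ) {u f : L2G a₁ a₂ a₃ μ}
    (h : IsOpPair a₁ a₂ a₃ β μ u f) :
    ∃ v : (limitOp a₁ a₂ a₃ β μ).domain, (v : L2G a₁ a₂ a₃ μ) = u ∧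
      limitOp a₁ a₂ a₃ β μ v = f := by
  rw [← mem_graph_limitOp hμ, LinearPMap.mem_graph_iff] at h
  exact h

end LimitGraph

/-! ### Integration by parts and trace inequalities for complex primitives. -/

theorem absolutelyContinuousOnInterval_ofReal {f : ℝ → ℝ} {a b : ℝ}
    (h : AbsolutelyContinuousOnInterval f a b) :
    AbsolutelyContinuousOnInterval (fun x => (f x : ℂ)) a b := by
  have hc : AbsolutelyContinuousOnInterval (fun _ : ℝ => (1 : ℂ)) a b :=
    LipschitzOnWith.absolutelyContinuousOnInterval (K := 0)
      ((LipschitzWith.const (1 : ℂ)).lipschitzOnWith)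
  have he : (fun x => (f x : ℂ)) = f • fun _ : ℝ => (1 : ℂ) :=
    funext fun x => by simp [Pi.smul_apply']
  rw [he]
  exact h.smul hc

theorem MeasureTheory.Integrable.absolutelyContinuousOnInterval_complex {g : ℝ → ℂ}
    (h : Integrable g) (a b : ℝ) :
    AbsolutelyContinuousOnInterval (fun x => ∫ t in a..x, g t) a b := by
  have hre : Integrable fun t => (g t).re := h.re
  have him : Integrable fun t => (g t).im := h.im
  have h1 := absolutelyContinuousOnInterval_ofReal
    ((hre.intervalIntegrable (a := a) (b := b)).absolutelyContinuousOnInterval_intervalIntegral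
      left_mem_uIcc)
  have h2 := absolutelyContinuousOnInterval_ofReal
    ((him.intervalIntegrable (a := a) (b := b)).absolutelyContinuousOnInterval_intervalIntegral
      left_mem_uIcc)
  refine (congrArg (AbsolutelyContinuousOnInterval · a b) (funext fun x => ?_)).mpr
    (h1.add (h2.const_smul Complex.I))
  simp only [Pi.add_apply, smul_eq_mul]
  rw [← intervalIntegral.integral_ofReal, ← intervalIntegral.integral_ofReal,
    ← intervalIntegral.integral_const_mul, ← intervalIntegral.integral_add]
  · refine intervalIntegral.integral_congr fun t _ => ?_
    simp only [mul_comm Complex.I]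
    exact (Complex.re_add_im _).symm
  · exact hre.ofReal.intervalIntegrable
  · exact (him.ofReal.const_mul Complex.I).intervalIntegrable

/-- An absolutely continuous function that coincides on `[a, b]` with the primitive of `g`. -/
theorem IntervalIntegrable.exists_primitive {g : ℝ → ℂ} {a b : ℝ} (hab : a ≤ b)
    (h : IntervalIntegrable g volume a b) :
    ∃ K : ℝ → ℂ, AbsolutelyContinuousOnInterval K a b ∧
      (∀ x ∈ Icc a b, K x = ∫ t in a..x, g t) ∧
      ∀ᵐ x, x ∈ uIcc a b → HasDerivAt K (g x) x := by
  -- Extending `g` by zero gives an integrable function on the line. The primitive is unchanged on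
  -- `[a, b]`, and the two end points, where two-sided derivatives may differ, form a null set.
  have hi : Integrable ((Icc a b).indicator g) := by
    rw [integrable_indicator_iff measurableSet_Icc]
    exact (intervalIntegrable_iff_integrableOn_Icc_of_le hab).1 h
  have heq : ∀ x ∈ Icc a b, ∫ t in a..x, (Icc a b).indicator g t = ∫ t in a..x, g t := by
    intro x hx
    refine intervalIntegral.integral_congr fun t ht => ?_
    rw [uIcc_of_le hx.1] at ht
    exact indicator_of_mem (show t ∈ Icc a b from ⟨ht.1, ht.2.trans hx.2⟩) g
  refine ⟨_, hi.absolutelyContinuousOnInterval_complex a b, heq, ?_⟩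
  filter_upwards [h.ae_hasDerivAt_integral, compl_mem_ae_iff.2 (measure_singleton a),
    compl_mem_ae_iff.2 (measure_singleton b)] with x hx hxa hxb hxI
  refine (hx hxI a left_mem_uIcc).congr_of_eventuallyEq ?_
  rw [uIcc_of_le hab] at hxI
  filter_upwards [Icc_mem_nhds (lt_of_le_of_ne hxI.1 (Ne.symm hxa))
    (lt_of_le_of_ne hxI.2 hxb)] with y hy
  exact heq y hy

/-- Product rule for the primitive of an integrable function and a `C¹` function. -/
theorem primitive_mul_sub {F g φ φ' : ℝ → ℂ} {a b : ℝ} (hab : a ≤ b)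
    (hg : IntervalIntegrable g volume a b)
    (hF : ∀ x ∈ Icc a b, F x = F a + ∫ t in a..x, g t)
    (hφ : ∀ x, HasDerivAt φ (φ' x) x) (hφ' : Continuous φ') :
    F b * φ b - F a * φ a = ∫ t in a..b, (g t * φ t + F t * φ' t) := by
  have hφc : Continuous φ := continuous_iff_continuousAt.2 fun x => (hφ x).continuousAt
  obtain ⟨K, hK1, hK2, hK3⟩ := hg.exists_primitive hab
  have hKF : ∀ x ∈ Icc a b, F x = F a + K x := fun x hx => by rw [hF x hx, hK2 x hx]
  have hFc : ContinuousOn F (uIcc a b) := by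
    rw [uIcc_of_le hab]
    refine (continuousOn_const.add ?_).congr hKF
    simpa [uIcc_of_le hab] using hK1.continuousOn
  have hi : IntervalIntegrable (fun t => g t * φ t + F t * φ' t) volume a b :=
    (hg.mul_continuousOn hφc.continuousOn).add
      (hFc.mul hφ'.continuousOn).intervalIntegrable
  obtain ⟨P, hP1, hP2, hP3⟩ := hi.exists_primitive hab
  have hφac : AbsolutelyContinuousOnInterval φ a b := by
    have hd : Differentiable ℝ φ := fun x => (hφ x).differentiableAt
    have : ContDiff ℝ 1 φ := contDiff_one_iff_deriv.2
      ⟨hd, by rwa [show deriv φ = φ' from funext fun x => (hφ x).deriv]⟩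
    exact this.contDiffOn.absolutelyContinuousOnInterval
  have hcK : AbsolutelyContinuousOnInterval (fun x => F a + K x) a b := by
    have hc : AbsolutelyContinuousOnInterval (fun _ : ℝ => F a) a b :=
      LipschitzOnWith.absolutelyContinuousOnInterval (K := 0)
        ((LipschitzWith.const (F a)).lipschitzOnWith)
    exact hc.add hK1
  -- The difference between the product and the primitive of its formal derivative is absolutely
  -- continuous with derivative zero a.e., hence constant.
  have hac : AbsolutelyContinuousOnInterval (fun x => (F a + K x) * φ x - P x) a b :=
    (hcK.smul hφac).sub hP1
  obtain ⟨C, hC⟩ := hac.const_of_ae_hasDerivAt_zero (by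
    filter_upwards [hK3, hP3] with x h1 h2 hx
    have hxI : x ∈ Icc a b := by rwa [uIcc_of_le hab] at hx
    have := (((h1 hx).const_add (F a)).mul (hφ x)).sub (h2 hx)
    rw [hKF x hxI, sub_self] at this
    exact this)
  have ha := hC a left_mem_uIcc
  have hb := hC b right_mem_uIcc
  have haI : a ∈ Icc a b := ⟨le_rfl, hab⟩
  have hbI : b ∈ Icc a b := ⟨hab, le_rfl⟩
  have hPa := hP2 a haI
  have hPb := hP2 b hbI
  rw [← hKF a haI, hPa, intervalIntegral.integral_same] at ha
  rw [← hKF b hbI, hPb] at hb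
  linear_combination hb - ha

/-- Cauchy–Schwarz, with the constant of the full interval so that the same bound serves all
subintervals and both orientations. -/
theorem sq_norm_integral_le {f : ℝ → ℂ} {lo hi x y : ℝ} (hlh : lo < hi)
    (hf : MemLp f 2 (volume.restrict (Icc lo hi))) (hx : x ∈ Icc lo hi) (hy : y ∈ Icc lo hi) :
    ‖∫ t in x..y, f t‖ ^ 2 ≤ (hi - lo) * ∫ t in Icc lo hi, ‖f t‖ ^ 2 := by
  have hi1 : IntegrableOn f (Icc lo hi) := hf.integrable (by norm_num)
  have hi2 : IntegrableOn (fun t => ‖f t‖ ^ 2) (Icc lo hi) :=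
    hf.integrable_norm_pow (p := 2) (by norm_num)
  have hL : 0 < hi - lo := sub_pos.2 hlh
  set J := ∫ t in Icc lo hi, ‖f t‖ with hJ
  set S := ∫ t in Icc lo hi, ‖f t‖ ^ 2 with hS
  have hJ0 : 0 ≤ J := integral_nonneg fun t => norm_nonneg _
  have h1 : ‖∫ t in x..y, f t‖ ≤ J := by
    refine intervalIntegral.norm_integral_le_integral_norm_uIoc.trans ?_
    refine setIntegral_mono_set hi1.norm (Eventually.of_forall fun t => norm_nonneg _) ?_
    exact (uIoc_subset_uIcc.trans (uIcc_subset_Icc hx hy)).eventuallyLE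
  -- Integrate `2 m |f| ≤ |f|² + m²` with `m` the mean of `|f|`, the choice that makes the
  -- inequality optimal.
  have h2 : 2 * (J / (hi - lo)) * J ≤ S + (J / (hi - lo)) ^ 2 * (hi - lo) := by
    have h3 : ∫ t in Icc lo hi, 2 * (J / (hi - lo)) * ‖f t‖
        ≤ ∫ t in Icc lo hi, (‖f t‖ ^ 2 + (J / (hi - lo)) ^ 2) := by
      refine integral_mono (hi1.norm.const_mul _)
        (hi2.add (integrable_const _)) fun t => ?_
      simp only
      nlinarith [sq_nonneg (‖f t‖ - J / (hi - lo))]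
    rw [integral_const_mul, integral_add hi2 (integrable_const _)] at h3
    simpa [hL.le, mul_comm] using h3
  have h4 : J ^ 2 ≤ (hi - lo) * S := by
    have h5 := mul_le_mul_of_nonneg_left h2 hL.le
    field_simp at h5
    nlinarith
  exact (pow_le_pow_left₀ (norm_nonneg _) h1 2).trans h4

/-- Trace inequality at any point of the interval. -/
theorem sq_norm_trace_le {F g : ℝ → ℂ} {lo hi x : ℝ} (hlh : lo < hi)
    (hFc : ContinuousOn F (Icc lo hi)) (hg : MemLp g 2 (volume.restrict (Icc lo hi)))
    (hF : ∀ x ∈ Icc lo hi, F x = F lo + ∫ t in lo..x, g t) (hx : x ∈ Icc lo hi) :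
    (hi - lo) * ‖F x‖ ^ 2 ≤ 2 * (∫ t in Icc lo hi, ‖F t‖ ^ 2)
      + 2 * (hi - lo) ^ 2 * ∫ t in Icc lo hi, ‖g t‖ ^ 2 := by
  have hL : 0 < hi - lo := sub_pos.2 hlh
  have hi2 : IntegrableOn (fun t => ‖F t‖ ^ 2) (Icc lo hi) :=
    (hFc.norm.pow 2).integrableOn_Icc
  have hgi : IntervalIntegrable g volume lo hi := by
    rw [intervalIntegrable_iff_integrableOn_Icc_of_le hlh.le]
    exact hg.integrable (by norm_num)
  have hsub : ∀ y ∈ Icc lo hi, IntervalIntegrable g volume lo y := fun y hy =>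
    hgi.mono_set (by
      rw [uIcc_of_le hlh.le, uIcc_of_le hy.1]; exact Icc_subset_Icc_right hy.2)
  set S := ∫ t in Icc lo hi, ‖g t‖ ^ 2
  -- `F x` is compared with `F y` for every `y`; averaging over `y` then gives the trace bound.
  have key : ∀ y ∈ Icc lo hi, ‖F x‖ ^ 2 ≤ 2 * ‖F y‖ ^ 2 + 2 * ((hi - lo) * S) := by
    intro y hy
    have h1 : F x = F y + ∫ t in y..x, g t := by
      rw [hF x hx, hF y hy, add_assoc, intervalIntegral.integral_add_adjacent_intervals
        (hsub y hy) ((hsub y hy).symm.trans (hsub x hx))]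
    have h2 := sq_norm_integral_le hlh hg hy hx
    have h3 : ‖F x‖ ≤ ‖F y‖ + ‖∫ t in y..x, g t‖ := by
      conv_lhs => rw [h1]
      exact norm_add_le _ _
    nlinarith [norm_nonneg (F x), norm_nonneg (F y), norm_nonneg (∫ t in y..x, g t),
      sq_nonneg (‖F y‖ - ‖∫ t in y..x, g t‖)]
  have h3 : ∫ _ in Icc lo hi, ‖F x‖ ^ 2
      ≤ ∫ t in Icc lo hi, (2 * ‖F t‖ ^ 2 + 2 * ((hi - lo) * S)) :=
    setIntegral_mono_on (integrable_const _) ((hi2.const_mul 2).add (integrable_const _))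
      measurableSet_Icc fun t ht => key t ht
  rw [integral_add (hi2.const_mul 2) (integrable_const _), integral_const_mul] at h3
  simp [hL.le] at h3
  nlinarith

/-! ### The inhomogeneous equation on a single edge. -/

namespace LimitGraph

section EdgeODE

variable {lo hi x ω : ℝ} {U V G : ℝ → ℂ}

theorem IsH2On.memLp_fun (h : IsH2On lo hi U V G) :
    MemLp U 2 (volume.restrict (Icc lo hi)) := by
  obtain ⟨C, hC⟩ := isCompact_Icc.exists_bound_of_continuousOn h.cont
  refine MemLp.of_bound (h.cont.aestronglyMeasurable measurableSet_Icc) C ?_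
  rw [ae_restrict_iff' measurableSet_Icc]
  exact Eventually.of_forall hC

/-- Two integrations by parts against a solution of the homogeneous equation. Taking for `φ` a sine
or cosine centred at `x` turns this into Duhamel's formula for `U x` or `V x`. -/
theorem IsH2On.green (h : IsH2On lo hi U V G) (hx : x ∈ Icc lo hi) {φ φ' : ℝ → ℂ}
    (hφ : ∀ t, HasDerivAt φ (φ' t) t) (hφ' : ∀ t, HasDerivAt φ' (-(ω : ℂ) ^ 2 * φ t) t) :
    V x * φ x - U x * φ' x - (V lo * φ lo - U lo * φ' lo)
      = ∫ t in lo..x, (G t + (ω : ℂ) ^ 2 * U t) * φ t := by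
  have hc : Continuous φ := continuous_iff_continuousAt.2 fun x => (hφ x).continuousAt
  have hc' : Continuous φ' := continuous_iff_continuousAt.2 fun x => (hφ' x).continuousAt
  have hs : Icc lo x ⊆ Icc lo hi := Icc_subset_Icc_right hx.2
  have hUc : ContinuousOn U (uIcc lo x) := by
    rw [uIcc_of_le hx.1]; exact h.cont.mono hs
  have hVc : ContinuousOn V (uIcc lo x) := by
    rw [uIcc_of_le hx.1]; exact h.cont_deriv.mono hs
  have h1 := primitive_mul_sub hx.1 (h.intervalIntegrable hx)
    (fun y hy => h.deriv_eq_integral y (hs hy)) hφ hc'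
  have h2 := primitive_mul_sub hx.1 (h.intervalIntegrable_deriv hx)
    (fun y hy => h.eq_integral y (hs hy)) hφ' (continuous_const.mul hc)
  have i1 : IntervalIntegrable (fun t => G t * φ t + V t * φ' t) volume lo x :=
    ((h.intervalIntegrable hx).mul_continuousOn hc.continuousOn).add
      (hVc.mul hc'.continuousOn).intervalIntegrable
  have i2 : IntervalIntegrable (fun t => V t * φ' t + U t * (-(ω : ℂ) ^ 2 * φ t)) volume lo x :=
    ((hVc.mul hc'.continuousOn).add
      (hUc.mul (continuous_const.mul hc).continuousOn)).intervalIntegrable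
  have h3 : V x * φ x - V lo * φ lo - (U x * φ' x - U lo * φ' lo)
      = ∫ t in lo..x, (G t + (ω : ℂ) ^ 2 * U t) * φ t := by
    rw [h1, h2, ← intervalIntegral.integral_sub i1 i2]
    exact intervalIntegral.integral_congr fun t _ => by ring
  rw [← h3]
  ring

theorem hasDerivAt_sin_sub (ω x t : ℝ) :
    HasDerivAt (fun t : ℝ => ((Real.sin (ω * (x - t)) : ℝ) : ℂ))
      ((-(ω * Real.cos (ω * (x - t))) : ℝ) : ℂ) t := by
  have h : HasDerivAt (fun t : ℝ => ω * (x - t)) (-ω) t := by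
    simpa using ((hasDerivAt_id t).const_sub x).const_mul ω
  have := h.sin.ofReal_comp
  convert this using 1
  push_cast
  ring

theorem hasDerivAt_cos_sub (ω x t : ℝ) :
    HasDerivAt (fun t : ℝ => ((Real.cos (ω * (x - t)) : ℝ) : ℂ))
      ((ω * Real.sin (ω * (x - t)) : ℝ) : ℂ) t := by
  have h : HasDerivAt (fun t : ℝ => ω * (x - t)) (-ω) t := by
    simpa using ((hasDerivAt_id t).const_sub x).const_mul ω
  have := h.cos.ofReal_comp
  convert this using 1
  push_cast
  ring

/-- The inhomogeneous equation `-u'' = ω² u + f`, as an initial value problem. -/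
theorem IsH2On.eq_initial (h : IsH2On lo hi U V G) (hx : x ∈ Icc lo hi) :
    (ω : ℂ) * U x = ω * Real.cos (ω * (x - lo)) * U lo + Real.sin (ω * (x - lo)) * V lo
      + ∫ t in lo..x, (G t + (ω : ℂ) ^ 2 * U t) * (Real.sin (ω * (x - t)) : ℝ) := by
  -- The sine centred at `x` vanishes at `x` with slope `-ω`, so only `ω U x` survives there;
  -- keeping the factor `ω` avoids a division.
  have h1 := h.green (ω := ω) hx (fun t => hasDerivAt_sin_sub ω x t) (fun t => by
    refine (((hasDerivAt_cos_sub ω x t).const_mul (-(ω : ℂ))).congr_deriv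
      (by simp only [Complex.ofReal_mul]; ring)).congr_of_eventuallyEq
      (Eventually.of_forall fun s => by simp))
  rw [← h1]
  simp
  ring

theorem IsH2On.deriv_eq_initial (h : IsH2On lo hi U V G) (hx : x ∈ Icc lo hi) :
    V x = Real.cos (ω * (x - lo)) * V lo - ω * Real.sin (ω * (x - lo)) * U lo
      + ∫ t in lo..x, (G t + (ω : ℂ) ^ 2 * U t) * (Real.cos (ω * (x - t)) : ℝ) := by
  have h1 := h.green (ω := ω) hx (fun t => hasDerivAt_cos_sub ω x t) (fun t => by
    refine (((hasDerivAt_sin_sub ω x t).const_mul (ω : ℂ)).congr_deriv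
      (by simp only [Complex.ofReal_mul, Complex.ofReal_neg]; ring)).congr_of_eventuallyEq
      (Eventually.of_forall fun s => by simp))
  rw [← h1]
  simp
  ring

theorem IsH2On.memLp_residual (h : IsH2On lo hi U V G) :
    MemLp (fun t => G t + (ω : ℂ) ^ 2 * U t) 2 (volume.restrict (Icc lo hi)) :=
  h.memLp.add (h.memLp_fun.const_mul _)

theorem IsH2On.sq_norm_source_le (h : IsH2On lo hi U V G) (hlh : lo < hi) (hx : x ∈ Icc lo hi)
    {φ : ℝ → ℝ} (hφ : Continuous φ) (hφ1 : ∀ t, |φ t| ≤ 1) :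
    ‖∫ t in lo..x, (G t + (ω : ℂ) ^ 2 * U t) * (φ t : ℂ)‖ ^ 2
      ≤ (hi - lo) * ∫ t in Icc lo hi, ‖G t + (ω : ℂ) ^ 2 * U t‖ ^ 2 := by
  have hL : 0 < hi - lo := sub_pos.2 hlh
  have hm := h.memLp_residual (ω := ω)
  have hle : ∀ t, ‖(G t + (ω : ℂ) ^ 2 * U t) * (φ t : ℂ)‖ ≤ ‖G t + (ω : ℂ) ^ 2 * U t‖ := by
    intro t
    rw [norm_mul, Complex.norm_real, Real.norm_eq_abs]
    exact mul_le_of_le_one_right (norm_nonneg _) (hφ1 t)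
  have hm' : MemLp (fun t => (G t + (ω : ℂ) ^ 2 * U t) * (φ t : ℂ)) 2
      (volume.restrict (Icc lo hi)) :=
    hm.mono (hm.1.mul (Complex.continuous_ofReal.comp hφ).aestronglyMeasurable)
      (Eventually.of_forall hle)
  refine (sq_norm_integral_le hlh hm' (left_mem_Icc.2 hlh.le) hx).trans ?_
  refine mul_le_mul_of_nonneg_left (integral_mono (hm'.integrable_norm_pow (p := 2) (by norm_num))
    (hm.integrable_norm_pow (p := 2) (by norm_num)) fun t => ?_) hL.le
  exact pow_le_pow_left₀ (norm_nonneg _) (hle t) 2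

/-- Each of the three terms of Duhamel's formula is bounded pointwise; `3` comes from squaring their
sum and one factor `hi - lo` from integrating. The mass of an edge is thus controlled by initial
data and residual. -/
theorem IsH2On.integral_sq_norm_le (h : IsH2On lo hi U V G) (hlh : lo < hi) :
    ω ^ 2 * ∫ t in Icc lo hi, ‖U t‖ ^ 2 ≤ 3 * (hi - lo) * (ω ^ 2 * ‖U lo‖ ^ 2 + ‖V lo‖ ^ 2
      + (hi - lo) * ∫ t in Icc lo hi, ‖G t + (ω : ℂ) ^ 2 * U t‖ ^ 2) := by
  have hL : 0 < hi - lo := sub_pos.2 hlh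
  set S := ∫ t in Icc lo hi, ‖G t + (ω : ℂ) ^ 2 * U t‖ ^ 2
  have key : ∀ x ∈ Icc lo hi, ω ^ 2 * ‖U x‖ ^ 2
      ≤ 3 * (ω ^ 2 * ‖U lo‖ ^ 2 + ‖V lo‖ ^ 2 + (hi - lo) * S) := by
    intro x hx
    have h1 := h.eq_initial (ω := ω) hx
    have h2 := h.sq_norm_source_le (ω := ω) hlh hx (φ := fun t => Real.sin (ω * (x - t)))
      (by fun_prop) (fun t => Real.abs_sin_le_one _)
    set I := ∫ t in lo..x, (G t + (ω : ℂ) ^ 2 * U t) * (Real.sin (ω * (x - t)) : ℝ)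
    have h3 : ‖(ω : ℂ) * U x‖ ≤ |ω| * ‖U lo‖ + ‖V lo‖ + ‖I‖ := by
      rw [h1]
      refine (norm_add₃_le).trans ?_
      gcongr
      · rw [norm_mul, norm_mul, Complex.norm_real, Complex.norm_real, Real.norm_eq_abs,
          Real.norm_eq_abs]
        refine mul_le_mul_of_nonneg_right ?_ (norm_nonneg _)
        exact mul_le_of_le_one_right (abs_nonneg _) (Real.abs_cos_le_one _)
      · rw [norm_mul, Complex.norm_real, Real.norm_eq_abs]
        exact mul_le_of_le_one_left (norm_nonneg _) (Real.abs_sin_le_one _)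
    rw [norm_mul, Complex.norm_real, Real.norm_eq_abs] at h3
    have h4 : (|ω| * ‖U x‖) ^ 2 ≤ (|ω| * ‖U lo‖ + ‖V lo‖ + ‖I‖) ^ 2 :=
      pow_le_pow_left₀ (by positivity) h3 2
    have h5 : (|ω| * ‖U x‖) ^ 2 = ω ^ 2 * ‖U x‖ ^ 2 := by rw [mul_pow, sq_abs]
    have h6 : (|ω| * ‖U lo‖) ^ 2 = ω ^ 2 * ‖U lo‖ ^ 2 := by rw [mul_pow, sq_abs]
    nlinarith [sq_nonneg (|ω| * ‖U lo‖ - ‖V lo‖), sq_nonneg (|ω| * ‖U lo‖ - ‖I‖),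
      sq_nonneg (‖V lo‖ - ‖I‖)]
  have hi2 : IntegrableOn (fun t => ‖U t‖ ^ 2) (Icc lo hi) :=
    (h.cont.norm.pow 2).integrableOn_Icc
  rw [← integral_const_mul]
  refine (setIntegral_mono_on (hi2.const_mul _) (integrable_const _) measurableSet_Icc key).trans ?_
  simp [hL.le]
  nlinarith

end EdgeODE

end LimitGraph

/-! ### The hopping operator on `ℓ²(ℤ²)`. -/

namespace Lattice

/-- Square summable functions on the lattice `ℤ²`. -/
abbrev L2Z (𝕜 : Type*) [RCLike 𝕜] : Type _ := lp (fun _ : ℤ × ℤ => 𝕜) 2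

section Basic

variable {𝕜 : Type*} [RCLike 𝕜]

theorem memℓp_two_iff {f : ℤ × ℤ → 𝕜} : Memℓp f 2 ↔ Summable fun x => ‖f x‖ ^ 2 := by
  rw [memℓp_gen_iff (by norm_num)]
  simp

theorem hasSum_sq (p : L2Z 𝕜) : HasSum (fun x => ‖p x‖ ^ 2) (‖p‖ ^ 2) := by
  simpa using lp.hasSum_norm (p := 2) (by norm_num) p

theorem hasSum_sq_shift (p : L2Z 𝕜) (d : ℤ × ℤ) :
    HasSum (fun x => ‖p (x + d)‖ ^ 2) (‖p‖ ^ 2) :=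
  (Equiv.addRight d).hasSum_iff (f := fun x => ‖p x‖ ^ 2) |>.2 (hasSum_sq p)

/-- The translate `p (· + d)`. -/
noncomputable def shiftFun (d : ℤ × ℤ) (p : L2Z 𝕜) : L2Z 𝕜 :=
  ⟨fun x => p (x + d), memℓp_two_iff.2 (hasSum_sq_shift p d).summable⟩

theorem norm_shiftFun (d : ℤ × ℤ) (p : L2Z 𝕜) : ‖shiftFun d p‖ = ‖p‖ := by
  have h3 : ‖shiftFun d p‖ ^ 2 = ‖p‖ ^ 2 :=
    (hasSum_sq (shiftFun d p)).unique (hasSum_sq_shift p d)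
  exact (pow_left_inj₀ (norm_nonneg _) (norm_nonneg _) two_ne_zero).1 h3

/-- The translation `p ↦ p (· + d)` as a linear isometry. -/
noncomputable def shift (𝕜 : Type*) [RCLike 𝕜] (d : ℤ × ℤ) : L2Z 𝕜 →ₗᵢ[𝕜] L2Z 𝕜 where
  toFun := shiftFun d
  map_add' _ _ := rfl
  map_smul' _ _ := rfl
  norm_map' p := norm_shiftFun d p

@[simp] theorem shift_apply (d : ℤ × ℤ) (p : L2Z 𝕜) (x : ℤ × ℤ) :
    shift 𝕜 d p x = p (x + d) := rfl

theorem shift_shift_neg (d : ℤ × ℤ) (p : L2Z 𝕜) : shift 𝕜 d (shift 𝕜 (-d) p) = p := by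
  refine lp.ext (funext fun x => ?_)
  simp

theorem inner_shift_neg (d : ℤ × ℤ) (p q : L2Z 𝕜) :
    inner 𝕜 (shift 𝕜 (-d) p) q = inner 𝕜 p (shift 𝕜 d q) := by
  rw [← (shift 𝕜 d).inner_map_map, shift_shift_neg]

/-- The hopping operator with amplitudes `t₁`, `t₂` in the two directions. -/
noncomputable def hop (𝕜 : Type*) [RCLike 𝕜] (t₁ t₂ : ℝ) : L2Z 𝕜 →L[𝕜] L2Z 𝕜 :=
  (t₁ : 𝕜) • ((shift 𝕜 (1, 0)).toContinuousLinearMap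
      + (shift 𝕜 (-(1, 0))).toContinuousLinearMap)
    + (t₂ : 𝕜) • ((shift 𝕜 (0, 1)).toContinuousLinearMap
      + (shift 𝕜 (-(0, 1))).toContinuousLinearMap)

theorem hop_eq (t₁ t₂ : ℝ) (p : L2Z 𝕜) :
    hop 𝕜 t₁ t₂ p = (t₁ : 𝕜) • (shift 𝕜 (1, 0) p + shift 𝕜 (-(1, 0)) p)
      + (t₂ : 𝕜) • (shift 𝕜 (0, 1) p + shift 𝕜 (-(0, 1)) p) := rfl

theorem hop_apply (t₁ t₂ : ℝ) (p : L2Z 𝕜) (k l : ℤ) :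
    hop 𝕜 t₁ t₂ p (k, l) = (t₁ : 𝕜) * (p (k + 1, l) + p (k - 1, l))
      + (t₂ : 𝕜) * (p (k, l + 1) + p (k, l - 1)) := by
  change (t₁ : 𝕜) * (p ((k, l) + (1, 0)) + p ((k, l) + -(1, 0)))
    + (t₂ : 𝕜) * (p ((k, l) + (0, 1)) + p ((k, l) + -(0, 1))) = _
  simp [sub_eq_add_neg]

theorem norm_hop_le (t₁ t₂ : ℝ) (p : L2Z 𝕜) :
    ‖hop 𝕜 t₁ t₂ p‖ ≤ (2 * |t₁| + 2 * |t₂|) * ‖p‖ := by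
  rw [hop_eq]
  have h : ∀ d : ℤ × ℤ, ‖shift 𝕜 d p + shift 𝕜 (-d) p‖ ≤ 2 * ‖p‖ := fun d =>
    (norm_add_le _ _).trans (by rw [LinearIsometry.norm_map, LinearIsometry.norm_map]; linarith)
  refine (norm_add_le _ _).trans ?_
  rw [norm_smul, norm_smul, RCLike.norm_ofReal, RCLike.norm_ofReal]
  nlinarith [mul_le_mul_of_nonneg_left (h (1, 0)) (abs_nonneg t₁),
    mul_le_mul_of_nonneg_left (h (0, 1)) (abs_nonneg t₂)]

/-- Above the norm bound of the hopping operator, `1 - E⁻¹ T` is inverted by the Neumann series. -/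
theorem isUnit_sub_hop {t₁ t₂ E : ℝ} (hE : 2 * |t₁| + 2 * |t₂| < E) :
    IsUnit ((E : 𝕜) • (1 : L2Z 𝕜 →L[𝕜] L2Z 𝕜) - hop 𝕜 t₁ t₂) := by
  have hE0 : 0 < E := lt_of_le_of_lt (by positivity) hE
  have hEk : (E : 𝕜) ≠ 0 := by exact_mod_cast hE0.ne'
  have hn : ‖(E : 𝕜)⁻¹ • hop 𝕜 t₁ t₂‖ < 1 := by
    rw [norm_smul, norm_inv, RCLike.norm_ofReal, abs_of_pos hE0, inv_mul_lt_iff₀ hE0, mul_one]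
    exact (ContinuousLinearMap.opNorm_le_bound _ (by positivity) (norm_hop_le t₁ t₂)).trans_lt hE
  have h1 : IsUnit (1 - (E : 𝕜)⁻¹ • hop 𝕜 t₁ t₂) := isUnit_one_sub_of_norm_lt_one hn
  have h2 : (E : 𝕜) • (1 : L2Z 𝕜 →L[𝕜] L2Z 𝕜) - hop 𝕜 t₁ t₂
      = (Units.mk0 (E : 𝕜) hEk) • (1 - (E : 𝕜)⁻¹ • hop 𝕜 t₁ t₂) := by
    rw [Units.smul_def, Units.val_mk0, smul_sub, smul_inv_smul₀ hEk]
  rw [h2]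
  exact h1.smul _

end Basic

/-! ### Energy estimates for the lattice Green function. -/

section Green

/-- The function `(E - T)⁻¹ δ₀`, where `T` is the hopping operator. -/
noncomputable def greenVec (t₁ t₂ E : ℝ) : L2Z ℝ :=
  Ring.inverse (E • (1 : L2Z ℝ →L[ℝ] L2Z ℝ) - hop ℝ t₁ t₂) (lp.single 2 (0, 0) 1)

/-- The lattice Green function at the origin. -/
noncomputable def green (t₁ t₂ E : ℝ) : ℝ := greenVec t₁ t₂ E (0, 0)

variable {t₁ t₂ E : ℝ}

theorem sub_hop_greenVec (hE : 2 * |t₁| + 2 * |t₂| < E) :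
    E • greenVec t₁ t₂ E - hop ℝ t₁ t₂ (greenVec t₁ t₂ E) = lp.single 2 (0, 0) 1 := by
  have h := Ring.mul_inverse_cancel _ (isUnit_sub_hop (𝕜 := ℝ) hE)
  have h2 := congrArg (fun A : L2Z ℝ →L[ℝ] L2Z ℝ => A (lp.single 2 (0, 0) 1)) h
  simp only [RCLike.ofReal_real_eq_id, id] at h2
  exact h2

theorem greenVec_apply (hE : 2 * |t₁| + 2 * |t₂| < E) (k l : ℤ) :
    E * greenVec t₁ t₂ E (k, l)
      - (t₁ * (greenVec t₁ t₂ E (k + 1, l) + greenVec t₁ t₂ E (k - 1, l))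
        + t₂ * (greenVec t₁ t₂ E (k, l + 1) + greenVec t₁ t₂ E (k, l - 1)))
      = if k = 0 ∧ l = 0 then 1 else 0 := by
  have h := congrArg (fun p : L2Z ℝ => p (k, l)) (sub_hop_greenVec hE)
  simp only [lp.coeFn_sub, Pi.sub_apply, lp.coeFn_smul, Pi.smul_apply, smul_eq_mul,
    hop_apply, lp.single_apply] at h
  simp only [RCLike.ofReal_real_eq_id, id] at h
  rw [h]
  by_cases hkl : k = 0 ∧ l = 0
  · obtain ⟨rfl, rfl⟩ := hkl
    simp
  · rw [if_neg hkl, Pi.single_eq_of_ne]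
    simpa [Prod.ext_iff] using hkl

/-- The operator depends continuously on the parameters in norm, and inversion is continuous at a
unit. -/
theorem continuousAt_green (hE : 2 * |t₁| + 2 * |t₂| < E) :
    ContinuousAt (fun q : ℝ × ℝ × ℝ => green q.1 q.2.1 q.2.2) (t₁, t₂, E) := by
  have h1 : Continuous fun q : ℝ × ℝ × ℝ =>
      q.2.2 • (1 : L2Z ℝ →L[ℝ] L2Z ℝ) - hop ℝ q.1 q.2.1 := by
    unfold hop
    simp only [RCLike.ofReal_real_eq_id, id]
    fun_prop
  have h2 : ContinuousAt (fun q : ℝ × ℝ × ℝ =>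
      Ring.inverse (q.2.2 • (1 : L2Z ℝ →L[ℝ] L2Z ℝ) - hop ℝ q.1 q.2.1)) (t₁, t₂, E) := by
    obtain ⟨u, hu⟩ := isUnit_sub_hop (𝕜 := ℝ) hE
    have h3 := NormedRing.inverse_continuousAt u
    rw [hu] at h3
    exact ContinuousAt.comp (f := fun q : ℝ × ℝ × ℝ =>
      q.2.2 • (1 : L2Z ℝ →L[ℝ] L2Z ℝ) - hop ℝ q.1 q.2.1) (x := (t₁, t₂, E)) h3 h1.continuousAt
  exact ((lp.evalCLM ℝ (fun _ : ℤ × ℤ => ℝ) 2 (0, 0)).comp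
    (ContinuousLinearMap.apply ℝ (L2Z ℝ)
      (lp.single 2 ((0 : ℤ), (0 : ℤ)) (1 : ℝ) : L2Z ℝ))).continuous.continuousAt.comp h2

/-- The quadratic form of `E - T`. -/
theorem inner_sub_hop (p : L2Z ℝ) :
    inner ℝ p (E • p - hop ℝ t₁ t₂ p) = (E - 2 * t₁ - 2 * t₂) * ‖p‖ ^ 2
      + t₁ * ‖shift ℝ (1, 0) p - p‖ ^ 2 + t₂ * ‖shift ℝ (0, 1) p - p‖ ^ 2 := by
  have h : ∀ d : ℤ × ℤ, ‖shift ℝ d p - p‖ ^ 2 = 2 * ‖p‖ ^ 2 - 2 * inner ℝ p (shift ℝ d p) := by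
    intro d
    rw [norm_sub_sq_real, LinearIsometry.norm_map, real_inner_comm]
    ring
  have h' : ∀ d : ℤ × ℤ, inner ℝ p (shift ℝ (-d) p) = inner ℝ p (shift ℝ d p) := by
    intro d
    rw [real_inner_comm, inner_shift_neg]
  rw [h, h, hop_eq]
  simp only [RCLike.ofReal_real_eq_id, id, inner_sub_right, inner_add_right, inner_smul_right, h',
    real_inner_self_eq_norm_sq]
  ring

theorem inner_single (p : L2Z ℝ) : inner ℝ p (lp.single 2 ((0 : ℤ), (0 : ℤ)) (1 : ℝ)) = p (0, 0) := by
  rw [lp.inner_single_right]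
  simp

/-- Pairing `(E - T) p = δ₀` with `p` itself: the value at the origin is the energy of `p`. All the
bounds below start from this. -/
theorem green_eq (hE : 2 * |t₁| + 2 * |t₂| < E) :
    green t₁ t₂ E = (E - 2 * t₁ - 2 * t₂) * ‖greenVec t₁ t₂ E‖ ^ 2
      + t₁ * ‖shift ℝ (1, 0) (greenVec t₁ t₂ E) - greenVec t₁ t₂ E‖ ^ 2
      + t₂ * ‖shift ℝ (0, 1) (greenVec t₁ t₂ E) - greenVec t₁ t₂ E‖ ^ 2 := by
  rw [← inner_sub_hop, sub_hop_greenVec hE, inner_single]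
  rfl

theorem sq_le_norm_sq (p : L2Z ℝ) (x : ℤ × ℤ) : p x ^ 2 ≤ ‖p‖ ^ 2 := by
  have := lp.norm_apply_le_norm (p := 2) (by norm_num) p x
  rw [← sq_abs]
  exact pow_le_pow_left₀ (abs_nonneg _) this 2

/-- Drop the gradient terms of the energy, bound `‖p‖²` below by `p(0)²`, and divide by `p(0)`. -/
theorem green_le_inv (ht₁ : 0 ≤ t₁) (ht₂ : 0 ≤ t₂) (hE : 2 * t₁ + 2 * t₂ < E) :
    green t₁ t₂ E ≤ 1 / (E - 2 * t₁ - 2 * t₂) := by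
  have hE' : 2 * |t₁| + 2 * |t₂| < E := by rwa [abs_of_nonneg ht₁, abs_of_nonneg ht₂]
  have h1 := green_eq hE'
  have h2 : green t₁ t₂ E ^ 2 ≤ ‖greenVec t₁ t₂ E‖ ^ 2 := sq_le_norm_sq _ _
  have hd : 0 < E - 2 * t₁ - 2 * t₂ := by linarith
  have h3 : (E - 2 * t₁ - 2 * t₂) * green t₁ t₂ E ^ 2 ≤ green t₁ t₂ E := by
    have := mul_le_mul_of_nonneg_left h2 hd.le
    have h4 : 0 ≤ t₁ * ‖shift ℝ (1, 0) (greenVec t₁ t₂ E) - greenVec t₁ t₂ E‖ ^ 2 := by positivity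
    have h5 : 0 ≤ t₂ * ‖shift ℝ (0, 1) (greenVec t₁ t₂ E) - greenVec t₁ t₂ E‖ ^ 2 := by positivity
    linarith
  rw [le_div_iff₀ hd]
  by_contra hlt
  push Not at hlt
  nlinarith

/-- Lower bound of the Green function by the energy of a test function. -/
theorem green_ge (ht₁ : 0 ≤ t₁) (ht₂ : 0 ≤ t₂) (hE : 2 * t₁ + 2 * t₂ < E) (φ : L2Z ℝ)
    (hφ : φ (0, 0) = 1) {Q : ℝ} (hQ0 : 0 < Q)
    (hQ : (E - 2 * t₁ - 2 * t₂) * ‖φ‖ ^ 2 + t₁ * ‖shift ℝ (1, 0) φ - φ‖ ^ 2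
      + t₂ * ‖shift ℝ (0, 1) φ - φ‖ ^ 2 ≤ Q) : 1 / Q ≤ green t₁ t₂ E := by
  have hE' : 2 * |t₁| + 2 * |t₂| < E := by rwa [abs_of_nonneg ht₁, abs_of_nonneg ht₂]
  set p := greenVec t₁ t₂ E with hp
  have hd : 0 < E - 2 * t₁ - 2 * t₂ := by linarith
  have hpos : ∀ q : L2Z ℝ, 0 ≤ inner ℝ q (E • q - hop ℝ t₁ t₂ q) := fun q => by
    rw [inner_sub_hop]; positivity
  have hsymm : inner ℝ p (E • φ - hop ℝ t₁ t₂ φ) = 1 := by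
    have h1 : inner ℝ p (E • φ - hop ℝ t₁ t₂ φ) = inner ℝ φ (E • p - hop ℝ t₁ t₂ p) := by
      have h2 : ∀ d, inner ℝ p (shift ℝ (-d) φ) = inner ℝ φ (shift ℝ d p) := fun d => by
        rw [real_inner_comm, inner_shift_neg]
      have h3 : ∀ d, inner ℝ p (shift ℝ d φ) = inner ℝ φ (shift ℝ (-d) p) := fun d => by
        rw [← inner_shift_neg, real_inner_comm]
      rw [hop_eq, hop_eq]
      simp only [RCLike.ofReal_real_eq_id, id, inner_sub_right, inner_add_right,
        inner_smul_right, h2, h3, real_inner_comm p φ]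
      ring
    rw [h1, sub_hop_greenVec hE', inner_single, hφ]
  have hpp : inner ℝ p (E • p - hop ℝ t₁ t₂ p) = green t₁ t₂ E := by
    rw [sub_hop_greenVec hE', inner_single]; rfl
  have hφp : inner ℝ φ (E • p - hop ℝ t₁ t₂ p) = 1 := by
    rw [sub_hop_greenVec hE', inner_single, hφ]
  have hφφ : inner ℝ φ (E • φ - hop ℝ t₁ t₂ φ) ≤ Q := by rw [inner_sub_hop]; exact hQ
  -- Expanding the nonnegative form at `p - φ / Q` gives `G - 2 / Q + (energy of φ) / Q² ≥ 0`, and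
  -- the last term is at most `1 / Q`.
  have h := hpos (p - Q⁻¹ • φ)
  have h4 : E • (p - Q⁻¹ • φ) - hop ℝ t₁ t₂ (p - Q⁻¹ • φ)
      = (E • p - hop ℝ t₁ t₂ p) - Q⁻¹ • (E • φ - hop ℝ t₁ t₂ φ) := by
    rw [map_sub, map_smul, smul_sub, smul_sub, smul_comm E Q⁻¹ φ]; abel
  have h7 : ∀ a b : L2Z ℝ, inner ℝ (p - Q⁻¹ • φ) (a - Q⁻¹ • b) = inner ℝ p a
      - Q⁻¹ * inner ℝ p b - Q⁻¹ * inner ℝ φ a + Q⁻¹ * Q⁻¹ * inner ℝ φ b := fun a b => by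
    simp only [inner_sub_left, inner_sub_right, inner_smul_left, inner_smul_right, conj_trivial]
    ring
  rw [h4, h7, hsymm, hpp, hφp] at h
  have h5 := mul_le_mul_of_nonneg_left hφφ (by positivity : 0 ≤ Q⁻¹ * Q⁻¹)
  have h6 : Q⁻¹ * Q⁻¹ * Q = Q⁻¹ := by field_simp
  rw [one_div]
  nlinarith

theorem sum_range_sq_le (p : L2Z ℝ) {g : ℕ → ℤ × ℤ} (hg : Function.Injective g) (M : ℕ) :
    ∑ k ∈ Finset.range M, p (g k) ^ 2 ≤ ‖p‖ ^ 2 := by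
  have h := sum_le_hasSum ((Finset.range M).map ⟨g, hg⟩) (fun x _ => sq_nonneg ‖p x‖) (hasSum_sq p)
  simpa using h

/-- One-dimensional Sobolev inequality along the direction `d`. -/
theorem sq_le_energy (p : L2Z ℝ) {d : ℤ × ℤ} (hd : Function.Injective fun k : ℕ => k • d)
    {ε : ℝ} (hε : 0 < ε) :
    p (0, 0) ^ 2 ≤ 2 * ε * ‖p‖ ^ 2 + ‖shift ℝ d p - p‖ ^ 2 / (2 * ε) := by
  have hinj1 : Function.Injective fun k : ℕ => (k + 1) • d := fun a b h => by
    simpa using hd h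
  -- Factor `b² - a² = (b - a)(b + a)` and use Young's inequality with weight `ε`. Summing along the
  -- half-line `k • d` telescopes the left side.
  have hstep : ∀ k : ℕ, p (k • d) ^ 2 - p ((k + 1) • d) ^ 2
      ≤ ε * p (k • d) ^ 2 + ε * p ((k + 1) • d) ^ 2
        + (shift ℝ d p - p) (k • d) ^ 2 / (2 * ε) := by
    intro k
    have h1 : (shift ℝ d p - p) (k • d) = p ((k + 1) • d) - p (k • d) := by
      rw [succ_nsmul]
      rfl
    rw [h1]
    generalize p ((k + 1) • d) = a
    generalize p (k • d) = b
    rw [← sub_nonneg]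
    have : ε * b ^ 2 + ε * a ^ 2 + (a - b) ^ 2 / (2 * ε) - (b ^ 2 - a ^ 2)
        = (((a - b) + ε * (a + b)) ^ 2 + ε ^ 2 * (a - b) ^ 2) / (2 * ε) := by
      field_simp
      ring
    rw [this]
    positivity
  have hsum : ∀ M : ℕ, p (0, 0) ^ 2 ≤ p (M • d) ^ 2
      + (2 * ε * ‖p‖ ^ 2 + ‖shift ℝ d p - p‖ ^ 2 / (2 * ε)) := by
    intro M
    have h1 := Finset.sum_range_sub' (fun k : ℕ => p (k • d) ^ 2) M
    have h2 := Finset.sum_le_sum fun k (_ : k ∈ Finset.range M) => hstep k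
    rw [h1, Finset.sum_add_distrib, Finset.sum_add_distrib, ← Finset.mul_sum, ← Finset.mul_sum,
      ← Finset.sum_div] at h2
    have h3 := mul_le_mul_of_nonneg_left (sum_range_sq_le p hd M) hε.le
    have h4 := mul_le_mul_of_nonneg_left (sum_range_sq_le p hinj1 M) hε.le
    have h5 := div_le_div_of_nonneg_right (sum_range_sq_le (shift ℝ d p - p) hd M)
      (by positivity : 0 ≤ 2 * ε)
    simp only [zero_smul] at h2
    change p 0 ^ 2 ≤ _
    linarith
  have hlim : Tendsto (fun M : ℕ => p (M • d) ^ 2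
      + (2 * ε * ‖p‖ ^ 2 + ‖shift ℝ d p - p‖ ^ 2 / (2 * ε))) atTop
      (𝓝 (0 + (2 * ε * ‖p‖ ^ 2 + ‖shift ℝ d p - p‖ ^ 2 / (2 * ε)))) := by
    refine Tendsto.add_const _ ?_
    have := ((hasSum_sq p).summable.comp_injective hd).tendsto_atTop_zero
    simpa [Function.comp_def] using this
  simpa using ge_of_tendsto' hlim hsum

theorem green_nonneg (ht₁ : 0 ≤ t₁) (ht₂ : 0 ≤ t₂) (hE : 2 * t₁ + 2 * t₂ < E) :
    0 ≤ green t₁ t₂ E := by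
  have hE' : 2 * |t₁| + 2 * |t₂| < E := by rwa [abs_of_nonneg ht₁, abs_of_nonneg ht₂]
  have hd : 0 < E - 2 * t₁ - 2 * t₂ := by linarith
  rw [green_eq hE']
  positivity

/-- The Green function is small when one of the amplitudes is large. -/
theorem green_le_of_direction (ht₁ : 0 ≤ t₁) (ht₂ : 0 ≤ t₂) (hE : 2 * t₁ + 2 * t₂ < E)
    {t : ℝ} (ht : 0 < t) {d : ℤ × ℤ}
    (hd : t = t₁ ∧ d = (1, 0) ∨ t = t₂ ∧ d = (0, 1)) {ε : ℝ} (hε : 0 < ε) :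
    green t₁ t₂ E ≤ 2 * ε / (E - 2 * t₁ - 2 * t₂) + 1 / (2 * ε * t) := by
  have hE' : 2 * |t₁| + 2 * |t₂| < E := by rwa [abs_of_nonneg ht₁, abs_of_nonneg ht₂]
  have hd0 : 0 < E - 2 * t₁ - 2 * t₂ := by linarith
  have h0 := green_nonneg ht₁ ht₂ hE
  have h1 := green_eq hE'
  have hinj : Function.Injective fun k : ℕ => k • d := by
    intro a b h
    rcases hd with ⟨-, rfl⟩ | ⟨-, rfl⟩ <;> simpa using h
  have h2 := sq_le_energy (greenVec t₁ t₂ E) hinj hε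
  change green t₁ t₂ E ^ 2 ≤ _ at h2
  have hA : 0 ≤ t₁ * ‖shift ℝ (1, 0) (greenVec t₁ t₂ E) - greenVec t₁ t₂ E‖ ^ 2 := by positivity
  have hB : 0 ≤ t₂ * ‖shift ℝ (0, 1) (greenVec t₁ t₂ E) - greenVec t₁ t₂ E‖ ^ 2 := by positivity
  have hC : 0 ≤ (E - 2 * t₁ - 2 * t₂) * ‖greenVec t₁ t₂ E‖ ^ 2 := by positivity
  have hD : ‖shift ℝ d (greenVec t₁ t₂ E) - greenVec t₁ t₂ E‖ ^ 2 ≤ green t₁ t₂ E / t := by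
    rw [le_div_iff₀ ht]
    rcases hd with ⟨rfl, rfl⟩ | ⟨rfl, rfl⟩ <;> linarith
  set N := ‖greenVec t₁ t₂ E‖ ^ 2
  have hN : N ≤ green t₁ t₂ E / (E - 2 * t₁ - 2 * t₂) := by
    rw [le_div_iff₀ hd0]
    linarith
  -- Both `‖p‖²` and the squared gradient along `d` are at most `G` times a constant, by the energy
  -- identity. The Sobolev inequality is therefore of the form `G² ≤ G · const`.
  have h3 : green t₁ t₂ E ^ 2 ≤ green t₁ t₂ E
      * (2 * ε / (E - 2 * t₁ - 2 * t₂) + 1 / (2 * ε * t)) := by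
    have h4 := mul_le_mul_of_nonneg_left hN (by positivity : 0 ≤ 2 * ε)
    have h5 := div_le_div_of_nonneg_right hD (by positivity : 0 ≤ 2 * ε)
    have h6 : green t₁ t₂ E * (2 * ε / (E - 2 * t₁ - 2 * t₂) + 1 / (2 * ε * t))
        = 2 * ε * (green t₁ t₂ E / (E - 2 * t₁ - 2 * t₂)) + green t₁ t₂ E / t / (2 * ε) := by
      field_simp
    rw [h6]
    linarith
  rcases h0.eq_or_lt with h | h
  · rw [← h]; positivity
  · rw [sq] at h3
    exact le_of_mul_le_mul_left h3 h

end Green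

/-! ### Logarithmic cutoffs and recurrence in dimension two. -/

section Capacity

/-- The harmonic sum. -/
noncomputable def harm (N : ℕ) : ℝ := ∑ j ∈ Finset.range N, 1 / ((j : ℝ) + 1)

theorem harm_succ (N : ℕ) : harm (N + 1) = harm N + 1 / ((N : ℝ) + 1) :=
  Finset.sum_range_succ _ _

/-- Logarithmic cutoff on `ℕ`, equal to `1` at `0` and to `0` from `N` on. -/
noncomputable def logCutoff (N n : ℕ) : ℝ := (harm N - harm (min n N)) / harm N

theorem logCutoff_sub (N n : ℕ) : logCutoff N (n + 1) - logCutoff N n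
    = if n + 1 ≤ N then -(1 / ((n : ℝ) + 1) / harm N) else 0 := by
  unfold logCutoff
  split_ifs with h
  · rw [min_eq_left h, min_eq_left (by omega), harm_succ]
    ring
  · rw [min_eq_right (by omega), min_eq_right (by omega), sub_self]

/-- Logarithmic cutoff on `ℤ²`. -/
noncomputable def logCutoff₂ (N : ℕ) (x : ℤ × ℤ) : ℝ := logCutoff N (max x.1.natAbs x.2.natAbs)

theorem logCutoff₂_swap (N : ℕ) (k l : ℤ) : logCutoff₂ N (k, l) = logCutoff₂ N (l, k) := by
  unfold logCutoff₂
  rw [max_comm]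

theorem summable_logCutoff₂ (N : ℕ) : Summable fun x => ‖logCutoff₂ N x‖ ^ 2 := by
  refine summable_of_ne_finset_zero
    (s := Finset.Icc (-(N : ℤ)) N ×ˢ Finset.Icc (-(N : ℤ)) N) fun x hx => ?_
  have : logCutoff₂ N x = 0 := by
    unfold logCutoff₂ logCutoff
    rw [min_eq_right, sub_self, zero_div]
    simp only [Finset.mem_product, Finset.mem_Icc] at hx
    omega
  simp [this]

/-- A step from `(k, l)` to `(k + 1, l)` changes the sup norm, by exactly one, precisely when `|l| <
max |k| |k + 1|`. The two signs of `k` only differ by which end is farther from the origin. -/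
theorem sq_logCutoff₂_sub (N : ℕ) (k l : ℤ) :
    (logCutoff₂ N (k + 1, l) - logCutoff₂ N (k, l)) ^ 2
      = if max k.natAbs (k + 1).natAbs ≤ N ∧ l.natAbs < max k.natAbs (k + 1).natAbs then
          (1 / (max k.natAbs (k + 1).natAbs : ℕ) / harm N) ^ 2 else 0 := by
  obtain ⟨n, hn⟩ : ∃ n, max k.natAbs (k + 1).natAbs = n + 1 :=
    ⟨max k.natAbs (k + 1).natAbs - 1, by omega⟩
  rw [hn]
  unfold logCutoff₂
  simp only
  by_cases hl : l.natAbs < n + 1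
  · have h := logCutoff_sub N n
    rcases le_or_gt 0 k with hk | hk
    · have e1 : max (k + 1).natAbs l.natAbs = n + 1 := by omega
      have e2 : max k.natAbs l.natAbs = n := by omega
      rw [e1, e2, h]
      simp only [hl, and_true]
      split_ifs <;> push_cast <;> ring
    · have e1 : max (k + 1).natAbs l.natAbs = n := by omega
      have e2 : max k.natAbs l.natAbs = n + 1 := by omega
      rw [e1, e2, ← neg_sub, neg_sq, h]
      simp only [hl, and_true]
      split_ifs <;> push_cast <;> ring
  · have e : max (k + 1).natAbs l.natAbs = max k.natAbs l.natAbs := by omega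
    rw [e]
    simp [hl]

/-- For `m = max |k| |k + 1|` fewer than `2 m` values of `l` contribute, each `1 / (m H)²` with `H =
harm N`. Every `m ≥ 1` occurs for two values of `k`, so the total is at most `2 · ∑ 2 / (m H²) = 4 /
H`. -/
theorem logCutoff₂_energy {N : ℕ} (hN : 0 < harm N) {S : ℝ}
    (hS : HasSum (fun x : ℤ × ℤ =>
      (logCutoff₂ N (x.1 + 1, x.2) - logCutoff₂ N (x.1, x.2)) ^ 2) S) :
    S ≤ 4 / harm N := by
  set m : ℤ → ℕ := fun k => max k.natAbs (k + 1).natAbs with hm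
  have hm1 : ∀ k, 1 ≤ m k := fun k => by simp only [hm]; omega
  have hfib : ∀ k : ℤ, HasSum (fun l : ℤ =>
      (logCutoff₂ N (k + 1, l) - logCutoff₂ N (k, l)) ^ 2)
      (∑ l ∈ Finset.Ioo (-(m k : ℤ)) (m k),
        (logCutoff₂ N (k + 1, l) - logCutoff₂ N (k, l)) ^ 2) := by
    intro k
    refine hasSum_sum_of_ne_finset_zero fun l hl => ?_
    rw [sq_logCutoff₂_sub, if_neg]
    rintro ⟨-, h⟩
    refine hl (Finset.mem_Ioo.2 ?_)
    simp only [hm]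
    omega
  have h1 := hS.prod_fiberwise hfib
  set b : ℤ → ℝ := fun k => if m k ≤ N then 2 / (m k * harm N ^ 2) else 0 with hb
  have hle : ∀ k, ∑ l ∈ Finset.Ioo (-(m k : ℤ)) (m k),
      (logCutoff₂ N (k + 1, l) - logCutoff₂ N (k, l)) ^ 2 ≤ b k := by
    intro k
    have hmk : (1 : ℝ) ≤ m k := by exact_mod_cast hm1 k
    have h2 : ∀ l ∈ Finset.Ioo (-(m k : ℤ)) (m k),
        (logCutoff₂ N (k + 1, l) - logCutoff₂ N (k, l)) ^ 2
          ≤ if m k ≤ N then (1 / (m k : ℕ) / harm N) ^ 2 else 0 := by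
      intro l _
      rw [sq_logCutoff₂_sub]
      change (if m k ≤ N ∧ l.natAbs < m k then (1 / (m k : ℕ) / harm N) ^ 2 else 0) ≤ _
      split_ifs with h3 h4 h5 <;> first | exact le_rfl | positivity | exact absurd h3.1 h4
    refine (Finset.sum_le_card_nsmul _ _ _ h2).trans ?_
    rw [Int.card_Ioo, nsmul_eq_mul]
    simp only [hb]
    split_ifs
    · have h6 : (((m k : ℤ) - -(m k : ℤ) - 1).toNat : ℝ) ≤ 2 * m k := by
        have : ((m k : ℤ) - -(m k : ℤ) - 1).toNat ≤ 2 * m k := by omega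
        exact_mod_cast this
      refine (mul_le_mul_of_nonneg_right h6 (by positivity)).trans (le_of_eq ?_)
      field_simp
    · simp
  have hnat : HasSum (fun n : ℕ => if n + 1 ≤ N then 2 / (((n + 1 : ℕ) : ℝ) * harm N ^ 2) else 0)
      (2 / harm N) := by
    have h2 : HasSum (fun n : ℕ => if n + 1 ≤ N then 2 / (((n + 1 : ℕ) : ℝ) * harm N ^ 2) else 0)
        (∑ n ∈ Finset.range N, if n + 1 ≤ N then 2 / (((n + 1 : ℕ) : ℝ) * harm N ^ 2) else 0) := by
      refine hasSum_sum_of_ne_finset_zero fun n hn => ?_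
      rw [if_neg]
      simpa using hn
    convert h2 using 1
    have h3 : ∀ n ∈ Finset.range N, (if n + 1 ≤ N then 2 / (((n + 1 : ℕ) : ℝ) * harm N ^ 2) else 0)
        = 2 / harm N ^ 2 * (1 / ((n : ℝ) + 1)) := by
      intro n hn
      rw [if_pos (by simpa using hn)]
      push_cast
      field_simp
    rw [Finset.sum_congr rfl h3, ← Finset.mul_sum]
    change _ = 2 / harm N ^ 2 * harm N
    field_simp
  -- The two integers with the same `m = n + 1` are `n` and `-(n + 1)`, hence the splitting of `ℤ`.
  have hbs : HasSum b (2 / harm N + 2 / harm N) := by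
    refine HasSum.of_nat_of_neg_add_one ?_ ?_
    · convert hnat using 2 with n
      have : m n = n + 1 := by simp only [hm]; omega
      simp only [hb, this]
    · convert hnat using 2 with n
      have : m (-((n : ℤ) + 1)) = n + 1 := by simp only [hm]; omega
      simp only [hb, this]
  have := hasSum_le hle h1 hbs
  calc S ≤ _ := this
    _ = 4 / harm N := by ring

/-- A point of `ℤ²` has zero capacity: the logarithmic cutoffs have energy at most `4 / harm N`, and
the harmonic series diverges. This is where dimension two matters. -/
theorem exists_small_energy {ε : ℝ} (hε : 0 < ε) : ∃ φ : L2Z ℝ, φ (0, 0) = 1 ∧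
    ‖shift ℝ (1, 0) φ - φ‖ ^ 2 ≤ ε ∧ ‖shift ℝ (0, 1) φ - φ‖ ^ 2 ≤ ε := by
  obtain ⟨N, hN⟩ := ((tendsto_atTop.1 Real.tendsto_sum_range_one_div_nat_succ_atTop)
    (4 / ε)).exists
  change 4 / ε ≤ harm N at hN
  have hpos : 0 < harm N := lt_of_lt_of_le (by positivity) hN
  have hle : 4 / harm N ≤ ε := by
    rw [div_le_iff₀ hpos]
    rwa [div_le_iff₀ hε, mul_comm] at hN
  refine ⟨⟨logCutoff₂ N, memℓp_two_iff.2 (summable_logCutoff₂ N)⟩, ?_, ?_, ?_⟩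
  · change logCutoff₂ N (0, 0) = 1
    have h0 : harm 0 = 0 := by simp [harm]
    unfold logCutoff₂ logCutoff
    simp [h0, hpos.ne']
  · refine (logCutoff₂_energy hpos ?_).trans hle
    have := hasSum_sq (shift ℝ (1, 0) ⟨logCutoff₂ N, memℓp_two_iff.2 (summable_logCutoff₂ N)⟩
      - ⟨logCutoff₂ N, memℓp_two_iff.2 (summable_logCutoff₂ N)⟩)
    convert this using 2 with x
    rw [Real.norm_eq_abs, sq_abs]
    change _ = (logCutoff₂ N (x + (1, 0)) - logCutoff₂ N x) ^ 2
    congr 3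
    ext <;> simp
  · refine (logCutoff₂_energy hpos ?_).trans hle
    have := hasSum_sq (shift ℝ (0, 1) ⟨logCutoff₂ N, memℓp_two_iff.2 (summable_logCutoff₂ N)⟩
      - ⟨logCutoff₂ N, memℓp_two_iff.2 (summable_logCutoff₂ N)⟩)
    rw [← (Equiv.prodComm ℤ ℤ).hasSum_iff] at this
    convert this using 2 with x
    simp only [Function.comp]
    rw [Real.norm_eq_abs, sq_abs]
    change _ = (logCutoff₂ N (x.swap + (0, 1)) - logCutoff₂ N x.swap) ^ 2
    rw [logCutoff₂_swap, logCutoff₂_swap N x.1]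
    congr 3
    ext <;> simp

/-- The lattice walk is recurrent: the Green function blows up at the edge of the spectrum. -/
theorem exists_le_green (K M : ℝ) : ∃ δ > 0, ∀ t₁ t₂ E : ℝ, 0 ≤ t₁ → t₁ ≤ K → 0 ≤ t₂ → t₂ ≤ K →
    2 * t₁ + 2 * t₂ < E → E < 2 * t₁ + 2 * t₂ + δ → M ≤ green t₁ t₂ E := by
  set M' := max M 1
  set K' := max K 1
  have hM : 0 < M' := lt_max_of_lt_right one_pos
  have hK : 0 < K' := lt_max_of_lt_right one_pos
  -- The energy budget `1 / M'` is split into `1 / (4 M')` for each gradient term, whatever the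
  -- amplitudes below `K'`, and `1 / (2 M')` for the mass. The test function is fixed first; `δ`
  -- then depends on its norm.
  obtain ⟨φ, hφ0, hφ1, hφ2⟩ := exists_small_energy (ε := 1 / (4 * K' * M')) (by positivity)
  refine ⟨1 / (2 * M' * (‖φ‖ ^ 2 + 1)), by positivity, fun t₁ t₂ E h1 h1' h2 h2' hE hE' => ?_⟩
  have h := green_ge h1 h2 hE φ hφ0 (Q := 1 / M') (by positivity) ?_
  · rw [one_div_one_div] at h
    exact (le_max_left _ _).trans h
  · have e1 : (E - 2 * t₁ - 2 * t₂) * ‖φ‖ ^ 2 ≤ 1 / (2 * M') := by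
      have : (E - 2 * t₁ - 2 * t₂) * ‖φ‖ ^ 2
          ≤ 1 / (2 * M' * (‖φ‖ ^ 2 + 1)) * (‖φ‖ ^ 2 + 1) := by
        gcongr <;> linarith
      refine this.trans (le_of_eq ?_)
      field_simp
    have e2 : t₁ * ‖shift ℝ (1, 0) φ - φ‖ ^ 2 ≤ K' * (1 / (4 * K' * M')) := by
      gcongr; exact h1'.trans (le_max_left _ _)
    have e3 : t₂ * ‖shift ℝ (0, 1) φ - φ‖ ^ 2 ≤ K' * (1 / (4 * K' * M')) := by
      gcongr; exact h2'.trans (le_max_left _ _)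
    have e4 : K' * (1 / (4 * K' * M')) = 1 / (4 * M') := by field_simp
    rw [e4] at e2 e3
    have e5 : 1 / (2 * M') + 1 / (4 * M') + 1 / (4 * M') = 1 / M' := by field_simp; norm_num
    linarith

end Capacity

end Lattice

/-! ### The vertex equation with a defect: monotonicity and existence. -/

namespace LimitGraph

/-- Contribution of the vertical segments to the vertex equation. -/
noncomputable def verticalTerm (a₃ β ω : ℝ) : ℝ :=
  (Real.cos (ω * a₃) - Real.cos β) / Real.sin (ω * a₃)

/-- Diagonal contribution of the horizontal edges to the vertex equation. -/
noncomputable def bandCenter (a₁ a₂ ω : ℝ) : ℝ :=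
  Real.cos (ω * a₁) / Real.sin (ω * a₁) + Real.cos (ω * a₂) / Real.sin (ω * a₂)

/-- Norm of the off-diagonal contribution of the horizontal edges to the vertex equation. -/
noncomputable def bandRadius (a₁ a₂ ω : ℝ) : ℝ :=
  1 / |Real.sin (ω * a₁)| + 1 / |Real.sin (ω * a₂)|

/-- The equation satisfied by the vertex values of a solution of `-u'' = ω² u`. -/
def VertexEquation (a₁ a₂ a₃ β μ ω : ℝ) (p : ℤ × ℤ → ℝ) : Prop :=
  ∀ k l : ℤ,
    (p (k + 1, l) + p (k - 1, l) - 2 * Real.cos (ω * a₁) * p (k, l)) / Real.sin (ω * a₁)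
      + (p (k, l + 1) + p (k, l - 1) - 2 * Real.cos (ω * a₂) * p (k, l)) / Real.sin (ω * a₂)
      = 2 * vertexWeight μ k l * verticalTerm a₃ β ω * p (k, l)

theorem vertexEquation_neg {a₁ a₂ a₃ β μ ω : ℝ} {p : ℤ × ℤ → ℝ}
    (h : VertexEquation a₁ a₂ a₃ β μ (-ω) p) : VertexEquation a₁ a₂ a₃ β μ ω p := by
  intro k l
  have := h k l
  simp only [verticalTerm, neg_mul, Real.cos_neg, Real.sin_neg, div_neg] at this ⊢
  linarith

section Trig

/-- The derivative is `a (1 - σ cos) / sin²`. The case `σ = cos β` is the vertical term up to sign,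
and `σ = ±1` gives the band edges. -/
theorem monotoneOn_trig_ratio {σ a α τ : ℝ} (hσ : |σ| ≤ 1) (ha : 0 < a)
    (hs : ∀ x ∈ Ioc α τ, Real.sin (x * a) ≠ 0) :
    MonotoneOn (fun x => (σ - Real.cos (x * a)) / Real.sin (x * a)) (Ioc α τ) := by
  have hd : ∀ x ∈ Ioc α τ, HasDerivAt (fun x => (σ - Real.cos (x * a)) / Real.sin (x * a))
      (a * (1 - σ * Real.cos (x * a)) / Real.sin (x * a) ^ 2) x := by
    intro x hx
    have h1 : HasDerivAt (fun x => x * a) a x := by simpa using (hasDerivAt_id x).mul_const a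
    refine ((h1.cos.const_sub σ).div h1.sin (hs x hx)).congr_deriv ?_
    congr 1
    have := Real.sin_sq_add_cos_sq (x * a)
    linear_combination a * this
  refine monotoneOn_of_deriv_nonneg (convex_Ioc α τ)
    (fun x hx => (hd x hx).continuousAt.continuousWithinAt)
    (fun x hx => (hd x (interior_subset hx)).differentiableAt.differentiableWithinAt)
    fun x hx => ?_
  rw [(hd x (interior_subset hx)).deriv]
  have h2 : σ * Real.cos (x * a) ≤ 1 := by
    refine (le_abs_self _).trans ?_
    rw [abs_mul]
    exact mul_le_one₀ hσ (abs_nonneg _) (Real.abs_cos_le_one _)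
  have : 0 ≤ 1 - σ * Real.cos (x * a) := by linarith
  positivity

/-- By connectedness the sine keeps one sign, which allows `1 / |sin|` to be written as `σ / sin`
with a constant `σ`. -/
theorem exists_sign_sin {a α τ : ℝ} (hs : ∀ x ∈ Ioc α τ, Real.sin (x * a) ≠ 0) :
    ∃ σ : ℝ, |σ| = 1 ∧ ∀ x ∈ Ioc α τ, |Real.sin (x * a)| = σ * Real.sin (x * a) := by
  by_cases h : ∀ x ∈ Ioc α τ, 0 < Real.sin (x * a)
  · exact ⟨1, by simp, fun x hx => by rw [abs_of_pos (h x hx), one_mul]⟩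
  · push Not at h
    obtain ⟨y, hy, hy0⟩ := h
    refine ⟨-1, by simp, fun x hx => ?_⟩
    rcases lt_or_ge 0 (Real.sin (x * a)) with hx0 | hx0
    · have hc : ContinuousOn (fun x => Real.sin (x * a)) (Ioc α τ) := by fun_prop
      obtain ⟨z, hz, hz0⟩ := isPreconnected_Ioc.intermediate_value hy hx hc ⟨hy0, hx0.le⟩
      exact absurd hz0 (hs z hz)
    · rw [abs_of_nonpos hx0]; ring

theorem one_div_abs_eq {σ s : ℝ} (hσ : |σ| = 1) (h : |s| = σ * s) : 1 / |s| = σ / s := by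
  have h2 : σ * σ = 1 := by rw [← abs_mul_abs_self, hσ, one_mul]
  have h3 : σ ≠ 0 := fun h0 => by simp [h0] at h2
  rcases eq_or_ne s 0 with rfl | hs
  · simp
  · rw [h]
    field_simp
    linarith

end Trig

section Gap

variable {a₁ a₂ a₃ β μ α τ : ℝ}

theorem antitoneOn_verticalTerm (ha₃ : 0 < a₃)
    (h3 : ∀ x ∈ Ioc α τ, Real.sin (x * a₃) ≠ 0) :
    AntitoneOn (verticalTerm a₃ β) (Ioc α τ) := by
  have := (monotoneOn_trig_ratio (Real.abs_cos_le_one β) ha₃ h3).neg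
  refine this.congr fun x _ => ?_
  simp only [verticalTerm]
  rw [← neg_div, neg_sub]

/-- `R - C` is the sum of two ratios `(σ - cos) / sin`. The condition `g + C > R` thus compares the
decreasing `g` with an increasing function. -/
theorem monotoneOn_radius_sub_center (ha₁ : 0 < a₁) (ha₂ : 0 < a₂)
    (h1 : ∀ x ∈ Ioc α τ, Real.sin (x * a₁) ≠ 0)
    (h2 : ∀ x ∈ Ioc α τ, Real.sin (x * a₂) ≠ 0) :
    MonotoneOn (fun x => bandRadius a₁ a₂ x - bandCenter a₁ a₂ x) (Ioc α τ) := by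
  obtain ⟨σ₁, hσ₁, hs₁⟩ := exists_sign_sin h1
  obtain ⟨σ₂, hσ₂, hs₂⟩ := exists_sign_sin h2
  refine ((monotoneOn_trig_ratio hσ₁.le ha₁ h1).add
    (monotoneOn_trig_ratio hσ₂.le ha₂ h2)).congr fun x hx => ?_
  simp only [bandRadius, bandCenter, one_div_abs_eq hσ₁ (hs₁ x hx),
    one_div_abs_eq hσ₂ (hs₂ x hx)]
  ring

/-- The counterpart for the lower edge `-R`, used to exclude `g + C < -R`. -/
theorem monotoneOn_neg_radius_sub_center (ha₁ : 0 < a₁) (ha₂ : 0 < a₂)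
    (h1 : ∀ x ∈ Ioc α τ, Real.sin (x * a₁) ≠ 0)
    (h2 : ∀ x ∈ Ioc α τ, Real.sin (x * a₂) ≠ 0) :
    MonotoneOn (fun x => -bandRadius a₁ a₂ x - bandCenter a₁ a₂ x) (Ioc α τ) := by
  obtain ⟨σ₁, hσ₁, hs₁⟩ := exists_sign_sin h1
  obtain ⟨σ₂, hσ₂, hs₂⟩ := exists_sign_sin h2
  refine ((monotoneOn_trig_ratio (σ := -σ₁) (by rw [abs_neg, hσ₁]) ha₁ h1).add
    (monotoneOn_trig_ratio (σ := -σ₂) (by rw [abs_neg, hσ₂]) ha₂ h2)).congr fun x hx => ?_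
  simp only [bandRadius, bandCenter, one_div_abs_eq hσ₁ (hs₁ x hx),
    one_div_abs_eq hσ₂ (hs₂ x hx)]
  ring

theorem abs_cos_lt_one {x : ℝ} (h : Real.sin x ≠ 0) : |Real.cos x| < 1 := by
  have h1 := Real.sin_sq_add_cos_sq x
  have h2 : 0 < Real.sin x ^ 2 := by positivity
  rw [← sq_lt_one_iff_abs_lt_one]
  linarith

/-- `|cot| < 1 / |sin|` termwise. As a consequence `g` has the sign of `g + C` as soon as `|g + C| ≥
R`. -/
theorem abs_bandCenter_lt {ω : ℝ} (h1 : Real.sin (ω * a₁) ≠ 0) (h2 : Real.sin (ω * a₂) ≠ 0) :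
    |bandCenter a₁ a₂ ω| < bandRadius a₁ a₂ ω := by
  refine (abs_add_le _ _).trans_lt ?_
  rw [abs_div, abs_div]
  exact add_lt_add (div_lt_div_of_pos_right (abs_cos_lt_one h1) (abs_pos.2 h1))
    (div_lt_div_of_pos_right (abs_cos_lt_one h2) (abs_pos.2 h2))

theorem continuousAt_verticalTerm {ω : ℝ} (h3 : Real.sin (ω * a₃) ≠ 0) :
    ContinuousAt (verticalTerm a₃ β) ω := by
  unfold verticalTerm
  exact ContinuousAt.div (by fun_prop) (by fun_prop) h3

theorem continuousAt_bandCenter {ω : ℝ} (h1 : Real.sin (ω * a₁) ≠ 0)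
    (h2 : Real.sin (ω * a₂) ≠ 0) : ContinuousAt (bandCenter a₁ a₂) ω := by
  have h : ∀ a : ℝ, Real.sin (ω * a) ≠ 0 →
      ContinuousAt (fun x => Real.cos (x * a) / Real.sin (x * a)) ω := fun a ha =>
    ContinuousAt.div (by fun_prop) (by fun_prop) ha
  exact (h a₁ h1).add (h a₂ h2)

theorem continuousAt_one_div_abs_sin {a ω : ℝ} (h : Real.sin (ω * a) ≠ 0) :
    ContinuousAt (fun x => 1 / |Real.sin (x * a)|) ω :=
  ContinuousAt.div (by fun_prop) (by fun_prop) (abs_ne_zero.2 h)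

theorem continuousAt_bandRadius {ω : ℝ} (h1 : Real.sin (ω * a₁) ≠ 0)
    (h2 : Real.sin (ω * a₂) ≠ 0) : ContinuousAt (bandRadius a₁ a₂) ω :=
  (continuousAt_one_div_abs_sin h1).add (continuousAt_one_div_abs_sin h2)

/-- The lattice Green function attached to the vertex equation. -/
noncomputable def vertexGreen (a₁ a₂ a₃ β ω : ℝ) : ℝ :=
  Lattice.green (1 / |Real.sin (ω * a₁)| / 2) (1 / |Real.sin (ω * a₂)| / 2)
    (verticalTerm a₃ β ω + bandCenter a₁ a₂ ω)

theorem radius_eq (ω : ℝ) : 2 * (1 / |Real.sin (ω * a₁)| / 2)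
    + 2 * (1 / |Real.sin (ω * a₂)| / 2) = bandRadius a₁ a₂ ω := by
  unfold bandRadius; ring

theorem continuousAt_vertexGreen {ω : ℝ} (h1 : Real.sin (ω * a₁) ≠ 0)
    (h2 : Real.sin (ω * a₂) ≠ 0) (h3 : Real.sin (ω * a₃) ≠ 0)
    (hE : bandRadius a₁ a₂ ω < verticalTerm a₃ β ω + bandCenter a₁ a₂ ω) :
    ContinuousAt (vertexGreen a₁ a₂ a₃ β) ω := by
  have hc : ContinuousAt (fun x => (1 / |Real.sin (x * a₁)| / 2, 1 / |Real.sin (x * a₂)| / 2,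
      verticalTerm a₃ β x + bandCenter a₁ a₂ x)) ω :=
    ((continuousAt_one_div_abs_sin h1).div_const 2).prodMk
      (((continuousAt_one_div_abs_sin h2).div_const 2).prodMk
        ((continuousAt_verticalTerm h3).add (continuousAt_bandCenter h1 h2)))
  have hE' : 2 * |1 / |Real.sin (ω * a₁)| / 2| + 2 * |1 / |Real.sin (ω * a₂)| / 2|
      < verticalTerm a₃ β ω + bandCenter a₁ a₂ ω := by
    have hab : ∀ s : ℝ, |1 / |s| / 2| = 1 / |s| / 2 := fun s => abs_of_nonneg (by positivity)
    rw [hab, hab, radius_eq]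
    exact hE
  have hG := Lattice.continuousAt_green hE'
  have he : vertexGreen a₁ a₂ a₃ β = (fun q : ℝ × ℝ × ℝ => Lattice.green q.1 q.2.1 q.2.2) ∘
      fun x => (1 / |Real.sin (x * a₁)| / 2, 1 / |Real.sin (x * a₂)| / 2,
      verticalTerm a₃ β x + bandCenter a₁ a₂ x) := rfl
  rw [he]
  exact ContinuousAt.comp_of_eq hG hc rfl

/-- The vertex equation is solved by the lattice Green function. -/
theorem exists_vertexEquation_of_green {ω : ℝ} (h1 : Real.sin (ω * a₁) ≠ 0)
    (h2 : Real.sin (ω * a₂) ≠ 0)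
    (hE : bandRadius a₁ a₂ ω < verticalTerm a₃ β ω + bandCenter a₁ a₂ ω)
    (hN : (1 - μ) * verticalTerm a₃ β ω * vertexGreen a₁ a₂ a₃ β ω = 1) :
    ∃ p : ℤ × ℤ → ℝ, p ≠ 0 ∧ (Summable fun x => ‖p x‖ ^ 2) ∧
      VertexEquation a₁ a₂ a₃ β μ ω p := by
  set s₁ := Real.sin (ω * a₁) with hs₁
  set s₂ := Real.sin (ω * a₂) with hs₂
  set t₁ := 1 / |s₁| / 2 with ht₁
  set t₂ := 1 / |s₂| / 2 with ht₂
  set E := verticalTerm a₃ β ω + bandCenter a₁ a₂ ω with hEdef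
  have hE' : 2 * |t₁| + 2 * |t₂| < E := by
    rw [abs_of_nonneg (by positivity), abs_of_nonneg (by positivity), ht₁, ht₂, hs₁, hs₂, radius_eq]
    exact hE
  set q := Lattice.greenVec t₁ t₂ E with hq
  have hq0 : q (0, 0) = vertexGreen a₁ a₂ a₃ β ω := rfl
  have hqe := Lattice.greenVec_apply hE'
  rw [← hq] at hqe
  -- Multiplication by `σ₁ ^ k σ₂ ^ l` turns the amplitudes `1 / |sin|` into `1 / sin`, so the Green
  -- function with positive amplitudes can be used.
  set σ₁ := s₁ / |s₁| with hσ₁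
  set σ₂ := s₂ / |s₂| with hσ₂
  have hA₁ : |s₁| ≠ 0 := abs_ne_zero.2 h1
  have hA₂ : |s₂| ≠ 0 := abs_ne_zero.2 h2
  have n₁ : σ₁ ≠ 0 := div_ne_zero h1 hA₁
  have n₂ : σ₂ ≠ 0 := div_ne_zero h2 hA₂
  have a₁' : |σ₁| = 1 := by rw [hσ₁, abs_div, abs_abs, div_self hA₁]
  have a₂' : |σ₂| = 1 := by rw [hσ₂, abs_div, abs_abs, div_self hA₂]
  have i₁ : σ₁⁻¹ = σ₁ := by
    refine inv_eq_of_mul_eq_one_left ?_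
    rw [← abs_mul_abs_self, a₁', one_mul]
  have i₂ : σ₂⁻¹ = σ₂ := by
    refine inv_eq_of_mul_eq_one_left ?_
    rw [← abs_mul_abs_self, a₂', one_mul]
  have m₁ : σ₁ / s₁ = 2 * t₁ := by rw [hσ₁, ht₁]; field_simp
  have m₂ : σ₂ / s₂ = 2 * t₂ := by rw [hσ₂, ht₂]; field_simp
  refine ⟨fun x => σ₁ ^ x.1 * σ₂ ^ x.2 * q x, fun h0 => ?_, ?_, fun k l => ?_⟩
  · have := congrFun h0 (0, 0)
    simp only [zpow_zero, one_mul, hq0, Pi.zero_apply] at this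
    rw [this, mul_zero] at hN
    exact zero_ne_one hN
  · refine (Lattice.hasSum_sq q).summable.congr fun x => ?_
    rw [norm_mul, norm_mul, norm_zpow, norm_zpow, Real.norm_eq_abs σ₁, Real.norm_eq_abs σ₂,
      a₁', a₂', one_zpow, one_zpow, one_mul, one_mul]
  · simp only [zpow_add₀ n₁, zpow_add₀ n₂, zpow_sub₀ n₁, zpow_sub₀ n₂, zpow_one, div_eq_mul_inv,
      i₁, i₂]
    -- The normalization `hN` makes the defect term at the origin equal to minus the source `δ₀` of
    -- the Green function.
    have hw : (vertexWeight μ k l - 1) * verticalTerm a₃ β ω * q (k, l)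
        = -(if k = 0 ∧ l = 0 then 1 else 0) := by
      unfold vertexWeight
      split_ifs with h0
      · rw [h0.1, h0.2, hq0]; linarith
      · ring
    have hC : Real.cos (ω * a₁) / s₁ + Real.cos (ω * a₂) / s₂ = bandCenter a₁ a₂ ω := rfl
    have hkl : E * q (k, l) - (t₁ * (q (k + 1, l) + q (k - 1, l))
        + t₂ * (q (k, l + 1) + q (k, l - 1)))
        = -((vertexWeight μ k l - 1) * verticalTerm a₃ β ω * q (k, l)) := by
      rw [hqe k l, hw, neg_neg]
    rw [hEdef, ← hC] at hkl
    rw [div_eq_mul_inv] at m₁ m₂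
    linear_combination (σ₁ ^ k * σ₂ ^ l) * (q (k + 1, l) + q (k - 1, l)) * m₁
      + (σ₁ ^ k * σ₂ ^ l) * (q (k, l + 1) + q (k, l - 1)) * m₂ - 2 * (σ₁ ^ k * σ₂ ^ l) * hkl

/-- Existence of a solution of the vertex equation between a pole of one of the coefficients
and the bottom of a band. -/
theorem exists_vertexEquation (ha₁ : 0 < a₁) (ha₂ : 0 < a₂) (ha₃ : 0 < a₃) (hμ0 : 0 < μ)
    (hμ1 : μ < 1) (hατ : α < τ)
    (h1 : ∀ x ∈ Ioc α τ, Real.sin (x * a₁) ≠ 0)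
    (h2 : ∀ x ∈ Ioc α τ, Real.sin (x * a₂) ≠ 0)
    (h3 : ∀ x ∈ Ioc α τ, Real.sin (x * a₃) ≠ 0)
    (hgap : ∀ x ∈ Ioo α τ, bandRadius a₁ a₂ x < |verticalTerm a₃ β x + bandCenter a₁ a₂ x|)
    (hτ : |verticalTerm a₃ β τ + bandCenter a₁ a₂ τ| ≤ bandRadius a₁ a₂ τ)
    (hα : Real.sin (α * a₁) = 0 ∨ Real.sin (α * a₂) = 0 ∨
      (Real.sin (α * a₃) = 0 ∧ Real.cos (α * a₃) ≠ Real.cos β)) :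
    ∃ ω ∈ Ioo α τ, ∃ p : ℤ × ℤ → ℝ, p ≠ 0 ∧ (Summable fun x => ‖p x‖ ^ 2) ∧
      VertexEquation a₁ a₂ a₃ β μ ω p := by
  set g := verticalTerm a₃ β with hg
  set C := bandCenter a₁ a₂ with hC
  set R := bandRadius a₁ a₂ with hR
  set G := vertexGreen a₁ a₂ a₃ β with hGdef
  have hτmem : τ ∈ Ioc α τ := ⟨hατ, le_rfl⟩
  have hga : AntitoneOn g (Ioc α τ) := antitoneOn_verticalTerm ha₃ h3
  have hF : MonotoneOn (fun x => R x - C x) (Ioc α τ) :=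
    monotoneOn_radius_sub_center ha₁ ha₂ h1 h2
  have hF' : MonotoneOn (fun x => -R x - C x) (Ioc α τ) :=
    monotoneOn_neg_radius_sub_center ha₁ ha₂ h1 h2
  -- On the other branch, `g x < -R x - C x ≤ -R τ - C τ ≤ g τ ≤ g x`, a contradiction.
  have hE : ∀ x ∈ Ioo α τ, R x < g x + C x := by
    intro x hx
    have hx' : x ∈ Ioc α τ := Ioo_subset_Ioc_self hx
    rcases lt_abs.1 (hgap x hx) with h | h
    · exact h
    · have e1 := hga hx' hτmem hx.2.le
      have e2 := hF' hx' hτmem hx.2.le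
      simp only at e2
      have e3 := (abs_le.1 hτ).1
      linarith
  have hRCτ : C τ < R τ := (le_abs_self _).trans_lt (abs_bandCenter_lt (h1 τ hτmem) (h2 τ hτmem))
  have hcg : ContinuousAt g τ := continuousAt_verticalTerm (h3 τ hτmem)
  have hcC : ContinuousAt C τ := continuousAt_bandCenter (h1 τ hτmem) (h2 τ hτmem)
  have hcR : ContinuousAt R τ := continuousAt_bandRadius (h1 τ hτmem) (h2 τ hτmem)
  have hIoo : Ioo α τ ∈ 𝓝[<] τ := Ioo_mem_nhdsLT hατ
  -- One inequality is the band condition at `τ`, the other is the limit of `hE` from the left. With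
  -- `C τ < R τ` this forces `g τ > 0`.
  have hEτ : g τ + C τ = R τ := by
    refine le_antisymm ((le_abs_self _).trans hτ) ?_
    have u1 : Tendsto R (𝓝[<] τ) (𝓝 (R τ)) := hcR.tendsto.mono_left nhdsWithin_le_nhds
    have u2 : Tendsto (fun x => g x + C x) (𝓝[<] τ) (𝓝 (g τ + C τ)) :=
      (hcg.add hcC).tendsto.mono_left nhdsWithin_le_nhds
    refine le_of_tendsto_of_tendsto u1 u2 ?_
    filter_upwards [hIoo] with x hx using (hE x hx).le
  have hgτ : 0 < g τ := by linarith
  have hgpos : ∀ x ∈ Ioo α τ, g τ ≤ g x := fun x hx =>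
    hga (Ioo_subset_Ioc_self hx) hτmem hx.2.le
  have hcN : ContinuousOn (fun x => (1 - μ) * g x * G x) (Ioo α τ) := fun x hx => by
    have hx' : x ∈ Ioc α τ := Ioo_subset_Ioc_self hx
    exact ((continuousAt_const.mul (continuousAt_verticalTerm (h3 x hx'))).mul
      (continuousAt_vertexGreen (h1 x hx') (h2 x hx') (h3 x hx') (hE x hx))).continuousWithinAt
  have hEG : ∀ x ∈ Ioo α τ, 2 * (1 / |Real.sin (x * a₁)| / 2)
      + 2 * (1 / |Real.sin (x * a₂)| / 2) < g x + C x := fun x hx => by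
    rw [radius_eq]; exact hE x hx
  have hdiff : ∀ x, g x + C x - 2 * (1 / |Real.sin (x * a₁)| / 2)
      - 2 * (1 / |Real.sin (x * a₂)| / 2) = g x + C x - R x := fun x => by
    rw [hR, ← radius_eq]; ring
  have hG0 : ∀ x ∈ Ioo α τ, 0 ≤ G x := fun x hx =>
    Lattice.green_nonneg (by positivity) (by positivity) (hEG x hx)
  -- Near `τ` the amplitudes stay below `K` and `E - R` is small, so recurrence makes `G` as large
  -- as `1 / ((1 - μ) g τ)`, while `g ≥ g τ`.
  have hhigh : ∃ x ∈ Ioo α τ, 1 ≤ (1 - μ) * g x * G x := by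
    set K := max (1 / |Real.sin (τ * a₁)| / 2) (1 / |Real.sin (τ * a₂)| / 2) + 1 with hK
    obtain ⟨δ, hδ, hδG⟩ := Lattice.exists_le_green K (1 / ((1 - μ) * g τ))
    have ev1 : ∀ᶠ x in 𝓝[<] τ, 1 / |Real.sin (x * a₁)| / 2 < K :=
      (((continuousAt_one_div_abs_sin (h1 τ hτmem)).div_const 2).tendsto.mono_left
        nhdsWithin_le_nhds).eventually_lt_const ((le_max_left _ _).trans_lt (lt_add_one _))
    have ev2 : ∀ᶠ x in 𝓝[<] τ, 1 / |Real.sin (x * a₂)| / 2 < K :=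
      (((continuousAt_one_div_abs_sin (h2 τ hτmem)).div_const 2).tendsto.mono_left
        nhdsWithin_le_nhds).eventually_lt_const ((le_max_right _ _).trans_lt (lt_add_one _))
    have ev3 : ∀ᶠ x in 𝓝[<] τ, g x + C x - R x < δ :=
      ((((hcg.add hcC).sub hcR).tendsto).mono_left nhdsWithin_le_nhds).eventually_lt_const
        (by change g τ + C τ - R τ < δ; linarith)
    obtain ⟨x, hx1, hx2, hx3, hx⟩ :=
      (ev1.and (ev2.and (ev3.and (eventually_mem_set.2 hIoo)))).exists
    refine ⟨x, hx, ?_⟩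
    have h := hδG _ _ (g x + C x) (by positivity) hx1.le (by positivity) hx2.le (hEG x hx)
      (by have := hdiff x; linarith)
    change _ ≤ G x at h
    have hp : 0 < (1 - μ) * g τ := mul_pos (by linarith) hgτ
    have h4 : (1 - μ) * g τ ≤ (1 - μ) * g x :=
      mul_le_mul_of_nonneg_left (hgpos x hx) (by linarith)
    calc (1 : ℝ) = (1 - μ) * g τ * (1 / ((1 - μ) * g τ)) := (mul_one_div_cancel hp.ne').symm
      _ ≤ (1 - μ) * g x * G x := mul_le_mul h4 h (by positivity) (by linarith)
  -- The behaviour near `α` is split according to whether `g` is bounded above there.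
  have hlow : ∃ x ∈ Ioo α τ, (1 - μ) * g x * G x ≤ 1 := by
    set m := (α + τ) / 2 with hm
    have hmI : m ∈ Ioo α τ := ⟨by linarith, by linarith⟩
    have hmI' : m ∈ Ioc α τ := Ioo_subset_Ioc_self hmI
    by_cases hbd : ∃ M, ∀ x ∈ Ioo α m, g x ≤ M
    · obtain ⟨M₀, hM₀⟩ := hbd
      set M := max M₀ 1 with hMdef
      have hM1 : 0 < M := lt_max_of_lt_right one_pos
      have hM : ∀ x ∈ Ioo α m, g x ≤ M := fun x hx => (hM₀ x hx).trans (le_max_left _ _)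
      set δ := g m + C m - R m with hδ
      have hδ0 : 0 < δ := by have := hE m hmI; linarith
      have hδx : ∀ x ∈ Ioo α m, δ ≤ g x + C x - R x := fun x hx => by
        have hx' : x ∈ Ioc α τ := ⟨hx.1, (hx.2.trans hmI.2).le⟩
        have e1 := hga hx' hmI' hx.2.le
        have e2 := hF hx' hmI' hx.2.le
        simp only at e2
        linarith
      have hIm : Ioo α m ∈ 𝓝[>] α := Ioo_mem_nhdsGT hmI.1
      have hsin : ∀ a, Tendsto (fun x => Real.sin (x * a)) (𝓝[>] α) (𝓝 (Real.sin (α * a))) :=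
        fun a => (Continuous.tendsto (by fun_prop) α).mono_left nhdsWithin_le_nhds
      -- This `ε` makes the first term `2 ε / δ` of `green_le_of_direction` equal to `1 / (2 M)`.
      -- The second term is `|sin (x a)| / ε`, which is below `1 / (2 M)` close to `α` if that sine
      -- vanishes at `α`.
      set ε := δ / (4 * M) with hε
      have hε0 : 0 < ε := by positivity
      have hfin : ∀ (a : ℝ) (d : ℤ × ℤ), Real.sin (α * a) = 0 →
          (a = a₁ ∧ d = (1, 0) ∨ a = a₂ ∧ d = (0, 1)) →
          ∃ x ∈ Ioo α τ, (1 - μ) * g x * G x ≤ 1 := by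
        intro a d hsa had
        have hev : ∀ᶠ x in 𝓝[>] α, |Real.sin (x * a)| < ε / (2 * M) := by
          have := (hsin a).abs
          rw [hsa, abs_zero] at this
          exact this.eventually_lt_const (by positivity)
        obtain ⟨x, hx1, hx⟩ := (hev.and (eventually_mem_set.2 hIm)).exists
        have hxI : x ∈ Ioo α τ := ⟨hx.1, hx.2.trans hmI.2⟩
        have hxI' : x ∈ Ioc α τ := Ioo_subset_Ioc_self hxI
        have hne : Real.sin (x * a) ≠ 0 := by
          rcases had with ⟨rfl, -⟩ | ⟨rfl, -⟩
          · exact h1 x hxI'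
          · exact h2 x hxI'
        have hspos : 0 < |Real.sin (x * a)| := abs_pos.2 hne
        refine ⟨x, hxI, ?_⟩
        have h := Lattice.green_le_of_direction (t₁ := 1 / |Real.sin (x * a₁)| / 2)
          (t₂ := 1 / |Real.sin (x * a₂)| / 2) (E := g x + C x) (by positivity) (by positivity)
          (hEG x hxI) (t := 1 / |Real.sin (x * a)| / 2) (by positivity) (d := d)
          (by rcases had with ⟨rfl, rfl⟩ | ⟨rfl, rfl⟩ <;> simp) hε0
        change G x ≤ _ at h
        rw [hdiff x] at h
        have e1 : 2 * ε / (g x + C x - R x) ≤ 1 / (2 * M) := by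
          refine (div_le_div_of_nonneg_left (by positivity) hδ0 (hδx x hx)).trans (le_of_eq ?_)
          rw [hε]; field_simp; norm_num
        have e2 : 1 / (2 * ε * (1 / |Real.sin (x * a)| / 2)) ≤ 1 / (2 * M) := by
          have : 1 / (2 * ε * (1 / |Real.sin (x * a)| / 2)) = |Real.sin (x * a)| / ε := by
            field_simp
          rw [this, div_le_iff₀ hε0]
          refine hx1.le.trans (le_of_eq ?_)
          ring
        have e3 : G x ≤ 1 / M := by
          have : 1 / (2 * M) + 1 / (2 * M) = 1 / M := by field_simp; norm_num
          linarith
        have e4 : (1 - μ) * g x ≤ M := by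
          have h5 := hM x hx
          have h6 := hgpos x hxI
          nlinarith
        calc (1 - μ) * g x * G x ≤ M * (1 / M) := mul_le_mul e4 e3 (hG0 x hxI) hM1.le
          _ = 1 := by field_simp
      rcases hα with h | h | ⟨h, hne⟩
      · exact hfin a₁ (1, 0) h (Or.inl ⟨rfl, rfl⟩)
      · exact hfin a₂ (0, 1) h (Or.inr ⟨rfl, rfl⟩)
      -- `g x sin (x a₃) = cos (x a₃) - cos β`: a bounded `g` would force the right side to vanish
      -- at `α`.
      · exfalso
        have t1 : Tendsto (fun x => M * |Real.sin (x * a₃)|) (𝓝[>] α) (𝓝 0) := by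
          have := ((hsin a₃).abs).const_mul M
          simpa [h] using this
        have t2 : Tendsto (fun x => |Real.cos (x * a₃) - Real.cos β|) (𝓝[>] α)
            (𝓝 |Real.cos (α * a₃) - Real.cos β|) :=
          (Continuous.tendsto (f := fun x => |Real.cos (x * a₃) - Real.cos β|)
            (by fun_prop) α).mono_left nhdsWithin_le_nhds
        have t3 : |Real.cos (α * a₃) - Real.cos β| ≤ 0 := by
          refine le_of_tendsto_of_tendsto t2 t1 ?_
          filter_upwards [hIm] with x hx
          have hxI : x ∈ Ioo α τ := ⟨hx.1, hx.2.trans hmI.2⟩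
          have h5 := hM x hx
          have h6 := hgpos x hxI
          have h7 : |g x| ≤ M := by rw [abs_of_pos (by linarith)]; exact h5
          have h8 : Real.cos (x * a₃) - Real.cos β = g x * Real.sin (x * a₃) :=
            (div_mul_cancel₀ _ (h3 x (Ioo_subset_Ioc_self hxI))).symm
          rw [h8, abs_mul]
          exact mul_le_mul_of_nonneg_right h7 (abs_nonneg _)
        exact hne (sub_eq_zero.1 (abs_nonpos_iff.1 t3))
    · push Not at hbd
      -- Above this threshold `μ g x > R m - C m ≥ R x - C x`, that is `(1 - μ) g x ≤ E - R`, and `G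
      -- ≤ 1 / (E - R)` concludes.
      obtain ⟨x, hx, hgx⟩ := hbd ((R m - C m) / μ)
      have hxI : x ∈ Ioo α τ := ⟨hx.1, hx.2.trans hmI.2⟩
      refine ⟨x, hxI, ?_⟩
      have e2 := hF (Ioo_subset_Ioc_self hxI) hmI' hx.2.le
      simp only at e2
      rw [div_lt_iff₀ hμ0] at hgx
      have h := Lattice.green_le_inv (t₁ := 1 / |Real.sin (x * a₁)| / 2)
          (t₂ := 1 / |Real.sin (x * a₂)| / 2) (E := g x + C x) (by positivity) (by positivity)
          (hEG x hxI)
      change G x ≤ _ at h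
      rw [hdiff x] at h
      have hpos : 0 < g x + C x - R x := by have := hE x hxI; linarith
      have h6 := hgpos x hxI
      have h7 : (1 - μ) * g x ≤ g x + C x - R x := by nlinarith
      calc (1 - μ) * g x * G x ≤ (g x + C x - R x) * (1 / (g x + C x - R x)) :=
            mul_le_mul h7 h (hG0 x hxI) hpos.le
        _ = 1 := by field_simp
  obtain ⟨x, hx, hx1⟩ := hlow
  obtain ⟨y, hy, hy1⟩ := hhigh
  obtain ⟨ω, hω, hω1⟩ := isPreconnected_Ioo.intermediate_value hx hy hcN ⟨hx1, hy1⟩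
  have hω' : ω ∈ Ioc α τ := Ioo_subset_Ioc_self hω
  exact ⟨ω, hω, exists_vertexEquation_of_green (h1 ω hω') (h2 ω hω') (hE ω hω) hω1⟩

end Gap

end LimitGraph

/-! ### From solutions of the vertex equation to eigenfunctions. -/

namespace LimitGraph

section EdgeSums

variable {α : Type*} [AddCommGroup α] [TopologicalSpace α] [IsTopologicalAddGroup α]

/-- A sum over the edges is the sum of the sums over the four families of edges. -/
theorem hasSum_edge {f : Edge → α} {s₁ s₂ s₃ s₄ : α}
    (h₁ : HasSum (fun x : ℤ × ℤ => f (.e₁ x.1 x.2)) s₁)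
    (h₂ : HasSum (fun x : ℤ × ℤ => f (.e₂ x.1 x.2)) s₂)
    (h₃ : HasSum (fun x : ℤ × ℤ => f (.ePlus x.1 x.2)) s₃)
    (h₄ : HasSum (fun x : ℤ × ℤ => f (.eMinus x.1 x.2)) s₄) :
    HasSum f (s₁ + s₂ + s₃ + s₄) := by
  have i₁ : Function.Injective fun x : ℤ × ℤ => Edge.e₁ x.1 x.2 := fun x y h => by
    simpa [Prod.ext_iff] using h
  have i₂ : Function.Injective fun x : ℤ × ℤ => Edge.e₂ x.1 x.2 := fun x y h => by
    simpa [Prod.ext_iff] using h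
  have i₃ : Function.Injective fun x : ℤ × ℤ => Edge.ePlus x.1 x.2 := fun x y h => by
    simpa [Prod.ext_iff] using h
  have i₄ : Function.Injective fun x : ℤ × ℤ => Edge.eMinus x.1 x.2 := fun x y h => by
    simpa [Prod.ext_iff] using h
  have g₁ : HasSum (fun e : Edge => match e with | .e₁ k l => f (.e₁ k l) | _ => 0) s₁ := by
    refine (i₁.hasSum_iff fun e he => ?_).1 h₁
    cases e <;> first | rfl | exact absurd ⟨(_, _), rfl⟩ he
  have g₂ : HasSum (fun e : Edge => match e with | .e₂ k l => f (.e₂ k l) | _ => 0) s₂ := by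
    refine (i₂.hasSum_iff fun e he => ?_).1 h₂
    cases e <;> first | rfl | exact absurd ⟨(_, _), rfl⟩ he
  have g₃ : HasSum (fun e : Edge => match e with | .ePlus k l => f (.ePlus k l) | _ => 0) s₃ := by
    refine (i₃.hasSum_iff fun e he => ?_).1 h₃
    cases e <;> first | rfl | exact absurd ⟨(_, _), rfl⟩ he
  have g₄ : HasSum (fun e : Edge => match e with | .eMinus k l => f (.eMinus k l) | _ => 0) s₄ := by
    refine (i₄.hasSum_iff fun e he => ?_).1 h₄
    cases e <;> first | rfl | exact absurd ⟨(_, _), rfl⟩ he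
  convert ((g₁.add g₂).add g₃).add g₄ using 1
  ext e
  cases e <;> simp

theorem summable_edge {f : Edge → α}
    (h₁ : Summable fun x : ℤ × ℤ => f (.e₁ x.1 x.2))
    (h₂ : Summable fun x : ℤ × ℤ => f (.e₂ x.1 x.2))
    (h₃ : Summable fun x : ℤ × ℤ => f (.ePlus x.1 x.2))
    (h₄ : Summable fun x : ℤ × ℤ => f (.eMinus x.1 x.2)) : Summable f :=
  (hasSum_edge h₁.hasSum h₂.hasSum h₃.hasSum h₄.hasSum).summable

end EdgeSums

variable {a₁ a₂ a₃ β μ ω : ℝ}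

theorem Edge.lo_lt_hi (ha₁ : 0 < a₁) (ha₂ : 0 < a₂) (ha₃ : 0 < a₃) (e : Edge) :
    e.lo a₁ a₂ a₃ < e.hi a₁ a₂ a₃ := by
  cases e <;> simp only [Edge.lo, Edge.hi] <;> nlinarith

/-- A uniform bound of the lengths of the edges. -/
theorem Edge.length_le (ha₁ : 0 < a₁) (ha₂ : 0 < a₂) (ha₃ : 0 < a₃) (e : Edge) :
    e.hi a₁ a₂ a₃ - e.lo a₁ a₂ a₃ ≤ a₁ + a₂ + a₃ := by
  cases e <;> simp only [Edge.lo, Edge.hi] <;> nlinarith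

theorem integral_edge_sq_le {W : ℝ → ℂ} {e : Edge} (ha₁ : 0 < a₁) (ha₂ : 0 < a₂) (ha₃ : 0 < a₃)
    (hc : ContinuousOn W (Icc (e.lo a₁ a₂ a₃) (e.hi a₁ a₂ a₃))) {B : ℝ}
    (hB : ∀ x ∈ Icc (e.lo a₁ a₂ a₃) (e.hi a₁ a₂ a₃), ‖W x‖ ≤ B) :
    ∫ x, ‖W x‖ ^ 2 ∂(edgeVolume a₁ a₂ a₃ e) ≤ (a₁ + a₂ + a₃) * B ^ 2 := by
  have hlt := e.lo_lt_hi ha₁ ha₂ ha₃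
  have h : ∫ x in Icc (e.lo a₁ a₂ a₃) (e.hi a₁ a₂ a₃), ‖W x‖ ^ 2
      ≤ ∫ _ in Icc (e.lo a₁ a₂ a₃) (e.hi a₁ a₂ a₃), B ^ 2 :=
    setIntegral_mono_on (hc.norm.pow 2).integrableOn_Icc continuousOn_const.integrableOn_Icc
      measurableSet_Icc fun x hx => pow_le_pow_left₀ (norm_nonneg _) (hB x hx) 2
  refine h.trans ?_
  rw [setIntegral_const, smul_eq_mul, Real.volume_real_Icc_of_le hlt.le]
  exact mul_le_mul_of_nonneg_right (e.length_le ha₁ ha₂ ha₃) (sq_nonneg _)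

instance isFiniteMeasure_edgeVolume (e : Edge) : IsFiniteMeasure (edgeVolume a₁ a₂ a₃ e) := by
  unfold edgeVolume
  infer_instance

theorem sqIntegrable_of_bound (ha₁ : 0 < a₁) (ha₂ : 0 < a₂) (ha₃ : 0 < a₃)
    {W : Edge → ℝ → ℂ} {B : Edge → ℝ}
    (hc : ∀ e, ContinuousOn (W e) (Icc (e.lo a₁ a₂ a₃) (e.hi a₁ a₂ a₃)))
    (hB : ∀ e, ∀ x ∈ Icc (e.lo a₁ a₂ a₃) (e.hi a₁ a₂ a₃), ‖W e x‖ ≤ B e)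
    (hs : Summable fun e => B e ^ 2) : SqIntegrable a₁ a₂ a₃ W := by
  refine ⟨fun e => ?_, ?_⟩
  · refine MemLp.of_bound ((hc e).aestronglyMeasurable measurableSet_Icc) (B e) ?_
    exact (ae_restrict_iff' measurableSet_Icc).2 (Eventually.of_forall (hB e))
  · exact Summable.of_nonneg_of_le (fun e => integral_nonneg fun x => by positivity)
      (fun e => integral_edge_sq_le ha₁ ha₂ ha₃ (hc e) (hB e)) (hs.mul_left _)

/-- Edgewise smooth solutions of `-u'' = ω² u` that satisfy all the vertex conditions. -/
structure IsLocalSolution (a₁ a₂ a₃ β μ ω : ℝ) (U V : Edge → ℝ → ℂ) : Prop where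
  deriv : ∀ e x, HasDerivAt (U e) (V e x) x
  deriv2 : ∀ e x, HasDerivAt (V e) (-(ω : ℂ) ^ 2 * U e x) x
  vertex : ∀ k l : ℤ, ∃ p : ℂ,
    U (.e₁ k l) (k * a₁) = p ∧ U (.e₁ (k - 1) l) (k * a₁) = p ∧
    U (.e₂ k l) (l * a₂) = p ∧ U (.e₂ k (l - 1)) (l * a₂) = p ∧
    U (.ePlus k l) 0 = p ∧ U (.eMinus k l) 0 = p
  quasiPer : ∀ k l : ℤ, U (.ePlus k l) (a₃ / 2) =
    Complex.exp (-(Complex.I * β)) * U (.eMinus k l) (-(a₃ / 2))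
  quasiPer_deriv : ∀ k l : ℤ, V (.ePlus k l) (a₃ / 2) =
    Complex.exp (-(Complex.I * β)) * V (.eMinus k l) (-(a₃ / 2))
  kirchhoff : ∀ k l : ℤ,
    V (.e₁ k l) (k * a₁) - V (.e₁ (k - 1) l) (k * a₁)
      + V (.e₂ k l) (l * a₂) - V (.e₂ k (l - 1)) (l * a₂)
      + (vertexWeight μ k l : ℂ) * (V (.ePlus k l) 0 - V (.eMinus k l) 0) = 0

theorem isH2On_of_hasDerivAt {lo hi : ℝ} {U V G : ℝ → ℂ} (hU : ∀ x, HasDerivAt U (V x) x)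
    (hV : ∀ x, HasDerivAt V (G x) x) (hG : Continuous G) : IsH2On lo hi U V G := by
  have cU : Continuous U := continuous_iff_continuousAt.2 fun x => (hU x).continuousAt
  have cV : Continuous V := continuous_iff_continuousAt.2 fun x => (hV x).continuousAt
  refine ⟨?_, cU.continuousOn, cV.continuousOn, fun x _ => ?_, fun x _ => ?_⟩
  · obtain ⟨C, hC⟩ := isCompact_Icc.exists_bound_of_continuousOn (s := Icc lo hi) hG.continuousOn
    refine MemLp.of_bound hG.aestronglyMeasurable C ?_
    rw [ae_restrict_iff' measurableSet_Icc]
    exact Eventually.of_forall hC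
  · rw [intervalIntegral.integral_eq_sub_of_hasDerivAt (fun y _ => hU y)
      (cV.intervalIntegrable _ _)]
    ring
  · rw [intervalIntegral.integral_eq_sub_of_hasDerivAt (fun y _ => hV y)
      (hG.intervalIntegrable _ _)]
    ring

/-- A square integrable local solution provides an eigenvalue. -/
theorem IsLocalSolution.isEigenvalue {U V : Edge → ℝ → ℂ} (ha₁ : 0 < a₁) (ha₂ : 0 < a₂)
    (ha₃ : 0 < a₃) (hμ : 0 < μ) (h : IsLocalSolution a₁ a₂ a₃ β μ ω U V)
    (hU : SqIntegrable a₁ a₂ a₃ U) (hV : SqIntegrable a₁ a₂ a₃ V)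
    (hne : ∃ e, ∃ x ∈ Icc (e.lo a₁ a₂ a₃) (e.hi a₁ a₂ a₃), U e x ≠ 0) :
    UnboundedOp.IsEigenvalue (limitOp a₁ a₂ a₃ β μ) ((ω ^ 2 : ℝ) : ℂ) := by
  have cU : ∀ e, Continuous (U e) := fun e =>
    continuous_iff_continuousAt.2 fun x => (h.deriv e x).continuousAt
  have hG : SqIntegrable a₁ a₂ a₃ fun e x => -(ω : ℂ) ^ 2 * U e x := hU.smul (-(ω : ℂ) ^ 2)
  have hdom : IsInDomain a₁ a₂ a₃ β μ U V fun e x => -(ω : ℂ) ^ 2 * U e x :=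
    ⟨⟨fun e => isH2On_of_hasDerivAt (h.deriv e) (h.deriv2 e) (continuous_const.mul (cU e)),
      hU, hV, hG, h.vertex⟩, h.quasiPer, h.quasiPer_deriv, h.kirchhoff⟩
  obtain ⟨u, hu⟩ := exists_L2G hμ hU
  refine isEigenvalue_of_isOpPair hμ (u := u) ?_ ⟨U, V, _, hdom, hu, fun e => ?_⟩
  · rintro rfl
    obtain ⟨e, x, hx, hxU⟩ := hne
    have h1 : U e =ᵐ[edgeMeasure a₁ a₂ a₃ μ e] 0 := by
      refine (hu e).symm.trans ?_
      exact Lp.coeFn_zero _ _ _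
    rw [EventuallyEq, ae_edgeMeasure hμ] at h1
    exact hxU (Measure.eqOn_Icc_of_ae_eq _ (e.lo_lt_hi ha₁ ha₂ ha₃).ne h1 (cU e).continuousOn
      continuousOn_const hx)
  · filter_upwards [hu e, Lp.coeFn_smul ((ω ^ 2 : ℝ) : ℂ) (u e)] with x h1 h2
    have h3 : ((((ω ^ 2 : ℝ) : ℂ) • u) e : ℝ → ℂ) x = ((ω ^ 2 : ℝ) : ℂ) • (u e : ℝ → ℂ) x := h2
    rw [h3, h1, smul_eq_mul]
    push_cast
    ring

section SinWave

/-- Phase shift of the elementary solution with coefficient `A`. -/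
noncomputable def Edge.phaseHi (a₁ a₂ a₃ : ℝ) : Edge → ℝ
  | .e₁ k _ => (k + 1) * a₁
  | .e₂ _ l => (l + 1) * a₂
  | .ePlus _ _ => a₃
  | .eMinus _ _ => 0

/-- Phase shift of the elementary solution with coefficient `B`. -/
noncomputable def Edge.phaseLo (a₁ a₂ a₃ : ℝ) : Edge → ℝ
  | .e₁ k _ => k * a₁
  | .e₂ _ l => l * a₂
  | .ePlus _ _ => 0
  | .eMinus _ _ => -a₃

/-- The solution of `-u'' = ω² u` with coefficients `A`, `B` on the edges. -/
noncomputable def sinWave (a₁ a₂ a₃ ω : ℝ) (A B : Edge → ℂ) (e : Edge) (x : ℝ) : ℂ :=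
  A e * (Real.sin (ω * (e.phaseHi a₁ a₂ a₃ - x)) : ℝ)
    + B e * (Real.sin (ω * (e.phaseLo a₁ a₂ a₃ - x)) : ℝ)

/-- The derivative of `sinWave`. -/
noncomputable def sinWaveDeriv (a₁ a₂ a₃ ω : ℝ) (A B : Edge → ℂ) (e : Edge) (x : ℝ) : ℂ :=
  A e * (-(ω * Real.cos (ω * (e.phaseHi a₁ a₂ a₃ - x))) : ℝ)
    + B e * (-(ω * Real.cos (ω * (e.phaseLo a₁ a₂ a₃ - x))) : ℝ)

variable {A B : Edge → ℂ}

theorem hasDerivAt_sinWave (e : Edge) (x : ℝ) :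
    HasDerivAt (sinWave a₁ a₂ a₃ ω A B e) (sinWaveDeriv a₁ a₂ a₃ ω A B e x) x :=
  ((hasDerivAt_sin_sub ω _ x).const_mul (A e)).add ((hasDerivAt_sin_sub ω _ x).const_mul (B e))

theorem hasDerivAt_sinWaveDeriv (e : Edge) (x : ℝ) :
    HasDerivAt (sinWaveDeriv a₁ a₂ a₃ ω A B e) (-(ω : ℂ) ^ 2 * sinWave a₁ a₂ a₃ ω A B e x) x := by
  have h := (((hasDerivAt_cos_sub ω (e.phaseHi a₁ a₂ a₃) x).const_mul (-(ω : ℂ))).const_mul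
    (A e)).add (((hasDerivAt_cos_sub ω (e.phaseLo a₁ a₂ a₃) x).const_mul (-(ω : ℂ))).const_mul (B e))
  refine (h.congr_deriv ?_).congr_of_eventuallyEq (Eventually.of_forall fun y => ?_)
  · simp only [sinWave, Complex.ofReal_mul]; ring
  · simp [sinWaveDeriv]

theorem norm_sinWave_le (e : Edge) (x : ℝ) :
    ‖sinWave a₁ a₂ a₃ ω A B e x‖ ≤ ‖A e‖ + ‖B e‖ := by
  refine (norm_add_le _ _).trans ?_
  rw [norm_mul, norm_mul, Complex.norm_real, Complex.norm_real]
  exact add_le_add (mul_le_of_le_one_right (norm_nonneg _) (Real.abs_sin_le_one _))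
    (mul_le_of_le_one_right (norm_nonneg _) (Real.abs_sin_le_one _))

theorem norm_sinWaveDeriv_le (e : Edge) (x : ℝ) :
    ‖sinWaveDeriv a₁ a₂ a₃ ω A B e x‖ ≤ |ω| * (‖A e‖ + ‖B e‖) := by
  refine (norm_add_le _ _).trans ?_
  rw [norm_mul, norm_mul, Complex.norm_real, Complex.norm_real, norm_neg, norm_neg, norm_mul,
    norm_mul, mul_add, mul_comm |ω|, mul_comm |ω|]
  exact add_le_add
    (mul_le_mul_of_nonneg_left (mul_le_of_le_one_right (norm_nonneg _) (Real.abs_cos_le_one _))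
      (norm_nonneg _))
    (mul_le_mul_of_nonneg_left (mul_le_of_le_one_right (norm_nonneg _) (Real.abs_cos_le_one _))
      (norm_nonneg _))

/-- Coefficients, on the elementary solutions shifted by `phaseHi`, for given vertex values. -/
noncomputable def coeffHi (a₁ a₂ a₃ β ω : ℝ) (p : ℤ × ℤ → ℂ) : Edge → ℂ
  | .e₁ k l => p (k, l) / Real.sin (ω * a₁)
  | .e₂ k l => p (k, l) / Real.sin (ω * a₂)
  | .ePlus k l => p (k, l) / Real.sin (ω * a₃)
  | .eMinus k l => Complex.exp (Complex.I * β) * p (k, l) / Real.sin (ω * a₃)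

/-- Coefficients, on the elementary solutions shifted by `phaseLo`, for given vertex values. -/
noncomputable def coeffLo (a₁ a₂ a₃ β ω : ℝ) (p : ℤ × ℤ → ℂ) : Edge → ℂ
  | .e₁ k l => -p (k + 1, l) / Real.sin (ω * a₁)
  | .e₂ k l => -p (k, l + 1) / Real.sin (ω * a₂)
  | .ePlus k l => -Complex.exp (-(Complex.I * β)) * p (k, l) / Real.sin (ω * a₃)
  | .eMinus k l => -p (k, l) / Real.sin (ω * a₃)

/-- The vertex equation produces a local solution. -/
theorem isLocalSolution_sinWave {p : ℤ × ℤ → ℂ} (h1 : Real.sin (ω * a₁) ≠ 0)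
    (h2 : Real.sin (ω * a₂) ≠ 0) (h3 : Real.sin (ω * a₃) ≠ 0)
    (hp : ∀ k l : ℤ,
      (p (k + 1, l) + p (k - 1, l) - 2 * (Real.cos (ω * a₁) : ℝ) * p (k, l))
          / (Real.sin (ω * a₁) : ℝ)
        + (p (k, l + 1) + p (k, l - 1) - 2 * (Real.cos (ω * a₂) : ℝ) * p (k, l))
          / (Real.sin (ω * a₂) : ℝ)
        = 2 * (vertexWeight μ k l : ℝ) * (verticalTerm a₃ β ω : ℝ) * p (k, l)) :
    IsLocalSolution a₁ a₂ a₃ β μ ω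
      (sinWave a₁ a₂ a₃ ω (coeffHi a₁ a₂ a₃ β ω p) (coeffLo a₁ a₂ a₃ β ω p))
      (sinWaveDeriv a₁ a₂ a₃ ω (coeffHi a₁ a₂ a₃ β ω p) (coeffLo a₁ a₂ a₃ β ω p)) := by
  have c1 : ((Real.sin (ω * a₁) : ℝ) : ℂ) ≠ 0 := by exact_mod_cast h1
  have c2 : ((Real.sin (ω * a₂) : ℝ) : ℂ) ≠ 0 := by exact_mod_cast h2
  have c3 : ((Real.sin (ω * a₃) : ℝ) : ℂ) ≠ 0 := by exact_mod_cast h3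
  have hexp : Complex.exp (-(Complex.I * β)) * Complex.exp (Complex.I * β) = 1 := by
    rw [← Complex.exp_add]; simp
  have hcos : Complex.exp (-(Complex.I * β)) + Complex.exp (Complex.I * β)
      = 2 * (Real.cos β : ℝ) := by
    rw [Complex.ofReal_cos, Complex.cos]
    rw [mul_comm Complex.I, neg_mul]; ring
  have e1 : ∀ (k : ℤ) (a : ℝ), ω * ((k + 1) * a - k * a) = ω * a := fun k a => by ring
  have e2 : ∀ (k : ℤ) (a : ℝ), ω * ((((k - 1 : ℤ) : ℝ) + 1) * a - k * a) = 0 := fun k a => by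
    push_cast; ring
  have e3 : ∀ (k : ℤ) (a : ℝ), ω * (((k - 1 : ℤ) : ℝ) * a - k * a) = -(ω * a) := fun k a => by
    push_cast; ring
  have e4 : ω * (a₃ - a₃ / 2) = ω * a₃ / 2 := by ring
  have e5 : ω * (0 - a₃ / 2) = -(ω * a₃ / 2) := by ring
  have e6 : ω * (0 - -(a₃ / 2)) = ω * a₃ / 2 := by ring
  have e7 : ω * (-a₃ - -(a₃ / 2)) = -(ω * a₃ / 2) := by ring
  have e8 : ω * (-a₃) = -(ω * a₃) := by ring
  -- Quasi-periodicity glues the two vertical halves into one segment of length `a₃`, with value `p`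
  -- at one end and `e^{∓iβ} p` at the other; hence phases `a₃` and `-a₃` that lie beyond the half
  -- edges.
  refine ⟨hasDerivAt_sinWave, hasDerivAt_sinWaveDeriv, fun k l => ⟨p (k, l), ?_, ?_, ?_, ?_, ?_, ?_⟩,
    fun k l => ?_, fun k l => ?_, fun k l => ?_⟩
  · simp only [sinWave, coeffHi, coeffLo, Edge.phaseHi, Edge.phaseLo, e1, sub_self, mul_zero,
      Real.sin_zero, Complex.ofReal_zero]
    field_simp; ring
  · simp only [sinWave, coeffHi, coeffLo, Edge.phaseHi, Edge.phaseLo, e2, e3, mul_zero,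
      Real.sin_zero, Complex.ofReal_zero, Real.sin_neg, Complex.ofReal_neg, sub_add_cancel]
    field_simp; ring
  · simp only [sinWave, coeffHi, coeffLo, Edge.phaseHi, Edge.phaseLo, e1, sub_self, mul_zero,
      Real.sin_zero, Complex.ofReal_zero]
    field_simp; ring
  · simp only [sinWave, coeffHi, coeffLo, Edge.phaseHi, Edge.phaseLo, e2, e3, mul_zero,
      Real.sin_zero, Complex.ofReal_zero, Real.sin_neg, Complex.ofReal_neg, sub_add_cancel]
    field_simp; ring
  · simp only [sinWave, coeffHi, coeffLo, Edge.phaseHi, Edge.phaseLo, sub_zero, mul_zero,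
      Real.sin_zero, Complex.ofReal_zero]
    field_simp; ring
  · simp only [sinWave, coeffHi, coeffLo, Edge.phaseHi, Edge.phaseLo, e8, sub_zero, mul_zero,
      Real.sin_zero, Complex.ofReal_zero, Real.sin_neg, Complex.ofReal_neg]
    field_simp; ring
  · simp only [sinWave, coeffHi, coeffLo, Edge.phaseHi, Edge.phaseLo, e4, e5, e6, e7,
      Real.sin_neg, Complex.ofReal_neg]
    linear_combination (-p (k, l) / (Real.sin (ω * a₃) : ℝ) * (Real.sin (ω * a₃ / 2) : ℝ)) * hexp
  · simp only [sinWaveDeriv, coeffHi, coeffLo, Edge.phaseHi, Edge.phaseLo, e4, e5, e6, e7,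
      Real.cos_neg, Complex.ofReal_neg, Complex.ofReal_mul]
    linear_combination
      (p (k, l) / (Real.sin (ω * a₃) : ℝ) * ω * (Real.cos (ω * a₃ / 2) : ℝ)) * hexp
  · simp only [sinWaveDeriv, coeffHi, coeffLo, Edge.phaseHi, Edge.phaseLo, e1, e2, e3, e8,
      sub_self, sub_zero, mul_zero, Real.cos_zero, Real.cos_neg, Complex.ofReal_neg,
      Complex.ofReal_mul, Complex.ofReal_one, sub_add_cancel]
    have hkl := hp k l
    have hv : ((verticalTerm a₃ β ω : ℝ) : ℂ)
        = ((Real.cos (ω * a₃) : ℝ) - (Real.cos β : ℝ)) / (Real.sin (ω * a₃) : ℝ) := by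
      unfold verticalTerm
      push_cast
      rfl
    rw [hv] at hkl
    -- The vertical fluxes contribute `e^{-iβ} + e^{iβ} = 2 cos β`, which produces the numerator of
    -- `verticalTerm`.
    linear_combination (ω : ℂ) * hkl + (vertexWeight μ k l : ℂ) * ω * p (k, l)
      / (Real.sin (ω * a₃) : ℝ) * hcos

/-- The common bound of the coefficients of `sinWave` in terms of the vertex values. -/
theorem norm_coeff_le (p : ℤ × ℤ → ℂ) : ∃ K : ℝ, 0 ≤ K ∧
    (∀ k l, ‖coeffHi a₁ a₂ a₃ β ω p (.e₁ k l)‖ + ‖coeffLo a₁ a₂ a₃ β ω p (.e₁ k l)‖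
      ≤ K * (‖p (k, l)‖ + ‖p (k + 1, l)‖)) ∧
    (∀ k l, ‖coeffHi a₁ a₂ a₃ β ω p (.e₂ k l)‖ + ‖coeffLo a₁ a₂ a₃ β ω p (.e₂ k l)‖
      ≤ K * (‖p (k, l)‖ + ‖p (k, l + 1)‖)) ∧
    (∀ k l, ‖coeffHi a₁ a₂ a₃ β ω p (.ePlus k l)‖ + ‖coeffLo a₁ a₂ a₃ β ω p (.ePlus k l)‖
      ≤ K * (‖p (k, l)‖ + ‖p (k, l)‖)) ∧
    (∀ k l, ‖coeffHi a₁ a₂ a₃ β ω p (.eMinus k l)‖ + ‖coeffLo a₁ a₂ a₃ β ω p (.eMinus k l)‖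
      ≤ K * (‖p (k, l)‖ + ‖p (k, l)‖)) := by
  have hx1 : ‖Complex.exp (Complex.I * β)‖ = 1 := by
    rw [mul_comm]; exact Complex.norm_exp_ofReal_mul_I β
  have hx2 : ‖Complex.exp (-(Complex.I * β))‖ = 1 := by
    rw [Complex.exp_neg, norm_inv, hx1, inv_one]
  have i1 : 0 ≤ ‖((Real.sin (ω * a₁) : ℝ) : ℂ)‖⁻¹ := by positivity
  have i2 : 0 ≤ ‖((Real.sin (ω * a₂) : ℝ) : ℂ)‖⁻¹ := by positivity
  have i3 : 0 ≤ ‖((Real.sin (ω * a₃) : ℝ) : ℂ)‖⁻¹ := by positivity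
  refine ⟨‖((Real.sin (ω * a₁) : ℝ) : ℂ)‖⁻¹ + ‖((Real.sin (ω * a₂) : ℝ) : ℂ)‖⁻¹
    + ‖((Real.sin (ω * a₃) : ℝ) : ℂ)‖⁻¹, by positivity, fun k l => ?_, fun k l => ?_,
    fun k l => ?_, fun k l => ?_⟩ <;>
  · simp only [coeffHi, coeffLo, norm_mul, norm_inv, norm_neg, hx1, hx2, one_mul, div_eq_mul_inv,
      ← add_mul]
    rw [mul_comm]
    refine mul_le_mul_of_nonneg_right ?_ (by positivity)
    linarith

/-- A square summable solution of the vertex equation provides an eigenvalue. -/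
theorem isEigenvalue_of_vertexEquation (ha₁ : 0 < a₁) (ha₂ : 0 < a₂)
    (ha₃ : 0 < a₃) (hμ : 0 < μ) (h1 : Real.sin (ω * a₁) ≠ 0)
    (h2 : Real.sin (ω * a₂) ≠ 0) (h3 : Real.sin (ω * a₃) ≠ 0) {p : ℤ × ℤ → ℝ} (hp0 : p ≠ 0)
    (hps : Summable fun x => ‖p x‖ ^ 2) (hp : VertexEquation a₁ a₂ a₃ β μ ω p) :
    UnboundedOp.IsEigenvalue (limitOp a₁ a₂ a₃ β μ) ((ω ^ 2 : ℝ) : ℂ) := by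
  set P : ℤ × ℤ → ℂ := fun x => (p x : ℂ) with hP
  have hsol := isLocalSolution_sinWave (β := β) (μ := μ) (p := P) h1 h2 h3 (fun k l => by
    have := congrArg (fun r : ℝ => (r : ℂ)) (hp k l)
    push_cast at this ⊢
    exact this)
  have hPs : Summable fun x => ‖P x‖ ^ 2 := by simpa [hP] using hps
  obtain ⟨K, hK, k1, k2, k3, k4⟩ := norm_coeff_le (a₁ := a₁) (a₂ := a₂) (a₃ := a₃) (β := β)
    (ω := ω) P
  set A := coeffHi a₁ a₂ a₃ β ω P
  set B := coeffLo a₁ a₂ a₃ β ω P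
  have hsh : ∀ d : ℤ × ℤ, Summable fun x => ‖P (x + d)‖ ^ 2 := fun d =>
    (Equiv.addRight d).summable_iff (f := fun x => ‖P x‖ ^ 2) |>.2 hPs
  have hfam : ∀ (b : ℤ × ℤ → ℝ) (d : ℤ × ℤ), (∀ x, 0 ≤ b x) →
      (∀ x, b x ≤ K * (‖P x‖ + ‖P (x + d)‖)) → Summable fun x => b x ^ 2 := by
    intro b d hb0 hb
    refine Summable.of_nonneg_of_le (fun x => sq_nonneg _) (fun x => ?_)
      ((hPs.add (hsh d)).mul_left (2 * K ^ 2))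
    refine (pow_le_pow_left₀ (hb0 x) (hb x) 2).trans ?_
    rw [mul_pow]
    nlinarith [mul_nonneg (sq_nonneg K) (sq_nonneg (‖P x‖ - ‖P (x + d)‖))]
  have hsum : Summable fun e => (‖A e‖ + ‖B e‖) ^ 2 := by
    refine summable_edge ?_ ?_ ?_ ?_
    · exact hfam _ (1, 0) (fun x => by positivity) fun x => by
        have := k1 x.1 x.2
        rwa [show ((x.1 + 1, x.2) : ℤ × ℤ) = x + (1, 0) by ext <;> simp] at this
    · exact hfam _ (0, 1) (fun x => by positivity) fun x => by
        have := k2 x.1 x.2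
        rwa [show ((x.1, x.2 + 1) : ℤ × ℤ) = x + (0, 1) by ext <;> simp] at this
    · exact hfam _ 0 (fun x => by positivity) fun x => by simpa using k3 x.1 x.2
    · exact hfam _ 0 (fun x => by positivity) fun x => by simpa using k4 x.1 x.2
  refine hsol.isEigenvalue ha₁ ha₂ ha₃ hμ ?_ ?_ ?_
  · exact sqIntegrable_of_bound ha₁ ha₂ ha₃ (fun e => fun x _ =>
      (hasDerivAt_sinWave e x).continuousAt.continuousWithinAt)
      (fun e x _ => norm_sinWave_le e x) hsum
  · refine sqIntegrable_of_bound ha₁ ha₂ ha₃ (fun e => fun x _ =>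
      (hasDerivAt_sinWaveDeriv e x).continuousAt.continuousWithinAt)
      (fun e x _ => norm_sinWaveDeriv_le e x) ?_
    simp only [mul_pow]
    exact hsum.mul_left _
  · obtain ⟨x, hx⟩ := Function.ne_iff.1 hp0
    refine ⟨.ePlus x.1 x.2, 0, ?_, ?_⟩
    · simp only [Edge.lo, Edge.hi]
      exact ⟨le_rfl, by positivity⟩
    · have h3' : ((Real.sin (ω * a₃) : ℝ) : ℂ) ≠ 0 := by exact_mod_cast h3
      have : sinWave a₁ a₂ a₃ ω A B (.ePlus x.1 x.2) 0 = P x := by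
        simp only [sinWave, A, B, coeffHi, coeffLo, Edge.phaseHi, Edge.phaseLo, sub_zero, mul_zero,
          Real.sin_zero, Complex.ofReal_zero]
        field_simp; ring
      rw [this]
      simpa [hP] using hx

end SinWave

end LimitGraph

/-! ### Smooth cutoffs on the graph that preserve the domain. -/

namespace LimitGraph

variable {a₁ a₂ a₃ β μ ω : ℝ}

/-- The lattice point at the beginning of a horizontal edge, or carrying a vertical edge. -/
def Edge.source : Edge → ℤ × ℤ
  | .e₁ k l => (k, l)
  | .e₂ k l => (k, l)
  | .ePlus k l => (k, l)
  | .eMinus k l => (k, l)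

/-- The lattice point at the end of a horizontal edge, or carrying a vertical edge. -/
def Edge.target : Edge → ℤ × ℤ
  | .e₁ k l => (k + 1, l)
  | .e₂ k l => (k, l + 1)
  | .ePlus k l => (k, l)
  | .eMinus k l => (k, l)

section Cutoff

/-- Length of an edge. -/
noncomputable def Edge.length (a₁ a₂ a₃ : ℝ) (e : Edge) : ℝ := e.hi a₁ a₂ a₃ - e.lo a₁ a₂ a₃

/-- Cubic interpolation of a function on the lattice, with vanishing derivative at the vertices. -/
noncomputable def cut (a₁ a₂ a₃ : ℝ) (χ : ℤ × ℤ → ℝ) (e : Edge) (x : ℝ) : ℝ :=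
  χ e.source + (χ e.target - χ e.source) *
    (3 * ((x - e.lo a₁ a₂ a₃) / e.length a₁ a₂ a₃) ^ 2
      - 2 * ((x - e.lo a₁ a₂ a₃) / e.length a₁ a₂ a₃) ^ 3)

/-- The derivative of `cut`. -/
noncomputable def cutDeriv (a₁ a₂ a₃ : ℝ) (χ : ℤ × ℤ → ℝ) (e : Edge) (x : ℝ) : ℝ :=
  (χ e.target - χ e.source) *
    ((6 * ((x - e.lo a₁ a₂ a₃) / e.length a₁ a₂ a₃)
      - 6 * ((x - e.lo a₁ a₂ a₃) / e.length a₁ a₂ a₃) ^ 2) / e.length a₁ a₂ a₃)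

/-- The second derivative of `cut`. -/
noncomputable def cutDeriv2 (a₁ a₂ a₃ : ℝ) (χ : ℤ × ℤ → ℝ) (e : Edge) (x : ℝ) : ℝ :=
  (χ e.target - χ e.source) *
    ((6 - 12 * ((x - e.lo a₁ a₂ a₃) / e.length a₁ a₂ a₃)) / e.length a₁ a₂ a₃ ^ 2)

variable {χ : ℤ × ℤ → ℝ}

theorem hasDerivAt_cut (e : Edge) (x : ℝ) :
    HasDerivAt (cut a₁ a₂ a₃ χ e) (cutDeriv a₁ a₂ a₃ χ e x) x := by
  have h : HasDerivAt (fun x => (x - e.lo a₁ a₂ a₃) / e.length a₁ a₂ a₃)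
      (1 / e.length a₁ a₂ a₃) x := ((hasDerivAt_id x).sub_const _).div_const _
  refine (((((h.pow 2).const_mul 3).sub ((h.pow 3).const_mul 2)).const_mul
    (χ e.target - χ e.source)).const_add (χ e.source)).congr_deriv ?_
  simp only [cutDeriv]
  push_cast
  ring

theorem hasDerivAt_cutDeriv (e : Edge) (x : ℝ) :
    HasDerivAt (cutDeriv a₁ a₂ a₃ χ e) (cutDeriv2 a₁ a₂ a₃ χ e x) x := by
  have h : HasDerivAt (fun x => (x - e.lo a₁ a₂ a₃) / e.length a₁ a₂ a₃)
      (1 / e.length a₁ a₂ a₃) x := ((hasDerivAt_id x).sub_const _).div_const _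
  refine ((((h.const_mul 6).sub ((h.pow 2).const_mul 6)).div_const
    (e.length a₁ a₂ a₃)).const_mul (χ e.target - χ e.source)).congr_deriv ?_
  simp only [cutDeriv2]
  push_cast
  ring

theorem Edge.length_pos (ha₁ : 0 < a₁) (ha₂ : 0 < a₂) (ha₃ : 0 < a₃) (e : Edge) :
    0 < e.length a₁ a₂ a₃ := sub_pos.2 (e.lo_lt_hi ha₁ ha₂ ha₃)

theorem cut_lo (e : Edge) : cut a₁ a₂ a₃ χ e (e.lo a₁ a₂ a₃) = χ e.source := by
  simp [cut]

theorem cut_hi (ha₁ : 0 < a₁) (ha₂ : 0 < a₂) (ha₃ : 0 < a₃) (e : Edge) :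
    cut a₁ a₂ a₃ χ e (e.hi a₁ a₂ a₃) = χ e.target := by
  have h : (e.hi a₁ a₂ a₃ - e.lo a₁ a₂ a₃) / e.length a₁ a₂ a₃ = 1 :=
    div_self (e.length_pos ha₁ ha₂ ha₃).ne'
  rw [cut, h]
  ring

theorem cutDeriv_lo (e : Edge) : cutDeriv a₁ a₂ a₃ χ e (e.lo a₁ a₂ a₃) = 0 := by
  simp [cutDeriv]

theorem cutDeriv_hi (ha₁ : 0 < a₁) (ha₂ : 0 < a₂) (ha₃ : 0 < a₃) (e : Edge) :
    cutDeriv a₁ a₂ a₃ χ e (e.hi a₁ a₂ a₃) = 0 := by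
  have h : (e.hi a₁ a₂ a₃ - e.lo a₁ a₂ a₃) / e.length a₁ a₂ a₃ = 1 :=
    div_self (e.length_pos ha₁ ha₂ ha₃).ne'
  rw [cutDeriv, h]
  ring

theorem cut_of_eq {e : Edge} (h : χ e.target = χ e.source) (x : ℝ) :
    cut a₁ a₂ a₃ χ e x = χ e.source := by
  simp [cut, h]

theorem cutDeriv_of_eq {e : Edge} (h : χ e.target = χ e.source) (x : ℝ) :
    cutDeriv a₁ a₂ a₃ χ e x = 0 := by
  simp [cutDeriv, h]

theorem Edge.inv_length_le (ha₁ : 0 < a₁) (ha₂ : 0 < a₂) (ha₃ : 0 < a₃) (e : Edge) :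
    (e.length a₁ a₂ a₃)⁻¹ ≤ a₁⁻¹ + a₂⁻¹ + 2 * a₃⁻¹ := by
  have h1 : 0 < a₁⁻¹ := by positivity
  have h2 : 0 < a₂⁻¹ := by positivity
  have h3 : 0 < a₃⁻¹ := by positivity
  cases e <;> simp only [Edge.length, Edge.lo, Edge.hi]
  · rw [show ((_ : ℤ) + 1 : ℝ) * a₁ - (_ : ℤ) * a₁ = a₁ by ring]; linarith
  · rw [show ((_ : ℤ) + 1 : ℝ) * a₂ - (_ : ℤ) * a₂ = a₂ by ring]; linarith
  · rw [sub_zero, inv_div, div_eq_mul_inv]; linarith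
  · rw [zero_sub, neg_neg, inv_div, div_eq_mul_inv]; linarith

theorem Edge.ratio_mem (ha₁ : 0 < a₁) (ha₂ : 0 < a₂) (ha₃ : 0 < a₃) {e : Edge} {x : ℝ}
    (hx : x ∈ Icc (e.lo a₁ a₂ a₃) (e.hi a₁ a₂ a₃)) :
    0 ≤ (x - e.lo a₁ a₂ a₃) / e.length a₁ a₂ a₃ ∧
      (x - e.lo a₁ a₂ a₃) / e.length a₁ a₂ a₃ ≤ 1 := by
  have h := e.length_pos ha₁ ha₂ ha₃
  refine ⟨div_nonneg (sub_nonneg.2 hx.1) h.le, (div_le_one h).2 ?_⟩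
  exact sub_le_sub_right hx.2 _

theorem abs_cut_le (ha₁ : 0 < a₁) (ha₂ : 0 < a₂) (ha₃ : 0 < a₃) {e : Edge} {x : ℝ}
    (hx : x ∈ Icc (e.lo a₁ a₂ a₃) (e.hi a₁ a₂ a₃)) :
    |cut a₁ a₂ a₃ χ e x| ≤ |χ e.source| + |χ e.target| := by
  obtain ⟨h0, h1⟩ := Edge.ratio_mem ha₁ ha₂ ha₃ hx
  unfold cut
  generalize (x - e.lo a₁ a₂ a₃) / e.length a₁ a₂ a₃ = t at *
  have e1 : χ e.source + (χ e.target - χ e.source) * (3 * t ^ 2 - 2 * t ^ 3)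
      = χ e.source * (1 - (3 * t ^ 2 - 2 * t ^ 3)) + χ e.target * (3 * t ^ 2 - 2 * t ^ 3) := by ring
  have e2 : 0 ≤ 3 * t ^ 2 - 2 * t ^ 3 := by nlinarith [sq_nonneg t]
  have e3 : 3 * t ^ 2 - 2 * t ^ 3 ≤ 1 := by nlinarith [mul_nonneg (sq_nonneg (1 - t)) h0]
  rw [e1]
  refine (abs_add_le _ _).trans ?_
  rw [abs_mul, abs_mul, abs_of_nonneg e2, abs_of_nonneg (sub_nonneg.2 e3)]
  exact add_le_add (mul_le_of_le_one_right (abs_nonneg _) (by linarith))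
    (mul_le_of_le_one_right (abs_nonneg _) e3)

theorem abs_cutDeriv_le (ha₁ : 0 < a₁) (ha₂ : 0 < a₂) (ha₃ : 0 < a₃) {e : Edge} {x : ℝ}
    (hx : x ∈ Icc (e.lo a₁ a₂ a₃) (e.hi a₁ a₂ a₃)) :
    |cutDeriv a₁ a₂ a₃ χ e x|
      ≤ 6 * (a₁⁻¹ + a₂⁻¹ + 2 * a₃⁻¹) * |χ e.target - χ e.source| := by
  obtain ⟨h0, h1⟩ := Edge.ratio_mem ha₁ ha₂ ha₃ hx
  have hl := e.length_pos ha₁ ha₂ ha₃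
  have hl' := e.inv_length_le ha₁ ha₂ ha₃
  unfold cutDeriv
  generalize (x - e.lo a₁ a₂ a₃) / e.length a₁ a₂ a₃ = t at *
  rw [abs_mul, mul_comm, abs_div, abs_of_pos hl, div_eq_mul_inv]
  refine mul_le_mul_of_nonneg_right (mul_le_mul ?_ hl' (by positivity) (by norm_num)) (abs_nonneg _)
  rw [abs_le]
  constructor <;> nlinarith

theorem abs_cutDeriv2_le (ha₁ : 0 < a₁) (ha₂ : 0 < a₂) (ha₃ : 0 < a₃) {e : Edge} {x : ℝ}
    (hx : x ∈ Icc (e.lo a₁ a₂ a₃) (e.hi a₁ a₂ a₃)) :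
    |cutDeriv2 a₁ a₂ a₃ χ e x|
      ≤ 6 * (a₁⁻¹ + a₂⁻¹ + 2 * a₃⁻¹) ^ 2 * |χ e.target - χ e.source| := by
  obtain ⟨h0, h1⟩ := Edge.ratio_mem ha₁ ha₂ ha₃ hx
  have hl := e.length_pos ha₁ ha₂ ha₃
  have hl' := e.inv_length_le ha₁ ha₂ ha₃
  unfold cutDeriv2
  generalize (x - e.lo a₁ a₂ a₃) / e.length a₁ a₂ a₃ = t at *
  rw [abs_mul, mul_comm, abs_div, abs_of_pos (pow_pos hl 2), div_eq_mul_inv, ← inv_pow]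
  refine mul_le_mul_of_nonneg_right (mul_le_mul ?_
    (pow_le_pow_left₀ (by positivity) hl' 2) (by positivity) (by norm_num)) (abs_nonneg _)
  rw [abs_le]
  constructor <;> linarith

theorem summable_edge_ends (hχ : Summable fun x => χ x ^ 2) :
    Summable fun e : Edge => (|χ e.source| + |χ e.target|) ^ 2 := by
  have hsh : ∀ d : ℤ × ℤ, Summable fun x => χ (x + d) ^ 2 := fun d =>
    (Equiv.addRight d).summable_iff (f := fun x => χ x ^ 2) |>.2 hχ
  have hfam : ∀ (f : ℤ × ℤ → ℤ × ℤ) (d : ℤ × ℤ), (∀ x, f x = x + d) →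
      Summable fun x => (|χ x| + |χ (f x)|) ^ 2 := by
    intro f d hf
    refine Summable.of_nonneg_of_le (fun x => sq_nonneg _) (fun x => ?_)
      ((hχ.add (hsh d)).mul_left 2)
    rw [hf, ← sq_abs (χ x), ← sq_abs (χ (x + d))]
    nlinarith [sq_nonneg (|χ x| - |χ (x + d)|)]
  refine summable_edge ?_ ?_ ?_ ?_
  · exact hfam (fun x => (x.1 + 1, x.2)) (1, 0) fun x => by ext <;> simp
  · exact hfam (fun x => (x.1, x.2 + 1)) (0, 1) fun x => by ext <;> simp
  · exact hfam (fun x => (x.1, x.2)) 0 fun x => by ext <;> simp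
  · exact hfam (fun x => (x.1, x.2)) 0 fun x => by ext <;> simp

/-- The cutoff has zero slope at the vertices, so each Kirchhoff sum is multiplied by `χ (k, l)`; it
is constant on vertical edges, so quasi-periodicity survives. The hypothesis `χ (0, 0) = 0` erases
the only vertex with a different weight: a solution for weight `1` becomes an element of the domain
for weight `μ`. -/
theorem isInDomain_cut {U V : Edge → ℝ → ℂ} (ha₁ : 0 < a₁) (ha₂ : 0 < a₂) (ha₃ : 0 < a₃)
    (h : IsLocalSolution a₁ a₂ a₃ β 1 ω U V) {B : ℝ}
    (hUB : ∀ e, ∀ x ∈ Icc (e.lo a₁ a₂ a₃) (e.hi a₁ a₂ a₃), ‖U e x‖ ≤ B)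
    (hVB : ∀ e, ∀ x ∈ Icc (e.lo a₁ a₂ a₃) (e.hi a₁ a₂ a₃), ‖V e x‖ ≤ B)
    (hχ : Summable fun x => χ x ^ 2) (hχ0 : χ (0, 0) = 0) :
    IsInDomain a₁ a₂ a₃ β μ
      (fun e x => (cut a₁ a₂ a₃ χ e x : ℂ) * U e x)
      (fun e x => (cutDeriv a₁ a₂ a₃ χ e x : ℂ) * U e x + (cut a₁ a₂ a₃ χ e x : ℂ) * V e x)
      (fun e x => ((cutDeriv2 a₁ a₂ a₃ χ e x : ℂ) * U e x
        + 2 * (cutDeriv a₁ a₂ a₃ χ e x : ℂ) * V e x)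
        + (cut a₁ a₂ a₃ χ e x : ℂ) * (-(ω : ℂ) ^ 2 * U e x)) := by
  have cU : ∀ e, Continuous (U e) := fun e =>
    continuous_iff_continuousAt.2 fun x => (h.deriv e x).continuousAt
  have cV : ∀ e, Continuous (V e) := fun e =>
    continuous_iff_continuousAt.2 fun x => (h.deriv2 e x).continuousAt
  have c0 : ∀ e, Continuous fun x => (cut a₁ a₂ a₃ χ e x : ℂ) := fun e =>
    Complex.continuous_ofReal.comp
      (continuous_iff_continuousAt.2 fun x => (hasDerivAt_cut e x).continuousAt)
  have c1 : ∀ e, Continuous fun x => (cutDeriv a₁ a₂ a₃ χ e x : ℂ) := fun e =>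
    Complex.continuous_ofReal.comp
      (continuous_iff_continuousAt.2 fun x => (hasDerivAt_cutDeriv e x).continuousAt)
  have c2 : ∀ e, Continuous fun x => (cutDeriv2 a₁ a₂ a₃ χ e x : ℂ) := fun e => by
    unfold cutDeriv2; fun_prop
  set M := a₁⁻¹ + a₂⁻¹ + 2 * a₃⁻¹ with hM
  have hM0 : 0 < M := by positivity
  have hB0 : 0 ≤ B := (norm_nonneg _).trans
    (hUB (.ePlus 0 0) 0 ⟨le_rfl, by simp only [Edge.hi]; positivity⟩)
  set m : Edge → ℝ := fun e => |χ e.source| + |χ e.target| with hm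
  have hm0 : ∀ e, 0 ≤ m e := fun e => by positivity
  have hms : Summable fun e => m e ^ 2 := summable_edge_ends hχ
  have hΔ : ∀ e : Edge, |χ e.target - χ e.source| ≤ m e := fun e =>
    (abs_sub _ _).trans (by simp only [hm]; linarith)
  have b0 : ∀ e, ∀ x ∈ Icc (e.lo a₁ a₂ a₃) (e.hi a₁ a₂ a₃),
      ‖(cut a₁ a₂ a₃ χ e x : ℂ)‖ ≤ m e := fun e x hx => by
    rw [Complex.norm_real]; exact abs_cut_le ha₁ ha₂ ha₃ hx
  have b1 : ∀ e, ∀ x ∈ Icc (e.lo a₁ a₂ a₃) (e.hi a₁ a₂ a₃),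
      ‖(cutDeriv a₁ a₂ a₃ χ e x : ℂ)‖ ≤ 6 * M * m e := fun e x hx => by
    rw [Complex.norm_real]
    exact (abs_cutDeriv_le ha₁ ha₂ ha₃ hx).trans
      (mul_le_mul_of_nonneg_left (hΔ e) (by positivity))
  have b2 : ∀ e, ∀ x ∈ Icc (e.lo a₁ a₂ a₃) (e.hi a₁ a₂ a₃),
      ‖(cutDeriv2 a₁ a₂ a₃ χ e x : ℂ)‖ ≤ 6 * M ^ 2 * m e := fun e x hx => by
    rw [Complex.norm_real]
    exact (abs_cutDeriv2_le ha₁ ha₂ ha₃ hx).trans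
      (mul_le_mul_of_nonneg_left (hΔ e) (by positivity))
  have hsq : ∀ {W : Edge → ℝ → ℂ} (C : ℝ), (∀ e, Continuous (W e)) →
      (∀ e, ∀ x ∈ Icc (e.lo a₁ a₂ a₃) (e.hi a₁ a₂ a₃), ‖W e x‖ ≤ C * m e) →
      SqIntegrable a₁ a₂ a₃ W := fun C hc hb =>
    sqIntegrable_of_bound ha₁ ha₂ ha₃ (fun e => (hc e).continuousOn) hb
      (by simp only [mul_pow]; exact hms.mul_left _)
  have hlo1 : ∀ k l : ℤ, cut a₁ a₂ a₃ χ (.e₁ k l) (k * a₁) = χ (k, l) := fun k l =>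
    cut_lo (.e₁ k l)
  have hlo2 : ∀ k l : ℤ, cut a₁ a₂ a₃ χ (.e₂ k l) (l * a₂) = χ (k, l) := fun k l =>
    cut_lo (.e₂ k l)
  have hhi1 : ∀ k l : ℤ, cut a₁ a₂ a₃ χ (.e₁ (k - 1) l) (k * a₁) = χ (k, l) := fun k l => by
    have := cut_hi (χ := χ) ha₁ ha₂ ha₃ (.e₁ (k - 1) l)
    simpa [Edge.hi, Edge.target] using this
  have hhi2 : ∀ k l : ℤ, cut a₁ a₂ a₃ χ (.e₂ k (l - 1)) (l * a₂) = χ (k, l) := fun k l => by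
    have := cut_hi (χ := χ) ha₁ ha₂ ha₃ (.e₂ k (l - 1))
    simpa [Edge.hi, Edge.target] using this
  have dlo1 : ∀ k l : ℤ, cutDeriv a₁ a₂ a₃ χ (.e₁ k l) (k * a₁) = 0 := fun k l =>
    cutDeriv_lo (.e₁ k l)
  have dlo2 : ∀ k l : ℤ, cutDeriv a₁ a₂ a₃ χ (.e₂ k l) (l * a₂) = 0 := fun k l =>
    cutDeriv_lo (.e₂ k l)
  have dhi1 : ∀ k l : ℤ, cutDeriv a₁ a₂ a₃ χ (.e₁ (k - 1) l) (k * a₁) = 0 := fun k l => by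
    have := cutDeriv_hi (χ := χ) ha₁ ha₂ ha₃ (.e₁ (k - 1) l)
    simpa [Edge.hi] using this
  have dhi2 : ∀ k l : ℤ, cutDeriv a₁ a₂ a₃ χ (.e₂ k (l - 1)) (l * a₂) = 0 := fun k l => by
    have := cutDeriv_hi (χ := χ) ha₁ ha₂ ha₃ (.e₂ k (l - 1))
    simpa [Edge.hi] using this
  have v1 : ∀ k l x, cut a₁ a₂ a₃ χ (.ePlus k l) x = χ (k, l) := fun k l x =>
    cut_of_eq (e := .ePlus k l) rfl x
  have v2 : ∀ k l x, cut a₁ a₂ a₃ χ (.eMinus k l) x = χ (k, l) := fun k l x =>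
    cut_of_eq (e := .eMinus k l) rfl x
  have v3 : ∀ k l x, cutDeriv a₁ a₂ a₃ χ (.ePlus k l) x = 0 := fun k l x =>
    cutDeriv_of_eq (e := .ePlus k l) rfl x
  have v4 : ∀ k l x, cutDeriv a₁ a₂ a₃ χ (.eMinus k l) x = 0 := fun k l x =>
    cutDeriv_of_eq (e := .eMinus k l) rfl x
  refine ⟨⟨fun e => ?_, ?_, ?_, ?_, fun k l => ?_⟩, fun k l => ?_, fun k l => ?_, fun k l => ?_⟩
  · refine isH2On_of_hasDerivAt (fun x => ?_) (fun x => ?_) ?_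
    · exact (hasDerivAt_cut e x).ofReal_comp.mul (h.deriv e x)
    · refine (((hasDerivAt_cutDeriv e x).ofReal_comp.mul (h.deriv e x)).add
        ((hasDerivAt_cut e x).ofReal_comp.mul (h.deriv2 e x))).congr_deriv ?_
      ring
    · exact (((c2 e).mul (cU e)).add ((continuous_const.mul (c1 e)).mul (cV e))).add
        ((c0 e).mul (continuous_const.mul (cU e)))
  · refine hsq B (fun e => (c0 e).mul (cU e)) fun e x hx => ?_
    rw [norm_mul, mul_comm]
    exact mul_le_mul (hUB e x hx) (b0 e x hx) (norm_nonneg _) hB0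
  · refine hsq (6 * M * B + B) (fun e => ((c1 e).mul (cU e)).add ((c0 e).mul (cV e)))
      fun e x hx => ?_
    refine (norm_add_le _ _).trans ?_
    rw [norm_mul, norm_mul]
    have h1 := mul_le_mul (b1 e x hx) (hUB e x hx) (norm_nonneg _)
      (by have := hm0 e; positivity)
    have h2 := mul_le_mul (b0 e x hx) (hVB e x hx) (norm_nonneg _) (hm0 e)
    linarith
  · refine hsq (6 * M ^ 2 * B + 2 * (6 * M) * B + ω ^ 2 * B)
      (fun e => (((c2 e).mul (cU e)).add ((continuous_const.mul (c1 e)).mul (cV e))).add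
        ((c0 e).mul (continuous_const.mul (cU e)))) fun e x hx => ?_
    refine norm_add₃_le.trans ?_
    have hω : ‖-(ω : ℂ) ^ 2‖ = ω ^ 2 := by
      rw [norm_neg, norm_pow, Complex.norm_real, Real.norm_eq_abs, sq_abs]
    rw [norm_mul, norm_mul, norm_mul, norm_mul, norm_mul, hω, Complex.norm_ofNat]
    have h1 := mul_le_mul (b2 e x hx) (hUB e x hx) (norm_nonneg _)
      (by have := hm0 e; positivity)
    have h2 := mul_le_mul (b1 e x hx) (hVB e x hx) (norm_nonneg _)
      (by have := hm0 e; positivity)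
    have h3 := mul_le_mul (b0 e x hx) (hUB e x hx) (norm_nonneg _) (hm0 e)
    have h4 := mul_le_mul_of_nonneg_left h3 (sq_nonneg ω)
    linarith
  · obtain ⟨p, q1, q2, q3, q4, q5, q6⟩ := h.vertex k l
    refine ⟨χ (k, l) * p, ?_, ?_, ?_, ?_, ?_, ?_⟩
    · simp only [hlo1, q1]
    · simp only [hhi1, q2]
    · simp only [hlo2, q3]
    · simp only [hhi2, q4]
    · simp only [v1, q5]
    · simp only [v2, q6]
  · simp only [v1, v2]
    rw [h.quasiPer]; ring
  · simp only [v1, v2, v3, v4]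
    rw [h.quasiPer_deriv]; push_cast; ring
  · have hk := h.kirchhoff k l
    simp only [hlo1, hlo2, hhi1, hhi2, dlo1, dlo2, dhi1, dhi2, v1, v2, v3, v4]
    by_cases h0 : k = 0 ∧ l = 0
    · obtain ⟨rfl, rfl⟩ := h0
      simp [hχ0]
    · simp only [vertexWeight, if_neg h0] at hk ⊢
      push_cast at hk ⊢
      linear_combination (χ (k, l) : ℂ) * hk

end Cutoff

end LimitGraph

/-! ### Singular sequences from bounded solutions. -/

namespace UnboundedOp

variable {H : Type*} [NormedAddCommGroup H] [InnerProductSpace ℂ H]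

/-- Orthogonal approximate eigenvectors of increasing norm and bounded residual provide a point of
the essential spectrum. -/
theorem mem_essSpectrum_of_orthogonal (T : H →ₗ.[ℂ] H) {z : ℂ} (u : ℕ → T.domain)
    (horth : ∀ n m, n ≠ m → inner ℂ (u n : H) (u m : H) = 0) {c C : ℝ} (hc : 0 < c)
    (hu : ∀ n : ℕ, c * (n + 1) ≤ ‖(u n : H)‖)
    (hT : ∀ n, ‖T (u n) - z • (u n : H)‖ ≤ C) : z ∈ essSpectrum T := by
  have hpos : ∀ n : ℕ, 0 < ‖(u n : H)‖ := fun n => lt_of_lt_of_le (by positivity) (hu n)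
  set r : ℕ → ℂ := fun n => ((‖(u n : H)‖⁻¹ : ℝ) : ℂ) with hr
  have hrn : ∀ n, ‖r n‖ = ‖(u n : H)‖⁻¹ := fun n => by
    rw [hr, Complex.norm_real, Real.norm_of_nonneg (inv_nonneg.2 (norm_nonneg _))]
  have hnorm : ∀ n, ‖((r n • u n : T.domain) : H)‖ = 1 := fun n => by
    rw [Submodule.coe_smul, norm_smul, hrn, inv_mul_cancel₀ (hpos n).ne']
  refine ⟨fun n => r n • u n, hnorm, fun v => ?_, ?_⟩
  · have ho : Orthonormal ℂ fun n => ((r n • u n : T.domain) : H) := by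
      refine ⟨hnorm, fun n m hnm => ?_⟩
      simp only [Submodule.coe_smul]
      rw [inner_smul_left, inner_smul_right, horth n m hnm, mul_zero, mul_zero]
    -- Bessel's inequality: an orthonormal sequence tends weakly to zero.
    have h1 := (ho.inner_products_summable v).tendsto_atTop_zero
    have h2 : Tendsto (fun n => ‖inner ℂ ((r n • u n : T.domain) : H) v‖) atTop (𝓝 0) := by
      have := h1.sqrt
      simpa only [Real.sqrt_sq (norm_nonneg _), Real.sqrt_zero] using this
    refine squeeze_zero_norm (fun n => ?_) h2
    rw [← inner_conj_symm, RCLike.norm_conj]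
  · have hlim : Tendsto (fun n : ℕ => C / c * (1 / ((n : ℝ) + 1))) atTop (𝓝 0) := by
      simpa using tendsto_one_div_add_atTop_nhds_zero_nat.const_mul (C / c)
    refine squeeze_zero_norm (fun n => ?_) hlim
    rw [LinearPMap.map_smul, Submodule.coe_smul, smul_comm z, ← smul_sub, norm_smul, hrn]
    have hC : 0 ≤ C := (norm_nonneg _).trans (hT n)
    calc ‖(u n : H)‖⁻¹ * ‖T (u n) - z • (u n : H)‖ ≤ (c * (n + 1))⁻¹ * C :=
          mul_le_mul (inv_anti₀ (by positivity) (hu n)) (hT n) (norm_nonneg _) (by positivity)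
      _ = C / c * (1 / ((n : ℝ) + 1)) := by field_simp

end UnboundedOp

namespace LimitGraph

variable {a₁ a₂ a₃ β μ ω : ℝ}

theorem Edge.target_eq (e : Edge) :
    e.target = e.source ∨ e.target = e.source + (1, 0) ∨ e.target = e.source + (0, 1) := by
  cases e <;> simp [Edge.target, Edge.source]

/-- Localization of a bounded local solution. -/
theorem exists_localized {U V : Edge → ℝ → ℂ} (ha₁ : 0 < a₁) (ha₂ : 0 < a₂) (ha₃ : 0 < a₃)
    (hμ : 0 < μ) (h : IsLocalSolution a₁ a₂ a₃ β 1 ω U V) {B : ℝ}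
    (hUB : ∀ e, ∀ x ∈ Icc (e.lo a₁ a₂ a₃) (e.hi a₁ a₂ a₃), ‖U e x‖ ≤ B)
    (hVB : ∀ e, ∀ x ∈ Icc (e.lo a₁ a₂ a₃) (e.hi a₁ a₂ a₃), ‖V e x‖ ≤ B)
    {ι : ℤ × ℤ → Edge} (hι : ∀ x, (ι x).source = x) {c : ℝ}
    (hc : ∀ x, c ≤ ∫ t, ‖U (ι x) t‖ ^ 2 ∂(edgeVolume a₁ a₂ a₃ (ι x)))
    {χ : ℤ × ℤ → ℝ} (hχ : Summable fun x => χ x ^ 2) (hχ0 : χ (0, 0) = 0)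
    (F : Finset (ℤ × ℤ))
    (hF : ∀ x ∈ F, χ x = 1 ∧ χ (x + (1, 0)) = 1 ∧ χ (x + (0, 1)) = 1) {S : ℝ}
    (hS : HasSum (fun e : Edge => (χ e.target - χ e.source) ^ 2) S) :
    ∃ u : (limitOp a₁ a₂ a₃ β μ).domain,
      ‖limitOp a₁ a₂ a₃ β μ u - ((ω ^ 2 : ℝ) : ℂ) • (u : L2G a₁ a₂ a₃ μ)‖ ^ 2
        ≤ max μ 1 * ((a₁ + a₂ + a₃) * (6 * (a₁⁻¹ + a₂⁻¹ + 2 * a₃⁻¹) ^ 2 * B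
          + 2 * (6 * (a₁⁻¹ + a₂⁻¹ + 2 * a₃⁻¹)) * B) ^ 2) * S ∧
      min μ 1 * c * F.card ≤ ‖(u : L2G a₁ a₂ a₃ μ)‖ ^ 2 ∧
      ∀ e : Edge, χ e.source = 0 → χ e.target = 0 → (u : L2G a₁ a₂ a₃ μ) e = 0 := by
  have hdom := isInDomain_cut (μ := μ) ha₁ ha₂ ha₃ h hUB hVB hχ hχ0
  set M := a₁⁻¹ + a₂⁻¹ + 2 * a₃⁻¹ with hM
  have hM0 : 0 < M := by positivity
  set W : Edge → ℝ → ℂ := fun e x => (cut a₁ a₂ a₃ χ e x : ℂ) * U e x with hW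
  set Q : Edge → ℝ → ℂ := fun e x => (cutDeriv2 a₁ a₂ a₃ χ e x : ℂ) * U e x
        + 2 * (cutDeriv a₁ a₂ a₃ χ e x : ℂ) * V e x with hQ
  obtain ⟨w, hw⟩ := exists_L2G hμ hdom.h2.sq
  obtain ⟨f, hf⟩ := exists_L2G hμ (hdom.h2.sq_deriv2.smul (-1))
  have hpair : IsOpPair a₁ a₂ a₃ β μ w f := ⟨_, _, _, hdom, hw, fun e => by
    filter_upwards [hf e] with x hx
    rw [hx]; simp⟩
  obtain ⟨u, hu1, hu2⟩ := exists_domain_of_isOpPair hμ hpair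
  have hB0 : 0 ≤ B := (norm_nonneg _).trans
    (hUB (.ePlus 0 0) 0 ⟨le_rfl, by simp only [Edge.hi]; positivity⟩)
  have cU : ∀ e, Continuous (U e) := fun e =>
    continuous_iff_continuousAt.2 fun x => (h.deriv e x).continuousAt
  have cV : ∀ e, Continuous (V e) := fun e =>
    continuous_iff_continuousAt.2 fun x => (h.deriv2 e x).continuousAt
  have c1 : ∀ e, Continuous fun x => (cutDeriv a₁ a₂ a₃ χ e x : ℂ) := fun e =>
    Complex.continuous_ofReal.comp
      (continuous_iff_continuousAt.2 fun x => (hasDerivAt_cutDeriv e x).continuousAt)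
  have c2 : ∀ e, Continuous fun x => (cutDeriv2 a₁ a₂ a₃ χ e x : ℂ) := fun e => by
    unfold cutDeriv2; fun_prop
  refine ⟨u, ?_, ?_, ?_⟩
  · rw [hu2, hu1]
    -- Since `U` solves the equation, only the commutator `χ'' U + 2 χ' V` remains, and it is
    -- bounded by the increment of `χ` along the edge.
    have hres : ∀ e, ((f - ((ω ^ 2 : ℝ) : ℂ) • w) e : ℝ → ℂ)
        =ᵐ[edgeMeasure a₁ a₂ a₃ μ e] -Q e := fun e => by
      filter_upwards [hw e, hf e, Lp.coeFn_smul ((ω ^ 2 : ℝ) : ℂ) (w e),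
        Lp.coeFn_sub (f e) (((ω ^ 2 : ℝ) : ℂ) • w e)] with x h1 h2 h3 h4
      have h5 : ((f - ((ω ^ 2 : ℝ) : ℂ) • w) e : ℝ → ℂ) x
        = (f e : ℝ → ℂ) x - (((ω ^ 2 : ℝ) : ℂ) • w e : Lp ℂ 2 _) x := h4
      rw [h5, h3, Pi.smul_apply, h1, h2]
      simp only [hQ, Pi.neg_apply, Pi.smul_apply, smul_eq_mul]
      push_cast
      ring
    have hsum := hasSum_norm_sq hμ _ hres
    refine hasSum_le (fun e => ?_) hsum (hS.mul_left _)
    have hb : ∀ x ∈ Icc (e.lo a₁ a₂ a₃) (e.hi a₁ a₂ a₃), ‖(-Q e) x‖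
        ≤ (6 * M ^ 2 * B + 2 * (6 * M) * B) * |χ e.target - χ e.source| := fun x hx => by
      rw [Pi.neg_apply, norm_neg]
      refine (norm_add_le _ _).trans ?_
      rw [norm_mul, norm_mul, norm_mul, Complex.norm_ofNat, Complex.norm_real, Complex.norm_real]
      have b2 := mul_le_mul (abs_cutDeriv2_le (χ := χ) ha₁ ha₂ ha₃ hx) (hUB e x hx) (norm_nonneg _)
        (by positivity)
      have b1 := mul_le_mul (abs_cutDeriv_le (χ := χ) ha₁ ha₂ ha₃ hx) (hVB e x hx) (norm_nonneg _)
        (by positivity)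
      simp only [Real.norm_eq_abs]
      rw [← hM] at b1 b2
      linarith
    have hi := integral_edge_sq_le ha₁ ha₂ ha₃ (e := e) (W := -Q e)
      ((((c2 e).mul (cU e)).add ((continuous_const.mul (c1 e)).mul (cV e))).neg).continuousOn hb
    rw [mul_pow, sq_abs, ← mul_assoc] at hi
    have hw0 := (e.weight_pos hμ).le
    calc e.weight μ * ∫ x, ‖(-Q e) x‖ ^ 2 ∂(edgeVolume a₁ a₂ a₃ e)
        ≤ max μ 1 * ((a₁ + a₂ + a₃) * (6 * M ^ 2 * B + 2 * (6 * M) * B) ^ 2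
          * (χ e.target - χ e.source) ^ 2) :=
          mul_le_mul e.weight_le hi (integral_nonneg fun x => by positivity) (by positivity)
      _ = _ := by ring
  · rw [hu1]
    have hsum := hasSum_norm_sq hμ _ hw
    have hinj : Function.Injective ι := fun x y hxy => by rw [← hι x, ← hι y, hxy]
    have h1 := sum_le_hasSum (F.map ⟨ι, hinj⟩) (fun e _ => mul_nonneg (e.weight_pos hμ).le
      (integral_nonneg fun x => by positivity)) hsum
    refine le_trans ?_ h1
    rw [Finset.sum_map, mul_comm, ← nsmul_eq_mul]
    refine Finset.card_nsmul_le_sum _ _ _ fun x hx => ?_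
    obtain ⟨f0, f1, f2⟩ := hF x hx
    have e0 : χ (ι x).source = 1 := by rw [hι, f0]
    have e1 : χ (ι x).target = 1 := by
      rcases (ι x).target_eq with e | e | e <;> rw [e, hι] <;> assumption
    have hcut : ∀ t, W (ι x) t = U (ι x) t := fun t => by
      simp only [hW]
      rw [cut_of_eq (by rw [e0, e1]), e0]; simp
    simp only [Function.Embedding.coeFn_mk, hcut]
    have hm0 : 0 ≤ min μ 1 := le_min hμ.le zero_le_one
    exact (mul_le_mul_of_nonneg_left (hc x) hm0).trans
      (mul_le_mul_of_nonneg_right (Edge.min_le_weight _) (integral_nonneg fun x => by positivity))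
  · intro e h0 h1
    rw [hu1]
    refine Lp.ext ((hw e).trans ?_)
    filter_upwards [Lp.coeFn_zero ℂ 2 (edgeMeasure a₁ a₂ a₃ μ e)] with x hx
    have hx' : (⇑(0 : Lp ℂ 2 (edgeMeasure a₁ a₂ a₃ μ e)) : ℝ → ℂ) x = 0 := hx
    rw [hx']
    simp only [hW]
    rw [cut_of_eq (by rw [h0, h1]), h0]; simp

section Tent

/-- The trapezoidal cutoff that equals `1` for `|j| ≤ N` and vanishes for `|j| ≥ 2 N`. -/
noncomputable def trapezoid (N : ℕ) (j : ℤ) : ℝ := max 0 (min 1 (2 - |(j : ℝ)| / N))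

theorem trapezoid_nonneg (N : ℕ) (j : ℤ) : 0 ≤ trapezoid N j := le_max_left _ _

theorem trapezoid_le_one (N : ℕ) (j : ℤ) : trapezoid N j ≤ 1 :=
  max_le zero_le_one (min_le_left _ _)

variable {N : ℕ}

theorem trapezoid_eq_one (hN : 0 < N) {j : ℤ} (hj : |j| ≤ N) : trapezoid N j = 1 := by
  have h1 : (0 : ℝ) < N := by exact_mod_cast hN
  have h2 : |(j : ℝ)| ≤ N := by exact_mod_cast hj
  have h3 : |(j : ℝ)| / N ≤ 1 := (div_le_one h1).2 h2
  rw [trapezoid, min_eq_left (by linarith), max_eq_right zero_le_one]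

theorem trapezoid_eq_zero (hN : 0 < N) {j : ℤ} (hj : 2 * (N : ℤ) ≤ |j|) : trapezoid N j = 0 := by
  have h1 : (0 : ℝ) < N := by exact_mod_cast hN
  have h2 : 2 * (N : ℝ) ≤ |(j : ℝ)| := by exact_mod_cast hj
  have h3 : 2 ≤ |(j : ℝ)| / N := (le_div_iff₀ h1).2 h2
  rw [trapezoid, max_eq_left ((min_le_right _ _).trans (by linarith))]

theorem abs_trapezoid_sub_le (j : ℤ) :
    |trapezoid N (j + 1) - trapezoid N j| ≤ 1 / N := by
  have h1 : |trapezoid N (j + 1) - trapezoid N j|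
      ≤ |(2 - |((j + 1 : ℤ) : ℝ)| / N) - (2 - |(j : ℝ)| / N)| := by
    unfold trapezoid
    refine (abs_max_sub_max_le_max _ _ _ _).trans (max_le (by simp) ?_)
    exact (abs_min_sub_min_le_max _ _ _ _).trans (max_le (by simp) le_rfl)
  refine h1.trans ?_
  rw [show (2 - |((j + 1 : ℤ) : ℝ)| / N) - (2 - |(j : ℝ)| / N)
    = (|(j : ℝ)| - |((j + 1 : ℤ) : ℝ)|) / N by ring, abs_div, Nat.abs_cast]
  refine div_le_div_of_nonneg_right ((abs_abs_sub_abs_le _ _).trans ?_) (Nat.cast_nonneg _)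
  push_cast
  rw [show (j : ℝ) - (j + 1) = -1 by ring, abs_neg, abs_one]

/-- The product cutoff centred at `(K, 0)`. -/
noncomputable def plateau (N : ℕ) (K : ℤ) (x : ℤ × ℤ) : ℝ :=
  trapezoid N (x.1 - K) * trapezoid N x.2

theorem plateau_eq_zero (hN : 0 < N) {K : ℤ} {x : ℤ × ℤ}
    (h : 2 * (N : ℤ) ≤ |x.1 - K| ∨ 2 * (N : ℤ) ≤ |x.2|) : plateau N K x = 0 := by
  unfold plateau
  rcases h with h | h
  · rw [trapezoid_eq_zero hN h, zero_mul]
  · rw [trapezoid_eq_zero hN h, mul_zero]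

theorem plateau_eq_zero_of_notMem (hN : 0 < N) {K : ℤ} {x : ℤ × ℤ}
    (h : x ∉ Finset.Icc (K - 2 * N) (K + 2 * N) ×ˢ Finset.Icc (-2 * (N : ℤ)) (2 * N)) :
    plateau N K x = 0 := by
  refine plateau_eq_zero hN ?_
  by_contra! h'
  obtain ⟨h1, h2⟩ := h'
  rw [abs_lt] at h1 h2
  refine h (Finset.mem_product.2 ⟨Finset.mem_Icc.2 ⟨?_, ?_⟩, Finset.mem_Icc.2 ⟨?_, ?_⟩⟩) <;> omega

/-- There are at most `25 N²` nonzero increments in each horizontal direction, each of square at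
most `1 / N²`: the gradient energy is bounded independently of `N`, whereas the mass of the plateau
grows like `N²`. -/
theorem hasSum_plateau_sub (hN : 0 < N) (K : ℤ) :
    ∃ S ≤ 50, HasSum (fun e : Edge => (plateau N K e.target - plateau N K e.source) ^ 2) S := by
  have hN' : (0 : ℝ) < N := by exact_mod_cast hN
  set Q := Finset.Icc (K - 2 * N) (K + 2 * N) ×ˢ Finset.Icc (-2 * (N : ℤ)) (2 * N) with hQ
  have hcard : (Q.card : ℝ) ≤ 25 * N ^ 2 := by
    have hc : Q.card = (4 * N + 1) * (4 * N + 1) := by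
      rw [hQ, Finset.card_product, Int.card_Icc, Int.card_Icc]
      congr 1 <;> omega
    rw [hc]
    have : (1 : ℝ) ≤ N := by exact_mod_cast hN
    push_cast
    nlinarith
  have key : ∀ g : ℤ × ℤ → ℤ × ℤ,
      (∀ x, |plateau N K (g x) - plateau N K x| ≤ 1 / N) →
      (∀ x ∉ Finset.Icc (K - 2 * N) (K + 2 * N) ×ˢ Finset.Icc (-2 * (N : ℤ)) (2 * N),
        plateau N K (g x) = 0) →
      ∃ S ≤ 25, HasSum (fun x => (plateau N K (g x) - plateau N K x) ^ 2) S := by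
    intro g hg hg0
    refine ⟨∑ x ∈ Q, (plateau N K (g x) - plateau N K x) ^ 2, ?_, hasSum_sum_of_ne_finset_zero ?_⟩
    · have h1 : ∀ x ∈ Q, (plateau N K (g x) - plateau N K x) ^ 2 ≤ (1 / (N : ℝ)) ^ 2 :=
        fun x _ => by
          rw [← sq_abs]
          exact pow_le_pow_left₀ (abs_nonneg _) (hg x) 2
      refine (Finset.sum_le_card_nsmul _ _ _ h1).trans ?_
      rw [nsmul_eq_mul, div_pow, one_pow, mul_one_div, div_le_iff₀ (by positivity)]
      exact hcard
    · intro x hx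
      rw [hg0 x hx, plateau_eq_zero_of_notMem hN hx]
      ring
  have hle : ∀ {u v : ℝ}, 0 ≤ v → v ≤ 1 → |u| ≤ 1 / N → |u * v| ≤ 1 / N := fun h0 h1 h2 => by
    rw [abs_mul, abs_of_nonneg h0]
    exact (mul_le_of_le_one_right (abs_nonneg _) h1).trans h2
  obtain ⟨S₁, hS₁, h₁⟩ := key (fun x => (x.1 + 1, x.2)) (fun x => by
      simp only [plateau]
      rw [← sub_mul, show x.1 + 1 - K = (x.1 - K) + 1 by ring]
      exact hle (trapezoid_nonneg _ _) (trapezoid_le_one _ _) (abs_trapezoid_sub_le _))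
    (fun x hx => by
      refine plateau_eq_zero hN ?_
      by_contra! h'
      obtain ⟨h1, h2⟩ := h'
      simp only [abs_lt] at h1 h2
      refine hx (Finset.mem_product.2 ⟨Finset.mem_Icc.2 ⟨?_, ?_⟩, Finset.mem_Icc.2 ⟨?_, ?_⟩⟩) <;>
        omega)
  obtain ⟨S₂, hS₂, h₂⟩ := key (fun x => (x.1, x.2 + 1)) (fun x => by
      simp only [plateau]
      rw [← mul_sub, mul_comm]
      exact hle (trapezoid_nonneg _ _) (trapezoid_le_one _ _) (abs_trapezoid_sub_le _))
    (fun x hx => by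
      refine plateau_eq_zero hN ?_
      by_contra! h'
      obtain ⟨h1, h2⟩ := h'
      simp only [abs_lt] at h1 h2
      refine hx (Finset.mem_product.2 ⟨Finset.mem_Icc.2 ⟨?_, ?_⟩, Finset.mem_Icc.2 ⟨?_, ?_⟩⟩) <;>
        omega)
  refine ⟨S₁ + S₂ + 0 + 0, by linarith, hasSum_edge h₁ h₂ ?_ ?_⟩
  · simp [Edge.target, Edge.source, hasSum_zero]
  · simp [Edge.target, Edge.source, hasSum_zero]

end Tent

/-- A bounded local solution of the unperturbed problem provides a point of the essential spectrum
of the perturbed operator. -/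
theorem mem_essSpectrum_of_isLocalSolution {U V : Edge → ℝ → ℂ} (ha₁ : 0 < a₁) (ha₂ : 0 < a₂)
    (ha₃ : 0 < a₃) (hμ : 0 < μ) (h : IsLocalSolution a₁ a₂ a₃ β 1 ω U V) {B : ℝ}
    (hUB : ∀ e, ∀ x ∈ Icc (e.lo a₁ a₂ a₃) (e.hi a₁ a₂ a₃), ‖U e x‖ ≤ B)
    (hVB : ∀ e, ∀ x ∈ Icc (e.lo a₁ a₂ a₃) (e.hi a₁ a₂ a₃), ‖V e x‖ ≤ B)
    {ι : ℤ × ℤ → Edge} (hι : ∀ x, (ι x).source = x) {c : ℝ} (hc0 : 0 < c)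
    (hc : ∀ x, c ≤ ∫ t, ‖U (ι x) t‖ ^ 2 ∂(edgeVolume a₁ a₂ a₃ (ι x))) :
    ((ω ^ 2 : ℝ) : ℂ) ∈ UnboundedOp.essSpectrum (limitOp a₁ a₂ a₃ β μ) := by
  -- The `n`-th cutoff has half-width `2 (n + 1)`. Centres at `10 (n + 1)²` keep the supports off
  -- the origin and pairwise disjoint, including edges that straddle their boundary.
  set K : ℕ → ℤ := fun n => 10 * ((n : ℤ) + 1) ^ 2 with hK
  have hN : ∀ n : ℕ, 0 < n + 1 := fun n => n.succ_pos
  set χ : ℕ → ℤ × ℤ → ℝ := fun n => plateau (n + 1) (K n) with hχd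
  have hχ : ∀ n, Summable fun x => χ n x ^ 2 := fun n => by
    refine summable_of_ne_finset_zero (s := Finset.Icc (K n - 2 * (n + 1 : ℕ)) (K n + 2 * (n + 1 : ℕ))
      ×ˢ Finset.Icc (-2 * ((n + 1 : ℕ) : ℤ)) (2 * (n + 1 : ℕ))) fun x hx => ?_
    simp only [hχd]
    rw [plateau_eq_zero_of_notMem (hN n) hx]
    norm_num
  have hχ0 : ∀ n, χ n (0, 0) = 0 := fun n => by
    refine plateau_eq_zero (hN n) (Or.inl ?_)
    simp only [zero_sub, abs_neg, hK]
    rw [abs_of_nonneg (by positivity)]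
    push_cast
    nlinarith
  -- A square of `(n + 1)²` points which, together with their right and upper neighbours, lie in the
  -- plateau; it gives norm at least a constant times `n + 1`.
  set F : ℕ → Finset (ℤ × ℤ) := fun n =>
    Finset.Ico (K n) (K n + (n + 1 : ℕ)) ×ˢ Finset.Ico 0 ((n + 1 : ℕ) : ℤ) with hFd
  have hone : ∀ n (x : ℤ × ℤ), |x.1 - K n| ≤ (n + 1 : ℕ) → |x.2| ≤ (n + 1 : ℕ) → χ n x = 1 :=
    fun n x h1 h2 => by
      simp only [hχd, plateau]
      rw [trapezoid_eq_one (hN n) h1, trapezoid_eq_one (hN n) h2, one_mul]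
  have hF : ∀ n, ∀ x ∈ F n, χ n x = 1 ∧ χ n (x + (1, 0)) = 1 ∧ χ n (x + (0, 1)) = 1 := by
    intro n x hx
    obtain ⟨h1, h2⟩ := Finset.mem_product.1 hx
    rw [Finset.mem_Ico] at h1 h2
    refine ⟨hone n _ ?_ ?_, hone n _ ?_ ?_, hone n _ ?_ ?_⟩ <;>
      simp only [Prod.fst_add, Prod.snd_add, abs_le] <;> omega
  have hFc : ∀ n, ((F n).card : ℝ) = ((n : ℝ) + 1) ^ 2 := fun n => by
    rw [hFd, Finset.card_product, Int.card_Ico, Int.card_Ico]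
    simp
    ring
  choose S hS50 hS using fun n => hasSum_plateau_sub (hN n) (K n)
  choose u hu1 hu2 hu3 using fun n => exists_localized (μ := μ) ha₁ ha₂ ha₃ hμ h hUB hVB hι hc
    (hχ n) (hχ0 n) (F n) (hF n) (hS n)
  have hm : 0 < min μ 1 * c := mul_pos (lt_min hμ one_pos) hc0
  refine UnboundedOp.mem_essSpectrum_of_orthogonal _ u ?_ (c := Real.sqrt (min μ 1 * c))
    (C := Real.sqrt (max μ 1 * ((a₁ + a₂ + a₃) * (6 * (a₁⁻¹ + a₂⁻¹ + 2 * a₃⁻¹) ^ 2 * B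
          + 2 * (6 * (a₁⁻¹ + a₂⁻¹ + 2 * a₃⁻¹)) * B) ^ 2) * 50)) (Real.sqrt_pos.2 hm) ?_ ?_
  · have hsupp : ∀ n (e : Edge), (u n : L2G a₁ a₂ a₃ μ) e ≠ 0 →
        |e.source.1 - K n| ≤ 2 * ((n : ℤ) + 1) := by
      intro n e hne
      by_contra! hgt
      have h1 : (n : ℤ) + 1 = ((n + 1 : ℕ) : ℤ) := by push_cast; ring
      have hgt' := lt_abs.1 hgt
      refine hne (hu3 n e ?_ ?_)
      · exact plateau_eq_zero (hN n) (Or.inl (by rw [← h1]; exact hgt.le))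
      · refine plateau_eq_zero (hN n) (Or.inl ?_)
        rw [← h1]
        have h2 : e.target.1 = e.source.1 ∨ e.target.1 = e.source.1 + 1 := by
          rcases e.target_eq with e' | e' | e' <;> rw [e'] <;> simp
        rw [le_abs]
        omega
    have hlt : ∀ n m, n < m → inner ℂ (u n : L2G a₁ a₂ a₃ μ) (u m : L2G a₁ a₂ a₃ μ) = 0 := by
      intro n m hnm
      rw [lp.inner_eq_tsum]
      refine (tsum_congr fun e => ?_).trans tsum_zero
      by_cases h1 : (u n : L2G a₁ a₂ a₃ μ) e = 0
      · rw [h1, inner_zero_left]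
      by_cases h2 : (u m : L2G a₁ a₂ a₃ μ) e = 0
      · rw [h2, inner_zero_right]
      exfalso
      have g1 := abs_le.1 (hsupp n e h1)
      have g2 := abs_le.1 (hsupp m e h2)
      simp only [hK] at g1 g2
      have g3 : (n : ℤ) + 1 ≤ m := by exact_mod_cast hnm
      have g4 : (0 : ℤ) ≤ n := by positivity
      nlinarith
    intro n m hnm
    rcases hnm.lt_or_gt with hl | hl
    · exact hlt n m hl
    · rw [← inner_conj_symm, hlt m n hl, map_zero]
  · intro n
    have h1 := hu2 n
    rw [hFc] at h1
    refine (sq_le_sq₀ (by positivity) (norm_nonneg _)).1 ?_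
    rw [mul_pow, Real.sq_sqrt hm.le]
    exact h1
  · intro n
    refine Real.le_sqrt_of_sq_le ((hu1 n).trans ?_)
    exact mul_le_mul_of_nonneg_left (hS50 n) (by positivity)

end LimitGraph

/-! ### Bounded waves at band frequencies. -/

namespace LimitGraph

variable {a₁ a₂ a₃ β μ ω : ℝ}

section SineFamily

/-- The wave `sin (ω x)` on the edges where `κ = 1`. -/
noncomputable def sineFamily (ω : ℝ) (κ : Edge → ℝ) (e : Edge) (x : ℝ) : ℂ :=
  (κ e * Real.sin (ω * x) : ℝ)

/-- The derivative of `sineFamily`. -/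
noncomputable def sineFamilyDeriv (ω : ℝ) (κ : Edge → ℝ) (e : Edge) (x : ℝ) : ℂ :=
  (κ e * (ω * Real.cos (ω * x)) : ℝ)

theorem hasDerivAt_sineFamily (κ : Edge → ℝ) (e : Edge) (x : ℝ) :
    HasDerivAt (sineFamily ω κ e) (sineFamilyDeriv ω κ e x) x := by
  have h : HasDerivAt (fun x => ω * x) ω x := by simpa using (hasDerivAt_id x).const_mul ω
  refine ((h.sin.const_mul (κ e)).congr_deriv ?_).ofReal_comp
  ring

theorem hasDerivAt_sineFamilyDeriv (κ : Edge → ℝ) (e : Edge) (x : ℝ) :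
    HasDerivAt (sineFamilyDeriv ω κ e) (-(ω : ℂ) ^ 2 * sineFamily ω κ e x) x := by
  have h : HasDerivAt (fun x => ω * x) ω x := by simpa using (hasDerivAt_id x).const_mul ω
  refine (((h.cos.const_mul ω).const_mul (κ e)).ofReal_comp).congr_deriv ?_
  simp only [sineFamily]
  push_cast
  ring

theorem integral_sin_mul_sq (hω : ω ≠ 0) (x y : ℝ) : ∫ t in x..y, Real.sin (ω * t) ^ 2
    = (y - x) / 2 + (Real.sin (ω * x) * Real.cos (ω * x)
      - Real.sin (ω * y) * Real.cos (ω * y)) / (2 * ω) := by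
  rw [intervalIntegral.integral_comp_mul_left (fun t => Real.sin t ^ 2) hω, integral_sin_sq,
    smul_eq_mul]
  field_simp
  ring

theorem integral_sineFamily_sq (ha₁ : 0 < a₁) (ha₂ : 0 < a₂) (ha₃ : 0 < a₃) (hω : ω ≠ 0)
    {κ : Edge → ℝ} {e : Edge} (hκ : κ e = 1)
    (hlo : Real.sin (ω * e.lo a₁ a₂ a₃) * Real.cos (ω * e.lo a₁ a₂ a₃) = 0)
    (hhi : Real.sin (ω * e.hi a₁ a₂ a₃) * Real.cos (ω * e.hi a₁ a₂ a₃) = 0) :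
    ∫ t, ‖sineFamily ω κ e t‖ ^ 2 ∂(edgeVolume a₁ a₂ a₃ e) = e.length a₁ a₂ a₃ / 2 := by
  have h := e.lo_lt_hi ha₁ ha₂ ha₃
  simp only [sineFamily, hκ, one_mul, Complex.norm_real, Real.norm_eq_abs, sq_abs, edgeVolume]
  rw [integral_Icc_eq_integral_Ioc, ← intervalIntegral.integral_of_le h.le,
    integral_sin_mul_sq hω, hlo, hhi, Edge.length]
  simp

/-- A family of sine waves is a singular sequence generator as soon as it satisfies the vertex
conditions. -/
theorem mem_essSpectrum_of_sineFamily (ha₁ : 0 < a₁) (ha₂ : 0 < a₂)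
    (ha₃ : 0 < a₃) (hμ : 0 < μ) (hω : ω ≠ 0) {κ : Edge → ℝ} (hκ : ∀ e, |κ e| ≤ 1)
    (h : IsLocalSolution a₁ a₂ a₃ β 1 ω (sineFamily ω κ) (sineFamilyDeriv ω κ))
    {ι : ℤ × ℤ → Edge} (hι : ∀ x, (ι x).source = x) (hκι : ∀ x, κ (ι x) = 1)
    (hlo : ∀ x, Real.sin (ω * (ι x).lo a₁ a₂ a₃) * Real.cos (ω * (ι x).lo a₁ a₂ a₃) = 0)
    (hhi : ∀ x, Real.sin (ω * (ι x).hi a₁ a₂ a₃) * Real.cos (ω * (ι x).hi a₁ a₂ a₃) = 0) :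
    ((ω ^ 2 : ℝ) : ℂ) ∈ UnboundedOp.essSpectrum (limitOp a₁ a₂ a₃ β μ) := by
  have hM : 0 < a₁⁻¹ + a₂⁻¹ + 2 * a₃⁻¹ := by positivity
  have h1 : ∀ e x, ‖sineFamily ω κ e x‖ ≤ 1 := fun e x => by
    rw [sineFamily, Complex.norm_real, norm_mul, Real.norm_eq_abs, Real.norm_eq_abs]
    exact mul_le_one₀ (hκ e) (abs_nonneg _) (Real.abs_sin_le_one _)
  have h2 : ∀ e x, ‖sineFamilyDeriv ω κ e x‖ ≤ |ω| := fun e x => by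
    rw [sineFamilyDeriv, Complex.norm_real, norm_mul, norm_mul]
    simp only [Real.norm_eq_abs]
    exact (mul_le_of_le_one_left (by positivity) (hκ e)).trans
      (mul_le_of_le_one_right (abs_nonneg _) (Real.abs_cos_le_one _))
  refine mem_essSpectrum_of_isLocalSolution ha₁ ha₂ ha₃ hμ h (B := 1 + |ω|)
    (fun e x _ => (h1 e x).trans (by linarith [abs_nonneg ω]))
    (fun e x _ => (h2 e x).trans (by linarith)) hι (c := (a₁⁻¹ + a₂⁻¹ + 2 * a₃⁻¹)⁻¹ / 2)
    (by positivity) fun x => ?_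
  rw [integral_sineFamily_sq ha₁ ha₂ ha₃ hω (hκι x) (hlo x) (hhi x)]
  exact div_le_div_of_nonneg_right
    (inv_le_of_inv_le₀ ((ι x).length_pos ha₁ ha₂ ha₃) ((ι x).inv_length_le ha₁ ha₂ ha₃))
    zero_le_two

theorem sin_mul_int_mul_eq_zero {a : ℝ} (h : Real.sin (ω * a) = 0) (k : ℤ) :
    Real.sin (ω * (k * a)) = 0 := by
  obtain ⟨n, hn⟩ := Real.sin_eq_zero_iff.1 h
  rw [show ω * (k * a) = ((k * n : ℤ) : ℝ) * Real.pi by push_cast; rw [mul_assoc, hn]; ring]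
  exact Real.sin_int_mul_pi _

/-- The function `sin (ω x₁)` on all lines parallel to the first axis, and zero elsewhere, vanishes
at every vertex and has continuous derivative along these lines, so the vertex conditions hold. -/
theorem mem_essSpectrum_of_sin_eq_zero (ha₁ : 0 < a₁) (ha₂ : 0 < a₂)
    (ha₃ : 0 < a₃) (hμ : 0 < μ) (hω : ω ≠ 0) (hs : Real.sin (ω * a₁) = 0) :
    ((ω ^ 2 : ℝ) : ℂ) ∈ UnboundedOp.essSpectrum (limitOp a₁ a₂ a₃ β μ) := by
  have hk := sin_mul_int_mul_eq_zero hs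
  set κ : Edge → ℝ := fun e => match e with | .e₁ _ _ => 1 | _ => 0 with hκ
  refine mem_essSpectrum_of_sineFamily ha₁ ha₂ ha₃ hμ hω (κ := κ)
    (fun e => by cases e <;> simp [hκ]) ?_ (ι := fun x => .e₁ x.1 x.2) (fun x => rfl)
    (fun x => rfl) (fun x => ?_) (fun x => ?_)
  · refine ⟨hasDerivAt_sineFamily κ, hasDerivAt_sineFamilyDeriv κ, fun k l => ⟨0, ?_⟩,
      fun k l => ?_, fun k l => ?_, fun k l => ?_⟩ <;> simp [sineFamily, sineFamilyDeriv, hκ, -Complex.ofReal_sin, hk]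
  · simp [Edge.lo, hk]
  · have := hk (x.1 + 1)
    push_cast at this
    simp [Edge.hi, this]

theorem mem_essSpectrum_of_sin_eq_zero' (ha₁ : 0 < a₁) (ha₂ : 0 < a₂)
    (ha₃ : 0 < a₃) (hμ : 0 < μ) (hω : ω ≠ 0) (hs : Real.sin (ω * a₂) = 0) :
    ((ω ^ 2 : ℝ) : ℂ) ∈ UnboundedOp.essSpectrum (limitOp a₁ a₂ a₃ β μ) := by
  have hk := sin_mul_int_mul_eq_zero hs
  set κ : Edge → ℝ := fun e => match e with | .e₂ _ _ => 1 | _ => 0 with hκ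
  refine mem_essSpectrum_of_sineFamily ha₁ ha₂ ha₃ hμ hω (κ := κ)
    (fun e => by cases e <;> simp [hκ]) ?_ (ι := fun x => .e₂ x.1 x.2) (fun x => rfl)
    (fun x => rfl) (fun x => ?_) (fun x => ?_)
  · refine ⟨hasDerivAt_sineFamily κ, hasDerivAt_sineFamilyDeriv κ, fun k l => ⟨0, ?_⟩,
      fun k l => ?_, fun k l => ?_, fun k l => ?_⟩ <;> simp [sineFamily, sineFamilyDeriv, hκ, -Complex.ofReal_sin, hk]
  · simp [Edge.lo, hk]
  · have := hk (x.2 + 1)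
    push_cast at this
    simp [Edge.hi, this]

/-- In this case `cos β = ±1` and `sin (ω x₃)` is itself quasi-periodic on each vertical segment. It
vanishes at the vertex with equal slopes on both sides, so no flux enters the horizontal edges. -/
theorem mem_essSpectrum_of_vertical (ha₁ : 0 < a₁) (ha₂ : 0 < a₂)
    (ha₃ : 0 < a₃) (hμ : 0 < μ) (hω : ω ≠ 0) (hs : Real.sin (ω * a₃) = 0)
    (hc : Real.cos (ω * a₃) = Real.cos β) :
    ((ω ^ 2 : ℝ) : ℂ) ∈ UnboundedOp.essSpectrum (limitOp a₁ a₂ a₃ β μ) := by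
  set κ : Edge → ℝ := fun e => match e with | .ePlus _ _ => 1 | .eMinus _ _ => 1 | _ => 0 with hκ
  set t := ω * (a₃ / 2) with ht
  have h2t : ω * a₃ = 2 * t := by rw [ht]; ring
  have hprod : Real.sin t * Real.cos t = 0 := by
    rw [h2t, Real.sin_two_mul] at hs
    linarith
  have hsinβ : Real.sin β = 0 := by
    have h1 := Real.sin_sq_add_cos_sq β
    have h2 := Real.sin_sq_add_cos_sq (ω * a₃)
    rw [hs, hc] at h2
    have : Real.sin β ^ 2 = 0 := by linarith
    exact pow_eq_zero_iff (two_ne_zero) |>.1 this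
  have hexp : Complex.exp (-(Complex.I * β)) = (Real.cos β : ℝ) := by
    rw [show -(Complex.I * (β : ℂ)) = ((-β : ℝ) : ℂ) * Complex.I by push_cast; ring,
      Complex.exp_mul_I, ← Complex.ofReal_cos, ← Complex.ofReal_sin, Real.cos_neg, Real.sin_neg,
      hsinβ]
    simp
  rw [h2t] at hc
  -- These are the quasi-periodicity conditions for the value and the derivative, expressed at the
  -- half angle `t = ω a₃ / 2`.
  have hcs : Real.sin t * (1 + Real.cos β) = 0 ∧ Real.cos t * (1 - Real.cos β) = 0 := by
    have hq := Real.sin_sq_add_cos_sq t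
    rw [← hc, Real.cos_two_mul]
    rcases mul_eq_zero.1 hprod with h | h
    · rw [h] at hq ⊢
      refine ⟨by ring, ?_⟩
      linear_combination (-2 * Real.cos t) * hq
    · rw [h]
      exact ⟨by ring, by ring⟩
  refine mem_essSpectrum_of_sineFamily ha₁ ha₂ ha₃ hμ hω (κ := κ)
    (fun e => by cases e <;> simp [hκ]) ?_ (ι := fun x => .ePlus x.1 x.2) (fun x => rfl)
    (fun x => rfl) (fun x => ?_) (fun x => ?_)
  · refine ⟨hasDerivAt_sineFamily κ, hasDerivAt_sineFamilyDeriv κ, fun k l => ⟨0, ?_⟩,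
      fun k l => ?_, fun k l => ?_, fun k l => ?_⟩
    · simp [sineFamily, hκ]
    · simp only [sineFamily, hκ, hexp, one_mul, mul_neg, Real.sin_neg]
      rw [← ht, ← Complex.ofReal_mul]
      congr 1
      linarith [hcs.1]
    · simp only [sineFamilyDeriv, hκ, hexp, one_mul, mul_neg, Real.cos_neg]
      rw [← ht, ← Complex.ofReal_mul]
      congr 1
      linear_combination ω * hcs.2
    · simp [sineFamilyDeriv, hκ]
  · simp [Edge.lo]
  · simpa [Edge.hi, ← ht] using hprod

end SineFamily

section Bloch

theorem exists_unimodular {t : ℝ} (ht : |t| ≤ 1) : ∃ z : ℂ, ‖z‖ = 1 ∧ z + z⁻¹ = 2 * (t : ℂ) := by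
  obtain ⟨h1, h2⟩ := abs_le.1 ht
  refine ⟨Complex.exp (Real.arccos t * Complex.I), Complex.norm_exp_ofReal_mul_I _, ?_⟩
  rw [← Complex.exp_neg, ← neg_mul, ← Complex.two_cos, ← Complex.ofReal_cos, Real.cos_arccos h1 h2]

/-- Parameters of a Bloch wave with prescribed value of the dispersion function. -/
theorem exists_band_parameters {r₁ r₂ E : ℝ} (h1 : r₁ ≠ 0) (h2 : r₂ ≠ 0)
    (hE : |E| ≤ 1 / |r₁| + 1 / |r₂|) :
    ∃ t₁ t₂ : ℝ, |t₁| ≤ 1 ∧ |t₂| ≤ 1 ∧ t₁ / r₁ + t₂ / r₂ = E := by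
  have p1 := abs_pos.2 h1
  have p2 := abs_pos.2 h2
  -- Both parameters are `E / R` up to the sign of `r₁` or `r₂`, so the two terms add up to `R · (E
  -- / R)`.
  set R := 1 / |r₁| + 1 / |r₂| with hR
  have hR0 : 0 < R := by positivity
  have hq : |E / R| ≤ 1 := by
    rw [abs_div, abs_of_pos hR0]
    exact (div_le_one hR0).2 hE
  have key : ∀ r : ℝ, r ≠ 0 → |r / |r| * (E / R)| ≤ 1 ∧ r / |r| * (E / R) / r = 1 / |r| * (E / R) := by
    intro r hr
    refine ⟨?_, ?_⟩
    · rw [abs_mul, abs_div, abs_abs, div_self (abs_ne_zero.2 hr), one_mul]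
      exact hq
    · have := abs_ne_zero.2 hr
      field_simp
  refine ⟨_, _, (key r₁ h1).1, (key r₂ h2).1, ?_⟩
  rw [(key r₁ h1).2, (key r₂ h2).2, ← add_mul, ← hR]
  field_simp

/-- For unimodular `z₁`, `z₂` the vertex values `z₁ ^ k z₂ ^ l` diagonalize the hopping terms with
factors `2 t₁`, `2 t₂`, and these can be chosen to match any value allowed by the band condition. -/
theorem mem_essSpectrum_of_bloch (ha₁ : 0 < a₁) (ha₂ : 0 < a₂)
    (ha₃ : 0 < a₃) (hμ : 0 < μ) (h1 : Real.sin (ω * a₁) ≠ 0)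
    (h2 : Real.sin (ω * a₂) ≠ 0) (h3 : Real.sin (ω * a₃) ≠ 0)
    (hband : |verticalTerm a₃ β ω + bandCenter a₁ a₂ ω| ≤ bandRadius a₁ a₂ ω) :
    ((ω ^ 2 : ℝ) : ℂ) ∈ UnboundedOp.essSpectrum (limitOp a₁ a₂ a₃ β μ) := by
  obtain ⟨t₁, t₂, ht₁, ht₂, ht⟩ := exists_band_parameters h1 h2 hband
  obtain ⟨z₁, hz₁, hz₁'⟩ := exists_unimodular ht₁
  obtain ⟨z₂, hz₂, hz₂'⟩ := exists_unimodular ht₂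
  have n1 : z₁ ≠ 0 := fun h => by simp [h] at hz₁
  have n2 : z₂ ≠ 0 := fun h => by simp [h] at hz₂
  set p : ℤ × ℤ → ℂ := fun x => z₁ ^ x.1 * z₂ ^ x.2 with hp
  have hpn : ∀ x, ‖p x‖ = 1 := fun x => by
    simp [hp, norm_zpow, hz₁, hz₂]
  have c1 : ((Real.sin (ω * a₁) : ℝ) : ℂ) ≠ 0 := by exact_mod_cast h1
  have c2 : ((Real.sin (ω * a₂) : ℝ) : ℂ) ≠ 0 := by exact_mod_cast h2
  have hdisp := congrArg (fun r : ℝ => (r : ℂ)) ht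
  simp only [bandCenter, Complex.ofReal_add, Complex.ofReal_div] at hdisp
  have hsol := isLocalSolution_sinWave (β := β) (μ := 1) (p := p) h1 h2 h3 (fun k l => by
    have e1 : p (k + 1, l) + p (k - 1, l) = 2 * (t₁ : ℂ) * p (k, l) := by
      simp only [hp]
      rw [zpow_add_one₀ n1, zpow_sub_one₀ n1, ← hz₁']
      ring
    have e2 : p (k, l + 1) + p (k, l - 1) = 2 * (t₂ : ℂ) * p (k, l) := by
      simp only [hp]
      rw [zpow_add_one₀ n2, zpow_sub_one₀ n2, ← hz₂']
      ring
    have hw : vertexWeight 1 k l = 1 := by simp [vertexWeight]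
    rw [e1, e2, hw, Complex.ofReal_one]
    linear_combination 2 * p (k, l) * hdisp)
  obtain ⟨K, hK, k1, k2, k3, k4⟩ := norm_coeff_le (a₁ := a₁) (a₂ := a₂) (a₃ := a₃) (β := β)
    (ω := ω) p
  set A := coeffHi a₁ a₂ a₃ β ω p
  set B := coeffLo a₁ a₂ a₃ β ω p
  have hAB : ∀ e, ‖A e‖ + ‖B e‖ ≤ K * 2 := fun e => by
    cases e with
    | e₁ k l => simpa [hpn, one_add_one_eq_two] using k1 k l
    | e₂ k l => simpa [hpn, one_add_one_eq_two] using k2 k l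
    | ePlus k l => simpa [hpn, one_add_one_eq_two] using k3 k l
    | eMinus k l => simpa [hpn, one_add_one_eq_two] using k4 k l
  have hwave : ∀ k l x, sinWave a₁ a₂ a₃ ω A B (.ePlus k l) x
      = p (k, l) * sinWave a₁ a₂ a₃ ω A B (.ePlus 0 0) x := fun k l x => by
    have p0 : p (0, 0) = 1 := by simp [hp]
    simp only [sinWave, A, B, coeffHi, coeffLo, Edge.phaseHi, Edge.phaseLo, p0]
    ring
  have hcont : Continuous (sinWave a₁ a₂ a₃ ω A B (.ePlus 0 0)) :=
    continuous_iff_continuousAt.2 fun x => (hasDerivAt_sinWave _ x).continuousAt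
  refine mem_essSpectrum_of_isLocalSolution ha₁ ha₂ ha₃ hμ hsol (B := K * 2 + |ω| * (K * 2))
    (fun e x _ => (norm_sinWave_le e x).trans ((hAB e).trans
      (le_add_of_nonneg_right (by positivity))))
    (fun e x _ => (norm_sinWaveDeriv_le e x).trans
      ((mul_le_mul_of_nonneg_left (hAB e) (abs_nonneg ω)).trans
      (le_add_of_nonneg_left (by positivity))))
    (ι := fun x => .ePlus x.1 x.2) (fun x => rfl)
    (c := ∫ t, ‖sinWave a₁ a₂ a₃ ω A B (.ePlus 0 0) t‖ ^ 2 ∂(edgeVolume a₁ a₂ a₃ (.ePlus 0 0)))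
    ?_ (fun x => ?_)
  -- If the mass of the reference vertical edge were zero, the continuous wave would vanish there,
  -- but its value at the vertex has modulus one. All other upper vertical edges carry the same
  -- mass.
  · refine lt_of_le_of_ne (integral_nonneg fun x => by positivity) fun h0 => ?_
    have hi : Integrable (fun t => ‖sinWave a₁ a₂ a₃ ω A B (.ePlus 0 0) t‖ ^ 2)
        (edgeVolume a₁ a₂ a₃ (.ePlus 0 0)) :=
      (hcont.norm.pow 2).continuousOn.integrableOn_Icc
    have h4 := (integral_eq_zero_iff_of_nonneg (fun x => by positivity) hi).1 h0.symm
    have h5 := Measure.eqOn_Icc_of_ae_eq _ ((Edge.ePlus 0 0).lo_lt_hi ha₁ ha₂ ha₃).ne h4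
      (hcont.norm.pow 2).continuousOn continuousOn_const
      (left_mem_Icc.2 ((Edge.ePlus 0 0).lo_lt_hi ha₁ ha₂ ha₃).le)
    have c3 : ((Real.sin (ω * a₃) : ℝ) : ℂ) ≠ 0 := by exact_mod_cast h3
    have h6 : sinWave a₁ a₂ a₃ ω A B (.ePlus 0 0) 0 = p (0, 0) := by
      simp only [sinWave, A, B, coeffHi, coeffLo, Edge.phaseHi, Edge.phaseLo, sub_zero, mul_zero,
        Real.sin_zero, Complex.ofReal_zero]
      field_simp; ring
    simp only [Edge.lo, h6, hpn, Pi.zero_apply] at h5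
    norm_num at h5
  · refine le_of_eq (integral_congr_ae (Eventually.of_forall fun t => ?_))
    simp only [hwave x.1 x.2 t, norm_mul, hpn, one_mul]

end Bloch

/-- The dispersion relation, in a form without division by `sin (ω a₃)`, describes points of the
essential spectrum. -/
theorem mem_essSpectrum_of_band (ha₁ : 0 < a₁) (ha₂ : 0 < a₂)
    (ha₃ : 0 < a₃) (hμ : 0 < μ) (hω : ω ≠ 0)
    (h : Real.sin (ω * a₁) = 0 ∨ Real.sin (ω * a₂) = 0 ∨
      |Real.cos (ω * a₃) - Real.cos β + Real.sin (ω * a₃) * bandCenter a₁ a₂ ω|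
        ≤ |Real.sin (ω * a₃)| * bandRadius a₁ a₂ ω) :
    ((ω ^ 2 : ℝ) : ℂ) ∈ UnboundedOp.essSpectrum (limitOp a₁ a₂ a₃ β μ) := by
  by_cases h1 : Real.sin (ω * a₁) = 0
  · exact mem_essSpectrum_of_sin_eq_zero ha₁ ha₂ ha₃ hμ hω h1
  by_cases h2 : Real.sin (ω * a₂) = 0
  · exact mem_essSpectrum_of_sin_eq_zero' ha₁ ha₂ ha₃ hμ hω h2
  have hb := (h.resolve_left h1).resolve_left h2
  by_cases h3 : Real.sin (ω * a₃) = 0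
  · rw [h3, zero_mul, add_zero, abs_zero, zero_mul] at hb
    exact mem_essSpectrum_of_vertical ha₁ ha₂ ha₃ hμ hω h3
      (sub_eq_zero.1 (abs_nonpos_iff.1 hb))
  · refine mem_essSpectrum_of_bloch ha₁ ha₂ ha₃ hμ h1 h2 h3 ?_
    refine le_of_mul_le_mul_left ?_ (abs_pos.2 h3)
    rw [← abs_mul, mul_add, verticalTerm, mul_div_cancel₀ _ h3]
    exact hb

end LimitGraph

/-! ### The vertex equation in the presence of a residual. -/

namespace LimitGraph

variable {a₁ a₂ a₃ β μ ω : ℝ}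

section VertexIdentities

/-- Sine moment of the residual `u'' + ω² u` on an edge. -/
noncomputable def sourceSin (a₁ a₂ a₃ ω : ℝ) (U G : Edge → ℝ → ℂ) (e : Edge) : ℂ :=
  ∫ t in e.lo a₁ a₂ a₃..e.hi a₁ a₂ a₃, (G e t + (ω : ℂ) ^ 2 * U e t)
    * (Real.sin (ω * (e.hi a₁ a₂ a₃ - t)) : ℝ)

/-- Cosine moment of the residual `u'' + ω² u` on an edge. -/
noncomputable def sourceCos (a₁ a₂ a₃ ω : ℝ) (U G : Edge → ℝ → ℂ) (e : Edge) : ℂ :=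
  ∫ t in e.lo a₁ a₂ a₃..e.hi a₁ a₂ a₃, (G e t + (ω : ℂ) ^ 2 * U e t)
    * (Real.cos (ω * (e.hi a₁ a₂ a₃ - t)) : ℝ)

/-- The squared norm of the residual `u'' + ω² u` on an edge. -/
noncomputable def residualSq (a₁ a₂ a₃ ω : ℝ) (U G : Edge → ℝ → ℂ) (e : Edge) : ℝ :=
  ∫ t, ‖G e t + (ω : ℂ) ^ 2 * U e t‖ ^ 2 ∂(edgeVolume a₁ a₂ a₃ e)

theorem residualSq_nonneg (U G : Edge → ℝ → ℂ) (e : Edge) :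
    0 ≤ residualSq a₁ a₂ a₃ ω U G e := integral_nonneg fun x => by positivity

variable {U V G : Edge → ℝ → ℂ}

theorem Edge.length_e₁ (k l : ℤ) : (Edge.e₁ k l).length a₁ a₂ a₃ = a₁ := by
  simp only [Edge.length, Edge.lo, Edge.hi]; ring

theorem Edge.length_e₂ (k l : ℤ) : (Edge.e₂ k l).length a₁ a₂ a₃ = a₂ := by
  simp only [Edge.length, Edge.lo, Edge.hi]; ring

theorem Edge.length_ePlus (k l : ℤ) : (Edge.ePlus k l).length a₁ a₂ a₃ = a₃ / 2 := by
  simp only [Edge.length, Edge.lo, Edge.hi]; ring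

theorem Edge.length_eMinus (k l : ℤ) : (Edge.eMinus k l).length a₁ a₂ a₃ = a₃ / 2 := by
  simp only [Edge.length, Edge.lo, Edge.hi]; ring

theorem IsH2Graph.value_hi (ha₁ : 0 < a₁) (ha₂ : 0 < a₂) (ha₃ : 0 < a₃)
    (h : IsH2Graph a₁ a₂ a₃ U V G) (ω : ℝ) (e : Edge) :
    (ω : ℂ) * U e (e.hi a₁ a₂ a₃) = ω * Real.cos (ω * e.length a₁ a₂ a₃) * U e (e.lo a₁ a₂ a₃)
      + Real.sin (ω * e.length a₁ a₂ a₃) * V e (e.lo a₁ a₂ a₃)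
      + sourceSin a₁ a₂ a₃ ω U G e :=
  (h.edge e).eq_initial (right_mem_Icc.2 (e.lo_lt_hi ha₁ ha₂ ha₃).le)

theorem IsH2Graph.deriv_hi (ha₁ : 0 < a₁) (ha₂ : 0 < a₂) (ha₃ : 0 < a₃)
    (h : IsH2Graph a₁ a₂ a₃ U V G) (ω : ℝ) (e : Edge) :
    V e (e.hi a₁ a₂ a₃) = Real.cos (ω * e.length a₁ a₂ a₃) * V e (e.lo a₁ a₂ a₃)
      - ω * Real.sin (ω * e.length a₁ a₂ a₃) * U e (e.lo a₁ a₂ a₃)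
      + sourceCos a₁ a₂ a₃ ω U G e :=
  (h.edge e).deriv_eq_initial (right_mem_Icc.2 (e.lo_lt_hi ha₁ ha₂ ha₃).le)

/-- The values at the vertices of a function on the graph. -/
def vertexValue (U : Edge → ℝ → ℂ) (x : ℤ × ℤ) : ℂ := U (.ePlus x.1 x.2) 0

theorem IsH2Graph.e₁_lo (h : IsH2Graph a₁ a₂ a₃ U V G) (k l : ℤ) :
    U (.e₁ k l) (k * a₁) = vertexValue U (k, l) := by
  obtain ⟨p, h1, h2, h3, h4, h5, h6⟩ := h.vertex k l
  rw [vertexValue, h1, h5]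

theorem IsH2Graph.e₁_hi (h : IsH2Graph a₁ a₂ a₃ U V G) (k l : ℤ) :
    U (.e₁ k l) ((k + 1) * a₁) = vertexValue U (k + 1, l) := by
  obtain ⟨p, h1, h2, h3, h4, h5, h6⟩ := h.vertex (k + 1) l
  rw [vertexValue, h5]
  simpa using h2

theorem IsH2Graph.e₂_lo (h : IsH2Graph a₁ a₂ a₃ U V G) (k l : ℤ) :
    U (.e₂ k l) (l * a₂) = vertexValue U (k, l) := by
  obtain ⟨p, h1, h2, h3, h4, h5, h6⟩ := h.vertex k l
  rw [vertexValue, h3, h5]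

theorem IsH2Graph.e₂_hi (h : IsH2Graph a₁ a₂ a₃ U V G) (k l : ℤ) :
    U (.e₂ k l) ((l + 1) * a₂) = vertexValue U (k, l + 1) := by
  obtain ⟨p, h1, h2, h3, h4, h5, h6⟩ := h.vertex k (l + 1)
  rw [vertexValue, h5]
  simpa using h4

theorem IsH2Graph.eMinus_hi (h : IsH2Graph a₁ a₂ a₃ U V G) (k l : ℤ) :
    U (.eMinus k l) 0 = vertexValue U (k, l) := by
  obtain ⟨p, h1, h2, h3, h4, h5, h6⟩ := h.vertex k l
  rw [vertexValue, h5, h6]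

theorem IsH2Graph.sin_mul_deriv_e₁ (ha₁ : 0 < a₁) (ha₂ : 0 < a₂) (ha₃ : 0 < a₃)
    (h : IsH2Graph a₁ a₂ a₃ U V G) (ω : ℝ) (k l : ℤ) :
    (Real.sin (ω * a₁) : ℂ) * V (.e₁ k l) (k * a₁)
      = ω * (vertexValue U (k + 1, l) - Real.cos (ω * a₁) * vertexValue U (k, l))
        - sourceSin a₁ a₂ a₃ ω U G (.e₁ k l) := by
  have h1 := h.value_hi ha₁ ha₂ ha₃ ω (.e₁ k l)
  rw [Edge.length_e₁] at h1
  simp only [Edge.lo, Edge.hi, h.e₁_lo, h.e₁_hi] at h1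
  linear_combination -h1

theorem IsH2Graph.sin_mul_deriv_e₂ (ha₁ : 0 < a₁) (ha₂ : 0 < a₂) (ha₃ : 0 < a₃)
    (h : IsH2Graph a₁ a₂ a₃ U V G) (ω : ℝ) (k l : ℤ) :
    (Real.sin (ω * a₂) : ℂ) * V (.e₂ k l) (l * a₂)
      = ω * (vertexValue U (k, l + 1) - Real.cos (ω * a₂) * vertexValue U (k, l))
        - sourceSin a₁ a₂ a₃ ω U G (.e₂ k l) := by
  have h1 := h.value_hi ha₁ ha₂ ha₃ ω (.e₂ k l)
  rw [Edge.length_e₂] at h1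
  simp only [Edge.lo, Edge.hi, h.e₂_lo, h.e₂_hi] at h1
  linear_combination -h1

/-- Residual terms of the flux through a vertex along a horizontal line. -/
noncomputable def sourceFlux (s c : ℂ) (J J' : ℂ) (Jc : ℂ) : ℂ := J - c * J' + s * Jc

/-- The derivative arriving at the vertex is propagated from the start of the previous edge, where
it is expressed by vertex values. The factor `sin (ω a₁)` clears denominators. -/
theorem IsH2Graph.flux_e₁ (ha₁ : 0 < a₁) (ha₂ : 0 < a₂) (ha₃ : 0 < a₃)
    (h : IsH2Graph a₁ a₂ a₃ U V G) (ω : ℝ) (k l : ℤ) :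
    (Real.sin (ω * a₁) : ℂ) * (V (.e₁ k l) (k * a₁) - V (.e₁ (k - 1) l) (k * a₁))
      = ω * (vertexValue U (k + 1, l) + vertexValue U (k - 1, l)
          - 2 * Real.cos (ω * a₁) * vertexValue U (k, l))
        - sourceFlux (Real.sin (ω * a₁)) (Real.cos (ω * a₁)) (sourceSin a₁ a₂ a₃ ω U G (.e₁ k l))
          (sourceSin a₁ a₂ a₃ ω U G (.e₁ (k - 1) l)) (sourceCos a₁ a₂ a₃ ω U G (.e₁ (k - 1) l)) := by
  have h1 := h.sin_mul_deriv_e₁ ha₁ ha₂ ha₃ ω k l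
  have h2 := h.sin_mul_deriv_e₁ ha₁ ha₂ ha₃ ω (k - 1) l
  have h3 := h.deriv_hi ha₁ ha₂ ha₃ ω (.e₁ (k - 1) l)
  have h4 := h.e₁_lo (k - 1) l
  rw [Edge.length_e₁] at h3
  simp only [Edge.lo, Edge.hi, h4] at h3
  rw [sub_add_cancel] at h2
  rw [show (((k - 1 : ℤ) : ℝ) + 1) = k by push_cast; ring] at h3
  have hq : ((Real.sin (ω * a₁) : ℝ) : ℂ) ^ 2 + ((Real.cos (ω * a₁) : ℝ) : ℂ) ^ 2 = 1 := by
    exact_mod_cast Real.sin_sq_add_cos_sq (ω * a₁)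
  unfold sourceFlux
  linear_combination h1 - (Real.sin (ω * a₁) : ℂ) * h3 - (Real.cos (ω * a₁) : ℂ) * h2
    + ω * vertexValue U (k - 1, l) * hq

theorem IsH2Graph.flux_e₂ (ha₁ : 0 < a₁) (ha₂ : 0 < a₂) (ha₃ : 0 < a₃)
    (h : IsH2Graph a₁ a₂ a₃ U V G) (ω : ℝ) (k l : ℤ) :
    (Real.sin (ω * a₂) : ℂ) * (V (.e₂ k l) (l * a₂) - V (.e₂ k (l - 1)) (l * a₂))
      = ω * (vertexValue U (k, l + 1) + vertexValue U (k, l - 1)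
          - 2 * Real.cos (ω * a₂) * vertexValue U (k, l))
        - sourceFlux (Real.sin (ω * a₂)) (Real.cos (ω * a₂)) (sourceSin a₁ a₂ a₃ ω U G (.e₂ k l))
          (sourceSin a₁ a₂ a₃ ω U G (.e₂ k (l - 1))) (sourceCos a₁ a₂ a₃ ω U G (.e₂ k (l - 1))) := by
  have h1 := h.sin_mul_deriv_e₂ ha₁ ha₂ ha₃ ω k l
  have h2 := h.sin_mul_deriv_e₂ ha₁ ha₂ ha₃ ω k (l - 1)
  have h3 := h.deriv_hi ha₁ ha₂ ha₃ ω (.e₂ k (l - 1))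
  have h4 := h.e₂_lo k (l - 1)
  rw [Edge.length_e₂] at h3
  simp only [Edge.lo, Edge.hi, h4] at h3
  rw [sub_add_cancel] at h2
  rw [show (((l - 1 : ℤ) : ℝ) + 1) = l by push_cast; ring] at h3
  have hq : ((Real.sin (ω * a₂) : ℝ) : ℂ) ^ 2 + ((Real.cos (ω * a₂) : ℝ) : ℂ) ^ 2 = 1 := by
    exact_mod_cast Real.sin_sq_add_cos_sq (ω * a₂)
  unfold sourceFlux
  linear_combination h1 - (Real.sin (ω * a₂) : ℂ) * h3 - (Real.cos (ω * a₂) : ℂ) * h2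
    + ω * vertexValue U (k, l - 1) * hq

/-- Residual term in the equation for `u'(0+)` on a vertical segment. -/
noncomputable def sourceUp (a₁ a₂ a₃ β ω : ℝ) (U G : Edge → ℝ → ℂ) (x : ℤ × ℤ) : ℂ :=
  Real.cos (ω * (a₃ / 2)) * sourceSin a₁ a₂ a₃ ω U G (.ePlus x.1 x.2)
    + Real.sin (ω * (a₃ / 2)) * sourceCos a₁ a₂ a₃ ω U G (.ePlus x.1 x.2)
    + Complex.exp (-(Complex.I * β)) * sourceSin a₁ a₂ a₃ ω U G (.eMinus x.1 x.2)

/-- Residual term in the equation for `u'(0-)` on a vertical segment. -/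
noncomputable def sourceDown (a₁ a₂ a₃ β ω : ℝ) (U G : Edge → ℝ → ℂ) (x : ℤ × ℤ) : ℂ :=
  Complex.exp (Complex.I * β) *
      (Real.cos (ω * (a₃ / 2)) * sourceCos a₁ a₂ a₃ ω U G (.ePlus x.1 x.2)
        - Real.sin (ω * (a₃ / 2)) * sourceSin a₁ a₂ a₃ ω U G (.ePlus x.1 x.2))
    + sourceCos a₁ a₂ a₃ ω U G (.eMinus x.1 x.2)

theorem exp_neg_mul_exp (β : ℝ) :
    Complex.exp (-(Complex.I * β)) * Complex.exp (Complex.I * β) = 1 := by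
  rw [← Complex.exp_add]; simp

theorem exp_neg_add_exp (β : ℝ) :
    Complex.exp (-(Complex.I * β)) + Complex.exp (Complex.I * β) = 2 * (Real.cos β : ℝ) := by
  rw [Complex.ofReal_cos, Complex.cos, mul_comm Complex.I, neg_mul]
  ring

/-- Propagate from the vertex to the top, jump to the bottom by quasi-periodicity, and propagate
back to the vertex. Both formulas are free of division, so they also hold where `sin (ω a₃) = 0`. -/
theorem IsInDomain.vertical (ha₁ : 0 < a₁) (ha₂ : 0 < a₂) (ha₃ : 0 < a₃)
    (h : IsInDomain a₁ a₂ a₃ β μ U V G) (ω : ℝ) (k l : ℤ) :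
    (Real.sin (ω * a₃) : ℂ) * V (.ePlus k l) 0
        = ω * (Complex.exp (-(Complex.I * β)) - Real.cos (ω * a₃)) * vertexValue U (k, l)
          - sourceUp a₁ a₂ a₃ β ω U G (k, l) ∧
      V (.eMinus k l) 0 = Complex.exp (Complex.I * β) * (Real.cos (ω * a₃) * V (.ePlus k l) 0
          - ω * Real.sin (ω * a₃) * vertexValue U (k, l))
          + sourceDown a₁ a₂ a₃ β ω U G (k, l) := by
  have h1 := h.h2.value_hi ha₁ ha₂ ha₃ ω (.ePlus k l)
  have h2 := h.h2.deriv_hi ha₁ ha₂ ha₃ ω (.ePlus k l)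
  have h3 := h.h2.value_hi ha₁ ha₂ ha₃ ω (.eMinus k l)
  have h4 := h.h2.deriv_hi ha₁ ha₂ ha₃ ω (.eMinus k l)
  have hb := exp_neg_mul_exp β
  have q1 := h.quasiPer k l
  have q2 := h.quasiPer_deriv k l
  rw [Edge.length_ePlus] at h1 h2
  rw [Edge.length_eMinus] at h3 h4
  simp only [Edge.lo, Edge.hi, h.h2.eMinus_hi] at h1 h2 h3 h4
  rw [show U (.ePlus k l) 0 = vertexValue U (k, l) from rfl] at h1 h2
  have hs : ((Real.sin (ω * a₃) : ℝ) : ℂ)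
      = 2 * (Real.sin (ω * (a₃ / 2)) : ℝ) * (Real.cos (ω * (a₃ / 2)) : ℝ) := by
    rw [show ω * a₃ = 2 * (ω * (a₃ / 2)) by ring, Real.sin_two_mul]; push_cast; ring
  have hc : ((Real.cos (ω * a₃) : ℝ) : ℂ)
      = 2 * ((Real.cos (ω * (a₃ / 2)) : ℝ) : ℂ) ^ 2 - 1 := by
    rw [show ω * a₃ = 2 * (ω * (a₃ / 2)) by ring, Real.cos_two_mul]; push_cast; ring
  have hq : ((Real.sin (ω * (a₃ / 2)) : ℝ) : ℂ) ^ 2 + ((Real.cos (ω * (a₃ / 2)) : ℝ) : ℂ) ^ 2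
      = 1 := by
    exact_mod_cast Real.sin_sq_add_cos_sq (ω * (a₃ / 2))
  rw [hs, hc]
  unfold sourceUp sourceDown
  set s : ℂ := ((Real.sin (ω * (a₃ / 2)) : ℝ) : ℂ)
  set c : ℂ := ((Real.cos (ω * (a₃ / 2)) : ℝ) : ℂ)
  set b := Complex.exp (-(Complex.I * β))
  set b' := Complex.exp (Complex.I * β)
  set p := vertexValue U (k, l)
  have um : U (.eMinus k l) (-(a₃ / 2)) = b' * U (.ePlus k l) (a₃ / 2) := by
    linear_combination -b' * q1 - U (.eMinus k l) (-(a₃ / 2)) * hb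
  have vm : V (.eMinus k l) (-(a₃ / 2)) = b' * V (.ePlus k l) (a₃ / 2) := by
    linear_combination -b' * q2 - V (.eMinus k l) (-(a₃ / 2)) * hb
  constructor
  · linear_combination (-b) * h3 + (-c) * h1 + (-s) * h2 + (ω : ℂ) * c * q1 + s * q2 + ω * p * hq
  · rw [h4, vm, um, h2]
    linear_combination (-b' * s) * h1 - b' * V (.ePlus k l) 0 * hq

/-- The vertex equation with residual. -/
theorem IsInDomain.vertex_equation (ha₁ : 0 < a₁) (ha₂ : 0 < a₂) (ha₃ : 0 < a₃)
    (h : IsInDomain a₁ a₂ a₃ β μ U V G) (h1 : Real.sin (ω * a₁) ≠ 0)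
    (h2 : Real.sin (ω * a₂) ≠ 0) (k l : ℤ) :
    (ω : ℂ) * (Real.sin (ω * a₃) *
        ((vertexValue U (k + 1, l) + vertexValue U (k - 1, l)
          - 2 * Real.cos (ω * a₁) * vertexValue U (k, l)) / Real.sin (ω * a₁)
        + (vertexValue U (k, l + 1) + vertexValue U (k, l - 1)
          - 2 * Real.cos (ω * a₂) * vertexValue U (k, l)) / Real.sin (ω * a₂))
      - 2 * vertexWeight μ k l * (Real.cos (ω * a₃) - Real.cos β : ℝ) * vertexValue U (k, l))
    = Real.sin (ω * a₃) *
        (sourceFlux (Real.sin (ω * a₁)) (Real.cos (ω * a₁)) (sourceSin a₁ a₂ a₃ ω U G (.e₁ k l))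
          (sourceSin a₁ a₂ a₃ ω U G (.e₁ (k - 1) l)) (sourceCos a₁ a₂ a₃ ω U G (.e₁ (k - 1) l))
            / Real.sin (ω * a₁)
        + sourceFlux (Real.sin (ω * a₂)) (Real.cos (ω * a₂)) (sourceSin a₁ a₂ a₃ ω U G (.e₂ k l))
          (sourceSin a₁ a₂ a₃ ω U G (.e₂ k (l - 1))) (sourceCos a₁ a₂ a₃ ω U G (.e₂ k (l - 1)))
            / Real.sin (ω * a₂))
      + vertexWeight μ k l * ((1 - Complex.exp (Complex.I * β) * Real.cos (ω * a₃))
          * sourceUp a₁ a₂ a₃ β ω U G (k, l)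
        + Real.sin (ω * a₃) * sourceDown a₁ a₂ a₃ β ω U G (k, l)) := by
  have f1 := h.h2.flux_e₁ ha₁ ha₂ ha₃ ω k l
  have f2 := h.h2.flux_e₂ ha₁ ha₂ ha₃ ω k l
  obtain ⟨f3, f4⟩ := h.vertical ha₁ ha₂ ha₃ ω k l
  have hk := h.kirchhoff k l
  have hb := exp_neg_mul_exp β
  have hb2 := exp_neg_add_exp β
  have c1 : ((Real.sin (ω * a₁) : ℝ) : ℂ) ≠ 0 := by exact_mod_cast h1
  have c2 : ((Real.sin (ω * a₂) : ℝ) : ℂ) ≠ 0 := by exact_mod_cast h2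
  have hq : ((Real.sin (ω * a₃) : ℝ) : ℂ) ^ 2 + ((Real.cos (ω * a₃) : ℝ) : ℂ) ^ 2 = 1 := by
    exact_mod_cast Real.sin_sq_add_cos_sq (ω * a₃)
  set R₁ := sourceFlux (Real.sin (ω * a₁)) (Real.cos (ω * a₁)) (sourceSin a₁ a₂ a₃ ω U G (.e₁ k l))
    (sourceSin a₁ a₂ a₃ ω U G (.e₁ (k - 1) l)) (sourceCos a₁ a₂ a₃ ω U G (.e₁ (k - 1) l))
  set R₂ := sourceFlux (Real.sin (ω * a₂)) (Real.cos (ω * a₂)) (sourceSin a₁ a₂ a₃ ω U G (.e₂ k l))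
    (sourceSin a₁ a₂ a₃ ω U G (.e₂ k (l - 1))) (sourceCos a₁ a₂ a₃ ω U G (.e₂ k (l - 1)))
  set p := vertexValue U (k, l)
  set b' := Complex.exp (Complex.I * β)
  have g1 := eq_div_of_mul_eq c1 ((mul_comm _ _).trans f1)
  have g2 := eq_div_of_mul_eq c2 ((mul_comm _ _).trans f2)
  rw [Complex.ofReal_sub]
  linear_combination (-(Real.sin (ω * a₃) : ℂ)) * g1 - (Real.sin (ω * a₃) : ℂ) * g2
    + (Real.sin (ω * a₃) : ℂ) * hk
    - (vertexWeight μ k l : ℂ) * (1 - b' * (Real.cos (ω * a₃) : ℂ)) * f3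
    + (vertexWeight μ k l : ℂ) * (Real.sin (ω * a₃) : ℂ) * f4
    + (vertexWeight μ k l : ℂ) * ω * p * (Real.cos (ω * a₃) : ℂ) * hb
    - (vertexWeight μ k l : ℂ) * ω * p * hb2
    - (vertexWeight μ k l : ℂ) * ω * p * b' * hq

end VertexIdentities

end LimitGraph

/-! ### Bounds in `ℓ²` that are uniform over a family. -/

namespace Lattice

theorem exists_L2Z {f : ℤ × ℤ → ℂ} (h : Summable fun x => ‖f x‖ ^ 2) :
    ∃ v : L2Z ℂ, ∀ x, v x = f x :=
  ⟨⟨f, memℓp_two_iff.2 h⟩, fun _ => rfl⟩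

/-- A family of functions on the lattice is bounded in `ℓ²` by a multiple of `δ`. -/
def IsBoundedBy {ι : Type*} (δ : ι → ℝ) (q : ι → ℤ × ℤ → ℂ) : Prop :=
  ∃ K : ℝ, 0 ≤ K ∧ ∀ i, ∃ v : L2Z ℂ, (∀ x, v x = q i x) ∧ ‖v‖ ≤ K * δ i

variable {ι : Type*} {δ : ι → ℝ} {q q' q'' r : ι → ℤ × ℤ → ℂ}

theorem IsBoundedBy.add (h : IsBoundedBy δ q) (h' : IsBoundedBy δ q') :
    IsBoundedBy δ fun i x => q i x + q' i x := by
  obtain ⟨K, hK, h⟩ := h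
  obtain ⟨K', hK', h'⟩ := h'
  refine ⟨K + K', add_nonneg hK hK', fun i => ?_⟩
  obtain ⟨v, hv, hvn⟩ := h i
  obtain ⟨v', hv', hvn'⟩ := h' i
  refine ⟨v + v', fun x => ?_, (norm_add_le _ _).trans (by linarith)⟩
  change v x + v' x = q i x + q' i x
  rw [hv, hv']

theorem IsBoundedBy.const_mul (h : IsBoundedBy δ q) (c : ℂ) :
    IsBoundedBy δ fun i x => c * q i x := by
  obtain ⟨K, hK, h⟩ := h
  refine ⟨‖c‖ * K, by positivity, fun i => ?_⟩
  obtain ⟨v, hv, hvn⟩ := h i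
  refine ⟨c • v, fun x => ?_, ?_⟩
  · change c * v x = c * q i x
    rw [hv]
  · rw [norm_smul, mul_assoc]
    exact mul_le_mul_of_nonneg_left hvn (norm_nonneg _)

theorem IsBoundedBy.sub (h : IsBoundedBy δ q) (h' : IsBoundedBy δ q') :
    IsBoundedBy δ fun i x => q i x - q' i x := by
  simpa [sub_eq_add_neg] using h.add (h'.const_mul (-1))

theorem IsBoundedBy.congr (h : IsBoundedBy δ q) (hq : ∀ i x, r i x = q i x) :
    IsBoundedBy δ r := by
  have : r = q := funext fun i => funext fun x => hq i x
  rwa [this]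

theorem IsBoundedBy.shift (h : IsBoundedBy δ q) (d : ℤ × ℤ) :
    IsBoundedBy δ fun i x => q i (x + d) := by
  obtain ⟨K, hK, h⟩ := h
  refine ⟨K, hK, fun i => ?_⟩
  obtain ⟨v, hv, hvn⟩ := h i
  exact ⟨Lattice.shift ℂ d v, fun x => by rw [shift_apply, hv],
    by rwa [LinearIsometry.norm_map]⟩

theorem isBoundedBy_of_tsum_le (hδ : ∀ i, 0 ≤ δ i) {K : ℝ} (hK : 0 ≤ K)
    (h : ∀ i, ∃ f : ℤ × ℤ → ℝ, (∀ x, ‖q i x‖ ^ 2 ≤ f x) ∧ Summable f ∧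
      ∑' x, f x ≤ (K * δ i) ^ 2) : IsBoundedBy δ q := by
  refine ⟨K, hK, fun i => ?_⟩
  obtain ⟨f, hf, hs, ht⟩ := h i
  have hsq : Summable fun x => ‖q i x‖ ^ 2 := Summable.of_nonneg_of_le (fun x => sq_nonneg _) hf hs
  obtain ⟨v, hv⟩ := exists_L2Z hsq
  refine ⟨v, hv, (sq_le_sq₀ (norm_nonneg _) (mul_nonneg hK (hδ i))).1 (le_trans ?_ ht)⟩
  exact hasSum_le (fun x => by rw [hv]; exact hf x) (hasSum_sq v) hs.hasSum

theorem IsBoundedBy.of_sq_le (hδ : ∀ i, 0 ≤ δ i) (h : IsBoundedBy δ q) (h' : IsBoundedBy δ q')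
    (h'' : IsBoundedBy δ q'') {C : ℝ} (hC : 0 ≤ C)
    (hr : ∀ i x, ‖r i x‖ ^ 2 ≤ C * (‖q i x‖ ^ 2 + ‖q' i x‖ ^ 2 + ‖q'' i x‖ ^ 2)) :
    IsBoundedBy δ r := by
  obtain ⟨K, hK, h⟩ := h
  obtain ⟨K', hK', h'⟩ := h'
  obtain ⟨K'', hK'', h''⟩ := h''
  refine isBoundedBy_of_tsum_le hδ
    (K := Real.sqrt (C * (K ^ 2 + K' ^ 2 + K'' ^ 2))) (Real.sqrt_nonneg _) fun i => ?_
  obtain ⟨v, hv, hvn⟩ := h i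
  obtain ⟨v', hv', hvn'⟩ := h' i
  obtain ⟨v'', hv'', hvn''⟩ := h'' i
  have hs := ((((hasSum_sq v).add (hasSum_sq v')).add (hasSum_sq v'')).mul_left C)
  refine ⟨_, fun x => ?_, hs.summable, ?_⟩
  · rw [hv, hv', hv'']
    exact hr i x
  · rw [hs.tsum_eq, mul_pow, Real.sq_sqrt (by positivity), mul_assoc]
    refine mul_le_mul_of_nonneg_left ?_ hC
    have e := pow_le_pow_left₀ (norm_nonneg _) hvn 2
    have e' := pow_le_pow_left₀ (norm_nonneg _) hvn' 2
    have e'' := pow_le_pow_left₀ (norm_nonneg _) hvn'' 2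
    rw [mul_pow] at e e' e''
    linarith

theorem IsBoundedBy.bounded_mul (hδ : ∀ i, 0 ≤ δ i) (h : IsBoundedBy δ q) {w : ℤ × ℤ → ℂ} {C : ℝ}
    (hw : ∀ x, ‖w x‖ ≤ C) : IsBoundedBy δ fun i x => w x * q i x := by
  refine h.of_sq_le hδ h h (C := C ^ 2) (sq_nonneg _) fun i x => ?_
  rw [norm_mul, mul_pow]
  have := pow_le_pow_left₀ (norm_nonneg _) (hw x) 2
  nlinarith [mul_le_mul_of_nonneg_right this (sq_nonneg ‖q i x‖), sq_nonneg ‖q i x‖,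
    sq_nonneg C, mul_nonneg (sq_nonneg C) (sq_nonneg ‖q i x‖)]

end Lattice

/-! ### Traces and residual moments of a family of functions. -/

namespace LimitGraph

open Lattice

variable {a₁ a₂ a₃ β μ ω : ℝ}

section VertexValues

variable {U V G : Edge → ℝ → ℂ}

/-- The vertex values of an `H²` function are square summable. -/
theorem IsH2Graph.summable_vertexValue (ha₁ : 0 < a₁) (ha₂ : 0 < a₂) (ha₃ : 0 < a₃)
    (h : IsH2Graph a₁ a₂ a₃ U V G) : Summable fun x => ‖vertexValue U x‖ ^ 2 := by
  have hinj : Function.Injective fun x : ℤ × ℤ => Edge.ePlus x.1 x.2 := fun x y h => by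
    simpa [Prod.ext_iff] using h
  have s1 := h.sq.2.comp_injective hinj
  have s2 := h.sq_deriv.2.comp_injective hinj
  refine Summable.of_nonneg_of_le (fun x => sq_nonneg _) (fun x => ?_)
    (((s1.mul_left 2).add (s2.mul_left (2 * (a₃ / 2) ^ 2))).mul_left (a₃ / 2)⁻¹)
  have he := h.edge (.ePlus x.1 x.2)
  have hlt := (Edge.ePlus x.1 x.2).lo_lt_hi ha₁ ha₂ ha₃
  have hV : MemLp (V (.ePlus x.1 x.2)) 2
    (volume.restrict (Icc ((Edge.ePlus x.1 x.2).lo a₁ a₂ a₃) ((Edge.ePlus x.1 x.2).hi a₁ a₂ a₃))) :=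
    h.sq_deriv.1 _
  have := sq_norm_trace_le hlt he.cont hV he.eq_integral (left_mem_Icc.2 hlt.le)
  rw [show (Edge.ePlus x.1 x.2).hi a₁ a₂ a₃ - (Edge.ePlus x.1 x.2).lo a₁ a₂ a₃ = a₃ / 2 from
    Edge.length_ePlus _ _] at this
  rw [le_inv_mul_iff₀ (by positivity)]
  exact this

end VertexValues

/-- `1 - e^{iβ} cos (ω a₃)` does not vanish unless `sin (ω a₃) = 0` and `cos (ω a₃) = cos β`. -/
theorem one_sub_exp_mul_cos_ne_zero
    (h : Real.sin (ω * a₃) ≠ 0 ∨ Real.cos (ω * a₃) - Real.cos β ≠ 0) :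
    1 - Complex.exp (Complex.I * β) * (Real.cos (ω * a₃) : ℂ) ≠ 0 := by
  intro h0
  have hn : ‖Complex.exp (Complex.I * β)‖ = 1 := by
    rw [mul_comm]; exact Complex.norm_exp_ofReal_mul_I β
  have h1 : Complex.exp (Complex.I * β) * (Real.cos (ω * a₃) : ℂ) = 1 := (sub_eq_zero.1 h0).symm
  have h2 := congrArg norm h1
  rw [norm_mul, hn, one_mul, Complex.norm_real, Real.norm_eq_abs, norm_one] at h2
  have h3 : Real.cos (ω * a₃) ^ 2 = 1 := by rw [← sq_abs, h2, one_pow]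
  have h4 := Real.sin_sq_add_cos_sq (ω * a₃)
  have h5 : Real.sin (ω * a₃) = 0 := by
    have : Real.sin (ω * a₃) ^ 2 = 0 := by linarith
    exact (pow_eq_zero_iff two_ne_zero).1 this
  refine (h.resolve_left (fun hs => hs h5)) ?_
  have h6 := congrArg Complex.re h1
  rw [Complex.re_mul_ofReal, Complex.one_re, mul_comm Complex.I, Complex.exp_ofReal_mul_I_re] at h6
  have h7 : Real.cos (ω * a₃) = Real.cos (ω * a₃) * (Real.cos β * Real.cos (ω * a₃)) := by
    rw [h6, mul_one]
  linear_combination h7 + Real.cos β * h3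

section Family

variable {ι : Type*} {U V G : ι → Edge → ℝ → ℂ} {δ : ι → ℝ}

/-- A family of functions of `H²(𝒢)` whose residual `u'' + ω² u` has norm at most `δ`. -/
structure ResidualBound (a₁ a₂ a₃ ω : ℝ) (U V G : ι → Edge → ℝ → ℂ) (δ : ι → ℝ) : Prop where
  h2 : ∀ i, IsH2Graph a₁ a₂ a₃ (U i) (V i) (G i)
  nonneg : ∀ i, 0 ≤ δ i
  summable : ∀ i, Summable (residualSq a₁ a₂ a₃ ω (U i) (G i))
  tsum_le : ∀ i, ∑' e, residualSq a₁ a₂ a₃ ω (U i) (G i) e ≤ δ i ^ 2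

/-- Injectivity of `f` means that each edge is counted at most once, so the sum over the lattice is
dominated by the total residual. -/
theorem isBoundedBy_of_le_residualSq {q : ι → ℤ × ℤ → ℂ} (h : ResidualBound a₁ a₂ a₃ ω U V G δ)
    {f : ℤ × ℤ → Edge} (hf : Function.Injective f) {C : ℝ} (hC : 0 ≤ C)
    (hq : ∀ i x, ‖q i x‖ ^ 2 ≤ C * residualSq a₁ a₂ a₃ ω (U i) (G i) (f x)) :
    IsBoundedBy δ q := by
  refine isBoundedBy_of_tsum_le h.nonneg (Real.sqrt_nonneg C) fun i => ⟨_, hq i,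
    ((h.summable i).comp_injective hf).mul_left C, ?_⟩
  rw [tsum_mul_left, mul_pow, Real.sq_sqrt hC]
  refine mul_le_mul_of_nonneg_left (le_trans ?_ (h.tsum_le i)) hC
  exact Summable.tsum_le_tsum_of_inj f hf (fun e _ => residualSq_nonneg _ _ e) (fun x => le_rfl)
    ((h.summable i).comp_injective hf) (h.summable i)

theorem isBoundedBy_sourceSin (ha₁ : 0 < a₁) (ha₂ : 0 < a₂) (ha₃ : 0 < a₃)
    (h : ResidualBound a₁ a₂ a₃ ω U V G δ)
    {f : ℤ × ℤ → Edge} (hf : Function.Injective f) :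
    IsBoundedBy δ fun i x => sourceSin a₁ a₂ a₃ ω (U i) (G i) (f x) := by
  refine isBoundedBy_of_le_residualSq h hf (C := a₁ + a₂ + a₃) (by positivity)
    fun i x => ?_
  have hlt := (f x).lo_lt_hi ha₁ ha₂ ha₃
  refine (((h.h2 i).edge (f x)).sq_norm_source_le (ω := ω) hlt (right_mem_Icc.2 hlt.le)
    (φ := fun t => Real.sin (ω * ((f x).hi a₁ a₂ a₃ - t))) (by fun_prop)
    fun t => Real.abs_sin_le_one _).trans ?_
  exact mul_le_mul_of_nonneg_right ((f x).length_le ha₁ ha₂ ha₃) (residualSq_nonneg _ _ _)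

theorem isBoundedBy_sourceCos (ha₁ : 0 < a₁) (ha₂ : 0 < a₂) (ha₃ : 0 < a₃)
    (h : ResidualBound a₁ a₂ a₃ ω U V G δ)
    {f : ℤ × ℤ → Edge} (hf : Function.Injective f) :
    IsBoundedBy δ fun i x => sourceCos a₁ a₂ a₃ ω (U i) (G i) (f x) := by
  refine isBoundedBy_of_le_residualSq h hf (C := a₁ + a₂ + a₃) (by positivity)
    fun i x => ?_
  have hlt := (f x).lo_lt_hi ha₁ ha₂ ha₃
  refine (((h.h2 i).edge (f x)).sq_norm_source_le (ω := ω) hlt (right_mem_Icc.2 hlt.le)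
    (φ := fun t => Real.cos (ω * ((f x).hi a₁ a₂ a₃ - t))) (by fun_prop)
    fun t => Real.abs_cos_le_one _).trans ?_
  exact mul_le_mul_of_nonneg_right ((f x).length_le ha₁ ha₂ ha₃) (residualSq_nonneg _ _ _)

/-- The `L²` norms on a family of edges are controlled by the initial values and the residual. -/
theorem isBoundedBy_mass (ha₁ : 0 < a₁) (ha₂ : 0 < a₂) (ha₃ : 0 < a₃) (hω : ω ≠ 0)
    (h : ResidualBound a₁ a₂ a₃ ω U V G δ)
    {f : ℤ × ℤ → Edge} (hf : Function.Injective f)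
    (hU : IsBoundedBy δ fun i x => U i (f x) ((f x).lo a₁ a₂ a₃))
    (hV : IsBoundedBy δ fun i x => V i (f x) ((f x).lo a₁ a₂ a₃)) :
    IsBoundedBy δ fun i x =>
      ((Real.sqrt (∫ t, ‖U i (f x) t‖ ^ 2 ∂(edgeVolume a₁ a₂ a₃ (f x))) : ℝ) : ℂ) := by
  have hsq : ∀ m : ℝ, 0 ≤ m → ‖((Real.sqrt m : ℝ) : ℂ)‖ ^ 2 = m := fun m hm => by
    rw [Complex.norm_real, Real.norm_eq_abs, sq_abs, Real.sq_sqrt hm]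
  have hr : IsBoundedBy δ fun i x =>
      ((Real.sqrt (residualSq a₁ a₂ a₃ ω (U i) (G i) (f x)) : ℝ) : ℂ) :=
    isBoundedBy_of_le_residualSq h hf zero_le_one fun i x => by
      rw [hsq _ (residualSq_nonneg _ _ _), one_mul]
  set L := a₁ + a₂ + a₃ with hL
  have hL0 : 0 < L := by positivity
  have hω2 : 0 < ω ^ 2 := by positivity
  refine hU.of_sq_le h.nonneg hV hr (C := 3 * L * (ω ^ 2 + 1 + L) / ω ^ 2) (by positivity)
    fun i x => ?_
  rw [hsq _ (integral_nonneg fun t => by positivity), hsq _ (residualSq_nonneg _ _ _),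
    div_mul_eq_mul_div, le_div_iff₀ hω2, mul_comm]
  have hlt := (f x).lo_lt_hi ha₁ ha₂ ha₃
  have hle := (f x).length_le ha₁ ha₂ ha₃
  refine (((h.h2 i).edge (f x)).integral_sq_norm_le (ω := ω) hlt).trans ?_
  change _ * (_ + (_ - _) * residualSq a₁ a₂ a₃ ω (U i) (G i) (f x)) ≤ _
  have hr0 := residualSq_nonneg (a₁ := a₁) (a₂ := a₂) (a₃ := a₃) (ω := ω) (U i) (G i) (f x)
  set u2 := ‖U i (f x) ((f x).lo a₁ a₂ a₃)‖ ^ 2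
  set v2 := ‖V i (f x) ((f x).lo a₁ a₂ a₃)‖ ^ 2
  set r2 := residualSq a₁ a₂ a₃ ω (U i) (G i) (f x)
  set ℓ := (f x).hi a₁ a₂ a₃ - (f x).lo a₁ a₂ a₃
  have hu0 : 0 ≤ u2 := sq_nonneg _
  have hv0 : 0 ≤ v2 := sq_nonneg _
  have hℓ0 : 0 ≤ ℓ := (sub_pos.2 hlt).le
  have k1 : ω ^ 2 * u2 + v2 + ℓ * r2 ≤ (ω ^ 2 + 1 + L) * (u2 + v2 + r2) := by
    have := mul_le_mul_of_nonneg_right hle hr0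
    nlinarith [mul_nonneg hω2.le hv0, mul_nonneg hω2.le hr0, mul_nonneg hL0.le hu0,
      mul_nonneg hL0.le hv0]
  calc 3 * ℓ * (ω ^ 2 * u2 + v2 + ℓ * r2)
      ≤ 3 * L * ((ω ^ 2 + 1 + L) * (u2 + v2 + r2)) :=
        mul_le_mul (by linarith) k1 (by positivity) (by positivity)
    _ = _ := by ring

theorem injective_e₁ : Function.Injective fun x : ℤ × ℤ => Edge.e₁ x.1 x.2 := fun x y h => by
  simpa [Prod.ext_iff] using h

theorem injective_e₂ : Function.Injective fun x : ℤ × ℤ => Edge.e₂ x.1 x.2 := fun x y h => by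
  simpa [Prod.ext_iff] using h

theorem injective_ePlus : Function.Injective fun x : ℤ × ℤ => Edge.ePlus x.1 x.2 :=
  fun x y h => by simpa [Prod.ext_iff] using h

theorem injective_eMinus : Function.Injective fun x : ℤ × ℤ => Edge.eMinus x.1 x.2 :=
  fun x y h => by simpa [Prod.ext_iff] using h

theorem injective_e₁_left : Function.Injective fun x : ℤ × ℤ => Edge.e₁ (x.1 - 1) x.2 :=
  fun x y h => by simpa [Prod.ext_iff] using h

theorem injective_e₂_left : Function.Injective fun x : ℤ × ℤ => Edge.e₂ x.1 (x.2 - 1) :=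
  fun x y h => by simpa [Prod.ext_iff] using h

theorem isBoundedBy_sourceFlux_e₁ (ha₁ : 0 < a₁) (ha₂ : 0 < a₂) (ha₃ : 0 < a₃)
    (h : ResidualBound a₁ a₂ a₃ ω U V G δ) (s c : ℂ) : IsBoundedBy δ fun i x =>
    sourceFlux s c (sourceSin a₁ a₂ a₃ ω (U i) (G i) (.e₁ x.1 x.2))
      (sourceSin a₁ a₂ a₃ ω (U i) (G i) (.e₁ (x.1 - 1) x.2))
      (sourceCos a₁ a₂ a₃ ω (U i) (G i) (.e₁ (x.1 - 1) x.2)) :=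
  ((isBoundedBy_sourceSin ha₁ ha₂ ha₃ h injective_e₁).sub
    ((isBoundedBy_sourceSin ha₁ ha₂ ha₃ h injective_e₁_left).const_mul c)).add
    ((isBoundedBy_sourceCos ha₁ ha₂ ha₃ h injective_e₁_left).const_mul s)

theorem isBoundedBy_sourceFlux_e₂ (ha₁ : 0 < a₁) (ha₂ : 0 < a₂) (ha₃ : 0 < a₃)
    (h : ResidualBound a₁ a₂ a₃ ω U V G δ) (s c : ℂ) : IsBoundedBy δ fun i x =>
    sourceFlux s c (sourceSin a₁ a₂ a₃ ω (U i) (G i) (.e₂ x.1 x.2))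
      (sourceSin a₁ a₂ a₃ ω (U i) (G i) (.e₂ x.1 (x.2 - 1)))
      (sourceCos a₁ a₂ a₃ ω (U i) (G i) (.e₂ x.1 (x.2 - 1))) :=
  ((isBoundedBy_sourceSin ha₁ ha₂ ha₃ h injective_e₂).sub
    ((isBoundedBy_sourceSin ha₁ ha₂ ha₃ h injective_e₂_left).const_mul c)).add
    ((isBoundedBy_sourceCos ha₁ ha₂ ha₃ h injective_e₂_left).const_mul s)

theorem isBoundedBy_sourceUp (ha₁ : 0 < a₁) (ha₂ : 0 < a₂) (ha₃ : 0 < a₃)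
    (h : ResidualBound a₁ a₂ a₃ ω U V G δ) :
    IsBoundedBy δ fun i x => sourceUp a₁ a₂ a₃ β ω (U i) (G i) x :=
  (((isBoundedBy_sourceSin ha₁ ha₂ ha₃ h injective_ePlus).const_mul _).add
    ((isBoundedBy_sourceCos ha₁ ha₂ ha₃ h injective_ePlus).const_mul _)).add
    ((isBoundedBy_sourceSin ha₁ ha₂ ha₃ h injective_eMinus).const_mul _)

theorem isBoundedBy_sourceDown (ha₁ : 0 < a₁) (ha₂ : 0 < a₂) (ha₃ : 0 < a₃)
    (h : ResidualBound a₁ a₂ a₃ ω U V G δ) :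
    IsBoundedBy δ fun i x => sourceDown a₁ a₂ a₃ β ω (U i) (G i) x :=
  ((((isBoundedBy_sourceCos ha₁ ha₂ ha₃ h injective_ePlus).const_mul _).sub
    ((isBoundedBy_sourceSin ha₁ ha₂ ha₃ h injective_ePlus).const_mul _)).const_mul
      _).add (isBoundedBy_sourceCos ha₁ ha₂ ha₃ h injective_eMinus)

end Family

end LimitGraph

/-! ### The a priori estimate outside the bands. -/

namespace LimitGraph

open Lattice

variable {a₁ a₂ a₃ β μ ω : ℝ} {ι : Type*} {U V G : ι → Edge → ℝ → ℂ} {δ : ι → ℝ}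

theorem vertexWeight_pos (hμ : 0 < μ) (k l : ℤ) : 0 < vertexWeight μ k l := by
  unfold vertexWeight
  split_ifs
  exacts [hμ, one_pos]

/-- Outside the bands the vertex values are controlled by the residual. -/
theorem ResidualBound.isBoundedBy_vertexValue (ha₁ : 0 < a₁) (ha₂ : 0 < a₂) (ha₃ : 0 < a₃)
    (hω : ω ≠ 0) (h : ResidualBound a₁ a₂ a₃ ω U V G δ)
    (hd : ∀ i, IsInDomain a₁ a₂ a₃ β 1 (U i) (V i) (G i)) (h1 : Real.sin (ω * a₁) ≠ 0)
    (h2 : Real.sin (ω * a₂) ≠ 0)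
    (hband : |Real.sin (ω * a₃)| * bandRadius a₁ a₂ ω
      < |Real.cos (ω * a₃) - Real.cos β + Real.sin (ω * a₃) * bandCenter a₁ a₂ ω|) :
    IsBoundedBy δ fun i => vertexValue (U i) := by
  set s₃ := Real.sin (ω * a₃) with hs₃
  set D := Real.cos (ω * a₃) - Real.cos β with hD
  set E := D + s₃ * bandCenter a₁ a₂ ω with hE
  have hrhs := ((((isBoundedBy_sourceFlux_e₁ ha₁ ha₂ ha₃ h (Real.sin (ω * a₁) : ℝ)
      (Real.cos (ω * a₁) : ℝ)).const_mul ((Real.sin (ω * a₁) : ℝ) : ℂ)⁻¹).add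
    ((isBoundedBy_sourceFlux_e₂ ha₁ ha₂ ha₃ h (Real.sin (ω * a₂) : ℝ)
      (Real.cos (ω * a₂) : ℝ)).const_mul ((Real.sin (ω * a₂) : ℝ) : ℂ)⁻¹)).const_mul (s₃ : ℂ)).add
    (((isBoundedBy_sourceUp (β := β) ha₁ ha₂ ha₃ h).const_mul
      (1 - Complex.exp (Complex.I * β) * (Real.cos (ω * a₃) : ℝ))).add
    ((isBoundedBy_sourceDown (β := β) ha₁ ha₂ ha₃ h).const_mul (s₃ : ℂ)))
  obtain ⟨K, hK, hr⟩ := hrhs.const_mul ((ω : ℂ)⁻¹)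
  have hgap : 0 < 2 * (|E| - |s₃| * bandRadius a₁ a₂ ω) := by linarith
  refine ⟨(2 * (|E| - |s₃| * bandRadius a₁ a₂ ω))⁻¹ * K, by positivity, fun i => ?_⟩
  obtain ⟨p, hp⟩ := exists_L2Z ((h.h2 i).summable_vertexValue ha₁ ha₂ ha₃)
  obtain ⟨v, hv, hvn⟩ := hr i
  refine ⟨p, hp, ?_⟩
  rw [mul_assoc, le_inv_mul_iff₀ hgap]
  refine le_trans ?_ hvn
  have hω' : (ω : ℂ) ≠ 0 := by exact_mod_cast hω
  -- After multiplication by `sin (ω a₃)` the hopping part has norm at most `2 |s₃| R`, strictly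
  -- less than the diagonal part `2 |E|`. The vertex values are then bounded by the source.
  have heq : hop ℂ (s₃ / Real.sin (ω * a₁)) (s₃ / Real.sin (ω * a₂)) p
      - ((2 * E : ℝ) : ℂ) • p = v := by
    refine lp.ext (funext fun x => ?_)
    obtain ⟨k, l⟩ := x
    have hveq := (hd i).vertex_equation (ω := ω) ha₁ ha₂ ha₃ h1 h2 k l
    change hop ℂ (s₃ / Real.sin (ω * a₁)) (s₃ / Real.sin (ω * a₂)) p (k, l)
      - ((2 * E : ℝ) : ℂ) * p (k, l) = v (k, l)
    rw [hop_apply, hv, hp, hp, hp, hp, hp, eq_inv_mul_iff_mul_eq₀ hω']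
    have hw : vertexWeight 1 k l = 1 := by simp [vertexWeight]
    rw [hw, Complex.ofReal_one, mul_one, one_mul, ← hs₃, ← hD] at hveq
    simp only [hE, bandCenter]
    rw [div_eq_inv_mul (sourceFlux _ _ _ _ _), div_eq_inv_mul (sourceFlux _ _ _ _ _)] at hveq
    rw [← hveq]
    simp only [Complex.coe_algebraMap, Complex.ofReal_div, Complex.ofReal_mul,
      Complex.ofReal_add, Complex.ofReal_ofNat]
    ring
  rw [← heq]
  have n1 := norm_hop_le (𝕜 := ℂ) (s₃ / Real.sin (ω * a₁)) (s₃ / Real.sin (ω * a₂)) p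
  have n2 : ‖((2 * E : ℝ) : ℂ) • p‖ = 2 * |E| * ‖p‖ := by
    rw [norm_smul, Complex.norm_real, norm_mul, Real.norm_ofNat, Real.norm_eq_abs]
  have n3 := norm_sub_norm_le (((2 * E : ℝ) : ℂ) • p)
    (hop ℂ (s₃ / Real.sin (ω * a₁)) (s₃ / Real.sin (ω * a₂)) p)
  rw [norm_sub_rev, n2] at n3
  have n4 : (2 * |s₃ / Real.sin (ω * a₁)| + 2 * |s₃ / Real.sin (ω * a₂)|)
      = 2 * (|s₃| * bandRadius a₁ a₂ ω) := by
    rw [bandRadius, abs_div, abs_div]; ring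
  rw [n4] at n1
  linarith

/-- Control of a function by its vertex values and its residual. -/
theorem ResidualBound.tsum_mass_le (ha₁ : 0 < a₁) (ha₂ : 0 < a₂) (ha₃ : 0 < a₃) (hμ : 0 < μ)
    (hω : ω ≠ 0) (h : ResidualBound a₁ a₂ a₃ ω U V G δ)
    (hd : ∀ i, IsInDomain a₁ a₂ a₃ β μ (U i) (V i) (G i)) (h1 : Real.sin (ω * a₁) ≠ 0)
    (h2 : Real.sin (ω * a₂) ≠ 0)
    (h3 : Real.sin (ω * a₃) ≠ 0 ∨ Real.cos (ω * a₃) - Real.cos β ≠ 0)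
    (hp : IsBoundedBy δ fun i => vertexValue (U i)) :
    ∃ K : ℝ, 0 ≤ K ∧ ∀ i, ∑' e, ∫ t, ‖U i e t‖ ^ 2 ∂(edgeVolume a₁ a₂ a₃ e) ≤ (K * δ i) ^ 2 := by
  have c1 : ((Real.sin (ω * a₁) : ℝ) : ℂ) ≠ 0 := by exact_mod_cast h1
  have c2 : ((Real.sin (ω * a₂) : ℝ) : ℂ) ≠ 0 := by exact_mod_cast h2
  have c3 := one_sub_exp_mul_cos_ne_zero h3
  have hω' : (ω : ℂ) ≠ 0 := by exact_mod_cast hω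
  have hb := exp_neg_mul_exp β
  have p10 : ∀ x : ℤ × ℤ, x + (1, 0) = (x.1 + 1, x.2) := fun x => by ext <;> simp
  have p01 : ∀ x : ℤ × ℤ, x + (0, 1) = (x.1, x.2 + 1) := fun x => by ext <;> simp
  have m10 : ∀ x : ℤ × ℤ, x + (-1, 0) = (x.1 - 1, x.2) := fun x => by ext <;> simp [sub_eq_add_neg]
  have m01 : ∀ x : ℤ × ℤ, x + (0, -1) = (x.1, x.2 - 1) := fun x => by ext <;> simp [sub_eq_add_neg]
  have src : ∀ {f : ℤ × ℤ → Edge}, Function.Injective f →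
      IsBoundedBy δ fun i x => sourceSin a₁ a₂ a₃ ω (U i) (G i) (f x) :=
    fun hf => isBoundedBy_sourceSin ha₁ ha₂ ha₃ h hf
  have srcc : ∀ {f : ℤ × ℤ → Edge}, Function.Injective f →
      IsBoundedBy δ fun i x => sourceCos a₁ a₂ a₃ ω (U i) (G i) (f x) :=
    fun hf => isBoundedBy_sourceCos ha₁ ha₂ ha₃ h hf
  have hV1 : IsBoundedBy δ fun i x => V i (.e₁ x.1 x.2) (x.1 * a₁) := by
    refine ((((hp.shift (1, 0)).sub (hp.const_mul (Real.cos (ω * a₁) : ℝ))).const_mul (ω : ℂ)).sub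
      (src injective_e₁)).const_mul ((Real.sin (ω * a₁) : ℝ) : ℂ)⁻¹ |>.congr fun i x => ?_
    rw [eq_inv_mul_iff_mul_eq₀ c1, p10]
    exact (h.h2 i).sin_mul_deriv_e₁ ha₁ ha₂ ha₃ ω x.1 x.2
  have hV2 : IsBoundedBy δ fun i x => V i (.e₂ x.1 x.2) (x.2 * a₂) := by
    refine ((((hp.shift (0, 1)).sub (hp.const_mul (Real.cos (ω * a₂) : ℝ))).const_mul (ω : ℂ)).sub
      (src injective_e₂)).const_mul ((Real.sin (ω * a₂) : ℝ) : ℂ)⁻¹ |>.congr fun i x => ?_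
    rw [eq_inv_mul_iff_mul_eq₀ c2, p01]
    exact (h.h2 i).sin_mul_deriv_e₂ ha₁ ha₂ ha₃ ω x.1 x.2
  have hF1 : IsBoundedBy δ fun i x =>
      V i (.e₁ x.1 x.2) (x.1 * a₁) - V i (.e₁ (x.1 - 1) x.2) (x.1 * a₁) := by
    refine (((((hp.shift (1, 0)).add (hp.shift (-1, 0))).sub
      (hp.const_mul (2 * (Real.cos (ω * a₁) : ℝ)))).const_mul (ω : ℂ)).sub
      (isBoundedBy_sourceFlux_e₁ ha₁ ha₂ ha₃ h (Real.sin (ω * a₁) : ℝ)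
      (Real.cos (ω * a₁) : ℝ))).const_mul ((Real.sin (ω * a₁) : ℝ) : ℂ)⁻¹ |>.congr fun i x => ?_
    rw [eq_inv_mul_iff_mul_eq₀ c1, p10, m10]
    exact (h.h2 i).flux_e₁ ha₁ ha₂ ha₃ ω x.1 x.2
  have hF2 : IsBoundedBy δ fun i x =>
      V i (.e₂ x.1 x.2) (x.2 * a₂) - V i (.e₂ x.1 (x.2 - 1)) (x.2 * a₂) := by
    refine (((((hp.shift (0, 1)).add (hp.shift (0, -1))).sub
      (hp.const_mul (2 * (Real.cos (ω * a₂) : ℝ)))).const_mul (ω : ℂ)).sub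
      (isBoundedBy_sourceFlux_e₂ ha₁ ha₂ ha₃ h (Real.sin (ω * a₂) : ℝ)
      (Real.cos (ω * a₂) : ℝ))).const_mul ((Real.sin (ω * a₂) : ℝ) : ℂ)⁻¹ |>.congr fun i x => ?_
    rw [eq_inv_mul_iff_mul_eq₀ c2, p01, m01]
    exact (h.h2 i).flux_e₂ ha₁ ha₂ ha₃ ω x.1 x.2
  -- The Kirchhoff condition gives the jump of the vertical derivative from the horizontal fluxes;
  -- the weights are bounded away from zero.
  have hVj : IsBoundedBy δ fun i x => V i (.ePlus x.1 x.2) 0 - V i (.eMinus x.1 x.2) 0 := by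
    have hw : ∀ x : ℤ × ℤ, ‖(-((vertexWeight μ x.1 x.2 : ℝ) : ℂ)⁻¹)‖ ≤ max μ⁻¹ 1 := fun x => by
      rw [norm_neg, norm_inv, Complex.norm_real, Real.norm_of_nonneg (vertexWeight_pos hμ _ _).le]
      unfold vertexWeight
      split_ifs
      · exact le_max_left _ _
      · rw [inv_one]; exact le_max_right _ _
    refine ((hF1.add hF2).bounded_mul h.nonneg hw).congr fun i x => ?_
    have hwn : ((vertexWeight μ x.1 x.2 : ℝ) : ℂ) ≠ 0 := by
      exact_mod_cast (vertexWeight_pos hμ _ _).ne'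
    rw [neg_mul, eq_neg_iff_add_eq_zero, ← mul_right_inj' hwn, mul_add, mul_inv_cancel_left₀ hwn,
      mul_zero]
    linear_combination (hd i).kirchhoff x.1 x.2
  -- Combining the jump with the transport formula isolates `V (0+)` with coefficient `1 - e^{iβ}
  -- cos (ω a₃)`. This is invertible under `h3`, even at zeros of `sin (ω a₃)`.
  have hVp : IsBoundedBy δ fun i x => V i (.ePlus x.1 x.2) 0 := by
    refine ((hVj.add (isBoundedBy_sourceDown (β := β) ha₁ ha₂ ha₃ h)).sub
      (hp.const_mul (Complex.exp (Complex.I * β) * ω * (Real.sin (ω * a₃) : ℝ)))).const_mul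
      (1 - Complex.exp (Complex.I * β) * (Real.cos (ω * a₃) : ℂ))⁻¹ |>.congr fun i x => ?_
    rw [eq_inv_mul_iff_mul_eq₀ c3]
    linear_combination ((hd i).vertical ha₁ ha₂ ha₃ ω x.1 x.2).2
  have hUm : IsBoundedBy δ fun i x => U i (.eMinus x.1 x.2) (-(a₃ / 2)) := by
    refine (((hp.const_mul (ω * (Real.cos (ω * (a₃ / 2)) : ℝ))).add
      (hVp.const_mul (Real.sin (ω * (a₃ / 2)) : ℝ))).add (src injective_ePlus)).const_mul
      (Complex.exp (Complex.I * β) * (ω : ℂ)⁻¹) |>.congr fun i x => ?_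
    have e1 := (h.h2 i).value_hi ha₁ ha₂ ha₃ ω (.ePlus x.1 x.2)
    rw [Edge.length_ePlus] at e1
    simp only [Edge.lo, Edge.hi] at e1
    have e2 := (hd i).quasiPer x.1 x.2
    have e3 : (ω : ℂ)⁻¹ * ω = 1 := inv_mul_cancel₀ hω'
    change U i (.eMinus x.1 x.2) (-(a₃ / 2)) = Complex.exp (Complex.I * β) * (ω : ℂ)⁻¹ *
      (ω * (Real.cos (ω * (a₃ / 2)) : ℝ) * U i (.ePlus x.1 x.2) 0
        + (Real.sin (ω * (a₃ / 2)) : ℝ) * V i (.ePlus x.1 x.2) 0 + _)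
    rw [← e1, e2]
    linear_combination (-U i (.eMinus x.1 x.2) (-(a₃ / 2))) * hb
      - Complex.exp (Complex.I * β) * Complex.exp (-(Complex.I * β))
        * U i (.eMinus x.1 x.2) (-(a₃ / 2)) * e3
  have hVm : IsBoundedBy δ fun i x => V i (.eMinus x.1 x.2) (-(a₃ / 2)) := by
    refine (((hVp.const_mul (Real.cos (ω * (a₃ / 2)) : ℝ)).sub
      (hp.const_mul (ω * (Real.sin (ω * (a₃ / 2)) : ℝ)))).add (srcc injective_ePlus)).const_mul
      (Complex.exp (Complex.I * β)) |>.congr fun i x => ?_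
    have e1 := (h.h2 i).deriv_hi ha₁ ha₂ ha₃ ω (.ePlus x.1 x.2)
    rw [Edge.length_ePlus] at e1
    simp only [Edge.lo, Edge.hi] at e1
    have e2 := (hd i).quasiPer_deriv x.1 x.2
    change V i (.eMinus x.1 x.2) (-(a₃ / 2)) = Complex.exp (Complex.I * β) *
      ((Real.cos (ω * (a₃ / 2)) : ℝ) * V i (.ePlus x.1 x.2) 0
        - ω * (Real.sin (ω * (a₃ / 2)) : ℝ) * U i (.ePlus x.1 x.2) 0 + _)
    rw [← e1, e2]
    linear_combination (-V i (.eMinus x.1 x.2) (-(a₃ / 2))) * hb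
  obtain ⟨K₁, hK₁, m₁⟩ := isBoundedBy_mass ha₁ ha₂ ha₃ hω h injective_e₁
    (hp.congr fun i x => (h.h2 i).e₁_lo x.1 x.2) hV1
  obtain ⟨K₂, hK₂, m₂⟩ := isBoundedBy_mass ha₁ ha₂ ha₃ hω h injective_e₂
    (hp.congr fun i x => (h.h2 i).e₂_lo x.1 x.2) hV2
  obtain ⟨K₃, hK₃, m₃⟩ := isBoundedBy_mass ha₁ ha₂ ha₃ hω h injective_ePlus
    (hp.congr fun i x => rfl) hVp
  obtain ⟨K₄, hK₄, m₄⟩ := isBoundedBy_mass ha₁ ha₂ ha₃ hω h injective_eMinus hUm hVm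
  refine ⟨Real.sqrt (K₁ ^ 2 + K₂ ^ 2 + K₃ ^ 2 + K₄ ^ 2), Real.sqrt_nonneg _, fun i => ?_⟩
  have hfam : ∀ {f : ℤ × ℤ → Edge} {K : ℝ} {v : L2Z ℂ}, (∀ x, v x
      = ((Real.sqrt (∫ t, ‖U i (f x) t‖ ^ 2 ∂(edgeVolume a₁ a₂ a₃ (f x))) : ℝ) : ℂ)) →
      ‖v‖ ≤ K * δ i → ∃ S ≤ (K * δ i) ^ 2,
        HasSum (fun x => ∫ t, ‖U i (f x) t‖ ^ 2 ∂(edgeVolume a₁ a₂ a₃ (f x))) S := by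
    intro f K v hv hvn
    refine ⟨‖v‖ ^ 2, pow_le_pow_left₀ (norm_nonneg _) hvn 2, ?_⟩
    refine (hasSum_sq v).congr_fun fun x => ?_
    rw [hv, Complex.norm_real, Real.norm_eq_abs, sq_abs,
      Real.sq_sqrt (integral_nonneg fun t => by positivity)]
  obtain ⟨v₁, hv₁, hn₁⟩ := m₁ i
  obtain ⟨v₂, hv₂, hn₂⟩ := m₂ i
  obtain ⟨v₃, hv₃, hn₃⟩ := m₃ i
  obtain ⟨v₄, hv₄, hn₄⟩ := m₄ i
  obtain ⟨S₁, hS₁, t₁⟩ := hfam hv₁ hn₁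
  obtain ⟨S₂, hS₂, t₂⟩ := hfam hv₂ hn₂
  obtain ⟨S₃, hS₃, t₃⟩ := hfam hv₃ hn₃
  obtain ⟨S₄, hS₄, t₄⟩ := hfam hv₄ hn₄
  rw [(hasSum_edge (f := fun e => ∫ t, ‖U i e t‖ ^ 2 ∂(edgeVolume a₁ a₂ a₃ e)) t₁ t₂ t₃ t₄).tsum_eq,
    mul_pow, Real.sq_sqrt (by positivity)]
  rw [mul_pow] at hS₁ hS₂ hS₃ hS₄
  linarith

section Operator

theorem norm_sq_le_of_tsum_le (hμ : 0 < μ) {u : L2G a₁ a₂ a₃ μ} {W : Edge → ℝ → ℂ}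
    (hu : ∀ e, (u e : ℝ → ℂ) =ᵐ[edgeMeasure a₁ a₂ a₃ μ e] W e) (hW : SqIntegrable a₁ a₂ a₃ W) :
    ‖u‖ ^ 2 ≤ max μ 1 * ∑' e, ∫ x, ‖W e x‖ ^ 2 ∂(edgeVolume a₁ a₂ a₃ e) :=
  hasSum_le (fun e => mul_le_mul_of_nonneg_right e.weight_le (integral_nonneg fun x => by positivity))
    (hasSum_norm_sq hμ u hu) (hW.2.hasSum.mul_left _)

theorem tsum_le_of_norm_sq (hμ : 0 < μ) {u : L2G a₁ a₂ a₃ μ} {W : Edge → ℝ → ℂ}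
    (hu : ∀ e, (u e : ℝ → ℂ) =ᵐ[edgeMeasure a₁ a₂ a₃ μ e] W e) (hW : SqIntegrable a₁ a₂ a₃ W) :
    min μ 1 * ∑' e, ∫ x, ‖W e x‖ ^ 2 ∂(edgeVolume a₁ a₂ a₃ e) ≤ ‖u‖ ^ 2 :=
  hasSum_le (fun e => mul_le_mul_of_nonneg_right e.min_le_weight
    (integral_nonneg fun x => by positivity)) (hW.2.hasSum.mul_left _) (hasSum_norm_sq hμ u hu)

/-- Outside the bands `T - ω²` is bounded below. -/
theorem exists_norm_le (ha₁ : 0 < a₁) (ha₂ : 0 < a₂) (ha₃ : 0 < a₃)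
    (hω : ω ≠ 0) (h1 : Real.sin (ω * a₁) ≠ 0) (h2 : Real.sin (ω * a₂) ≠ 0)
    (hband : |Real.sin (ω * a₃)| * bandRadius a₁ a₂ ω
      < |Real.cos (ω * a₃) - Real.cos β + Real.sin (ω * a₃) * bandCenter a₁ a₂ ω|) :
    ∃ K : ℝ, ∀ u : (limitOp a₁ a₂ a₃ β 1).domain, ‖(u : L2G a₁ a₂ a₃ 1)‖
      ≤ K * ‖limitOp a₁ a₂ a₃ β 1 u - ((ω ^ 2 : ℝ) : ℂ) • (u : L2G a₁ a₂ a₃ 1)‖ := by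
  choose U V G hd hu hf using fun u => isOpPair_of_domain (β := β) one_pos u
  -- The family is indexed by the domain itself and `δ` is the norm of the residual, so uniformity
  -- of the constant is exactly the desired lower bound.
  set δ : (limitOp a₁ a₂ a₃ β 1).domain → ℝ := fun u =>
    ‖limitOp a₁ a₂ a₃ β 1 u - ((ω ^ 2 : ℝ) : ℂ) • (u : L2G a₁ a₂ a₃ 1)‖ with hδ
  have hres : ∀ u, SqIntegrable a₁ a₂ a₃ fun e t => G u e t + (ω : ℂ) ^ 2 * U u e t := fun u =>
    (hd u).h2.sq_deriv2.add ((hd u).h2.sq.smul ((ω : ℂ) ^ 2))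
  have hae : ∀ u e, ((limitOp a₁ a₂ a₃ β 1 u - ((ω ^ 2 : ℝ) : ℂ) • (u : L2G a₁ a₂ a₃ 1)) e : ℝ → ℂ)
      =ᵐ[edgeMeasure a₁ a₂ a₃ 1 e] ((-1 : ℂ) • fun e t => G u e t + (ω : ℂ) ^ 2 * U u e t) e := by
    intro u e
    filter_upwards [hu u e, hf u e, Lp.coeFn_smul ((ω ^ 2 : ℝ) : ℂ) ((u : L2G a₁ a₂ a₃ 1) e),
      Lp.coeFn_sub (limitOp a₁ a₂ a₃ β 1 u e) (((ω ^ 2 : ℝ) : ℂ) • (u : L2G a₁ a₂ a₃ 1) e)]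
      with x h1 h2 h3 h4
    have h5 : ((limitOp a₁ a₂ a₃ β 1 u - ((ω ^ 2 : ℝ) : ℂ) • (u : L2G a₁ a₂ a₃ 1)) e : ℝ → ℂ) x
        = (limitOp a₁ a₂ a₃ β 1 u e : ℝ → ℂ) x
          - (((ω ^ 2 : ℝ) : ℂ) • (u : L2G a₁ a₂ a₃ 1) e : Lp ℂ 2 _) x := h4
    rw [h5, h3, Pi.smul_apply, h1, h2]
    simp only [Pi.smul_apply, smul_eq_mul]
    push_cast
    ring
  have hR : ResidualBound a₁ a₂ a₃ ω U V G δ := by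
    refine ⟨fun u => (hd u).h2, fun u => norm_nonneg _, fun u => (hres u).2, fun u => ?_⟩
    have := tsum_le_of_norm_sq one_pos (hae u) ((hres u).smul (-1))
    rw [min_self, one_mul] at this
    refine le_trans (le_of_eq (tsum_congr fun e => integral_congr_ae
      (Eventually.of_forall fun t => ?_))) this
    simp only [Pi.smul_apply, norm_smul, norm_neg, norm_one, one_mul]
  have h3 : Real.sin (ω * a₃) ≠ 0 ∨ Real.cos (ω * a₃) - Real.cos β ≠ 0 := by
    by_contra! h0
    rw [h0.1, h0.2] at hband
    simp at hband
  obtain ⟨K, hK, hKb⟩ := hR.tsum_mass_le ha₁ ha₂ ha₃ one_pos hω hd h1 h2 h3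
    (hR.isBoundedBy_vertexValue ha₁ ha₂ ha₃ hω hd h1 h2 hband)
  refine ⟨K, fun u => (sq_le_sq₀ (norm_nonneg _) (mul_nonneg hK (norm_nonneg _))).1 ?_⟩
  have := norm_sq_le_of_tsum_le one_pos (hu u) (hd u).h2.sq
  rw [max_self, one_mul] at this
  exact this.trans (hKb u)

/-- An eigenfunction is determined by its vertex values. -/
theorem eq_zero_of_vertexValue_eq_zero (ha₁ : 0 < a₁) (ha₂ : 0 < a₂) (ha₃ : 0 < a₃) (hμ : 0 < μ)
    (hω : ω ≠ 0) (h1 : Real.sin (ω * a₁) ≠ 0) (h2 : Real.sin (ω * a₂) ≠ 0)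
    (h3 : Real.sin (ω * a₃) ≠ 0 ∨ Real.cos (ω * a₃) - Real.cos β ≠ 0)
    {U V G : Edge → ℝ → ℂ} (hd : IsInDomain a₁ a₂ a₃ β μ U V G)
    (hres : ∀ e, residualSq a₁ a₂ a₃ ω U G e = 0) (hp : ∀ x, vertexValue U x = 0)
    {u : L2G a₁ a₂ a₃ μ} (hu : ∀ e, (u e : ℝ → ℂ) =ᵐ[edgeMeasure a₁ a₂ a₃ μ e] U e) : u = 0 := by
  -- A family with one element and `δ = 0`: the estimate then forces the mass to vanish.
  have hR : ResidualBound a₁ a₂ a₃ ω (fun _ : Unit => U) (fun _ => V) (fun _ => G) fun _ => 0 :=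
    ⟨fun _ => hd.h2, fun _ => le_rfl, fun _ => by simp [funext hres], fun _ => by simp [hres]⟩
  obtain ⟨K, hK, hKb⟩ := hR.tsum_mass_le ha₁ ha₂ ha₃ hμ hω (fun _ => hd) h1 h2 h3
    ⟨0, le_rfl, fun _ => ⟨0, fun x => (hp x).symm, by simp⟩⟩
  have h4 := norm_sq_le_of_tsum_le hμ hu hd.h2.sq
  have h5 := hKb ()
  rw [mul_zero, zero_pow two_ne_zero] at h5
  have h6 : ‖u‖ ^ 2 ≤ 0 := h4.trans (mul_nonpos_of_nonneg_of_nonpos (by positivity) h5)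
  exact norm_eq_zero.1 ((pow_eq_zero_iff two_ne_zero).1 (le_antisymm h6 (sq_nonneg _)))

end Operator

end LimitGraph

/-! ### The energy identity and positivity of eigenvalues. -/

namespace LimitGraph

open Lattice ComplexConjugate

variable {a₁ a₂ a₃ β μ ω : ℝ}

section Energy

/-- Integration by parts on an edge. -/
theorem IsH2On.energy {lo hi : ℝ} {U V G : ℝ → ℂ} (h : IsH2On lo hi U V G) (hlh : lo ≤ hi) :
    V hi * conj (U hi) - V lo * conj (U lo)
      = ∫ t in lo..hi, (G t * conj (U t) + V t * conj (V t)) := by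
  -- Extending `V` continuously beyond the edge makes the conjugate of `U` coincide there with a
  -- `C¹` function on the line, as the product rule requires.
  set W : ℝ → ℂ := IccExtend hlh ((Icc lo hi).domRestrict V) with hW
  have hWc : Continuous W := h.cont_deriv.domRestrict.Icc_extend'
  have hWV : ∀ t ∈ Icc lo hi, W t = V t := fun t ht => by
    rw [hW, IccExtend_of_mem hlh _ ht]; rfl
  set φ : ℝ → ℂ := fun x => U lo + ∫ t in lo..x, W t with hφ
  have hφd : ∀ x, HasDerivAt φ (W x) x := fun x =>
    (intervalIntegral.integral_hasDerivAt_right (hWc.intervalIntegrable _ _)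
      (hWc.stronglyMeasurableAtFilter _ _) hWc.continuousAt).const_add _
  have hφU : ∀ x ∈ Icc lo hi, φ x = U x := fun x hx => by
    rw [h.eq_integral x hx]
    simp only [hφ]
    congr 1
    refine intervalIntegral.integral_congr fun t ht => ?_
    rw [uIcc_of_le hx.1] at ht
    exact hWV t ⟨ht.1, ht.2.trans hx.2⟩
  have hcd : ∀ x, HasDerivAt (fun x => conj (φ x)) (conj (W x)) x := fun x =>
    (hφd x).star
  have key := primitive_mul_sub hlh (h.intervalIntegrable (right_mem_Icc.2 hlh))
    h.deriv_eq_integral hcd (Complex.continuous_conj.comp hWc)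
  rw [hφU hi (right_mem_Icc.2 hlh), hφU lo (left_mem_Icc.2 hlh)] at key
  rw [key]
  refine intervalIntegral.integral_congr fun t ht => ?_
  rw [uIcc_of_le hlh] at ht
  simp only [hφU t ht, hWV t ht]

variable {U V G : Edge → ℝ → ℂ}

theorem IsH2Graph.summable_deriv_lo (ha₁ : 0 < a₁) (ha₂ : 0 < a₂) (ha₃ : 0 < a₃)
    (h : IsH2Graph a₁ a₂ a₃ U V G) : Summable fun e => ‖V e (e.lo a₁ a₂ a₃)‖ ^ 2 := by
  set M := a₁⁻¹ + a₂⁻¹ + 2 * a₃⁻¹ with hM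
  have hM0 : 0 < M := by positivity
  refine Summable.of_nonneg_of_le (fun x => sq_nonneg _) (fun e => ?_)
    (((h.sq_deriv.2.mul_left 2).add (h.sq_deriv2.2.mul_left (2 * (a₁ + a₂ + a₃) ^ 2))).mul_left M)
  have he := h.edge e
  have hlt := e.lo_lt_hi ha₁ ha₂ ha₃
  have hl := e.length_pos ha₁ ha₂ ha₃
  have h1 := sq_norm_trace_le hlt he.cont_deriv he.memLp he.deriv_eq_integral
    (left_mem_Icc.2 hlt.le)
  replace h1 := (le_inv_mul_iff₀ hl).2 h1
  refine h1.trans ?_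
  have hG : 0 ≤ ∫ t in Icc (e.lo a₁ a₂ a₃) (e.hi a₁ a₂ a₃), ‖G e t‖ ^ 2 :=
    integral_nonneg fun t => by positivity
  have hV : 0 ≤ ∫ t in Icc (e.lo a₁ a₂ a₃) (e.hi a₁ a₂ a₃), ‖V e t‖ ^ 2 :=
    integral_nonneg fun t => by positivity
  refine mul_le_mul (e.inv_length_le ha₁ ha₂ ha₃) (add_le_add le_rfl
    (mul_le_mul_of_nonneg_right ?_ hG)) (by positivity) hM0.le
  exact mul_le_mul_of_nonneg_left (pow_le_pow_left₀ hl.le (e.length_le ha₁ ha₂ ha₃) 2) zero_le_two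

theorem summable_mul_of_sq {α : Type*} {f g : α → ℂ} (hf : Summable fun x => ‖f x‖ ^ 2)
    (hg : Summable fun x => ‖g x‖ ^ 2) : Summable fun x => f x * g x := by
  refine Summable.of_norm_bounded (hf.add hg) fun x => ?_
  rw [norm_mul]
  nlinarith [sq_nonneg (‖f x‖ - ‖g x‖), sq_nonneg ‖f x‖, sq_nonneg ‖g x‖]

/-- The boundary terms of the energy identity cancel. -/
theorem IsInDomain.hasSum_boundary (ha₁ : 0 < a₁) (ha₂ : 0 < a₂) (ha₃ : 0 < a₃)
    (h : IsInDomain a₁ a₂ a₃ β μ U V G)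
    (hs : Summable fun e : Edge => (e.weight μ : ℂ) * (V e (e.hi a₁ a₂ a₃)
      * conj (U e (e.hi a₁ a₂ a₃)) - V e (e.lo a₁ a₂ a₃) * conj (U e (e.lo a₁ a₂ a₃)))) :
    HasSum (fun e : Edge => (e.weight μ : ℂ) * (V e (e.hi a₁ a₂ a₃)
      * conj (U e (e.hi a₁ a₂ a₃)) - V e (e.lo a₁ a₂ a₃) * conj (U e (e.lo a₁ a₂ a₃)))) 0 := by
  set f : Edge → ℂ := fun e => (e.weight μ : ℂ) * (V e (e.hi a₁ a₂ a₃)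
      * conj (U e (e.hi a₁ a₂ a₃)) - V e (e.lo a₁ a₂ a₃) * conj (U e (e.lo a₁ a₂ a₃))) with hf
  set p := vertexValue U with hp
  have hps : Summable fun x => ‖conj (p x)‖ ^ 2 := by
    simpa only [RCLike.norm_conj] using h.h2.summable_vertexValue ha₁ ha₂ ha₃
  have hV := h.h2.summable_deriv_lo ha₁ ha₂ ha₃
  have f1 := (hs.comp_injective injective_e₁).hasSum
  have f2 := (hs.comp_injective injective_e₂).hasSum
  have f3 := (hs.comp_injective injective_ePlus).hasSum
  have f4 := (hs.comp_injective injective_eMinus).hasSum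
  have hα₁ := (summable_mul_of_sq (hV.comp_injective injective_e₁) hps).hasSum
  have hα₂ := (summable_mul_of_sq (hV.comp_injective injective_e₂) hps).hasSum
  have g1 := f1.add hα₁
  have g2 := f2.add hα₂
  -- Adding back the lower-end terms isolates the upper-end ones, and a translation attaches each of
  -- them to the vertex where its edge ends.
  have r1 : HasSum (fun x : ℤ × ℤ => V (.e₁ (x.1 - 1) x.2) (x.1 * a₁) * conj (p x)) _ :=
    (Equiv.addRight ((1, 0) : ℤ × ℤ)).hasSum_iff.1 (g1.congr_fun fun x => by
      have e1 : ((Equiv.addRight ((1, 0) : ℤ × ℤ)) x) = (x.1 + 1, x.2) := by ext <;> simp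
      simp only [Function.comp_apply, e1, hf, Edge.weight, Edge.lo, Edge.hi, h.h2.e₁_lo,
        h.h2.e₁_hi, add_sub_cancel_right, Prod.mk.eta, ← hp]
      push_cast
      ring)
  have r2 : HasSum (fun x : ℤ × ℤ => V (.e₂ x.1 (x.2 - 1)) (x.2 * a₂) * conj (p x)) _ :=
    (Equiv.addRight ((0, 1) : ℤ × ℤ)).hasSum_iff.1 (g2.congr_fun fun x => by
      have e1 : ((Equiv.addRight ((0, 1) : ℤ × ℤ)) x) = (x.1, x.2 + 1) := by ext <;> simp
      simp only [Function.comp_apply, e1, hf, Edge.weight, Edge.lo, Edge.hi, h.h2.e₂_lo,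
        h.h2.e₂_hi, add_sub_cancel_right, Prod.mk.eta, ← hp]
      push_cast
      ring)
  have htot := (((r1.sub hα₁).add (r2.sub hα₂)).add (f3.add f4))
  -- Grouped by vertex, the terms form a multiple of the Kirchhoff sum; the outer ends of the
  -- vertical edges cancel because `e^{-iβ}` has modulus one.
  have hzero : HasSum (fun _ : ℤ × ℤ => (0 : ℂ)) _ := htot.congr_fun fun x => by
    have hk := h.kirchhoff x.1 x.2
    have q1 := h.quasiPer x.1 x.2
    have q2 := h.quasiPer_deriv x.1 x.2
    have hcj : conj (Complex.exp (-(Complex.I * β))) = Complex.exp (Complex.I * β) := by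
      rw [← Complex.exp_conj]
      simp
    have hb := exp_neg_mul_exp β
    have ep : U (.ePlus x.1 x.2) 0 = p x := rfl
    have em : U (.eMinus x.1 x.2) 0 = p x := h.h2.eMinus_hi x.1 x.2
    simp only [Function.comp_apply, hf, Edge.weight, Edge.lo, Edge.hi, q1, q2, map_mul, hcj, ep, em]
    linear_combination conj (p x) * hk - (vertexWeight μ x.1 x.2 : ℂ)
      * V (.eMinus x.1 x.2) (-(a₃ / 2)) * conj (U (.eMinus x.1 x.2) (-(a₃ / 2))) * hb
  have h0 := hzero.unique hasSum_zero
  refine hs.hasSum_iff.2 ((hasSum_edge f1 f2 f3 f4).tsum_eq.trans ?_)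
  linear_combination h0

theorem IsInDomain.energy_edge (ha₁ : 0 < a₁) (ha₂ : 0 < a₂) (ha₃ : 0 < a₃)
    (h : IsInDomain a₁ a₂ a₃ β μ U V G) {z : ℂ}
    (hG : ∀ e, G e =ᵐ[edgeVolume a₁ a₂ a₃ e] fun x => -z * U e x) (e : Edge) :
    V e (e.hi a₁ a₂ a₃) * conj (U e (e.hi a₁ a₂ a₃))
      - V e (e.lo a₁ a₂ a₃) * conj (U e (e.lo a₁ a₂ a₃))
      = ((∫ x, ‖V e x‖ ^ 2 ∂(edgeVolume a₁ a₂ a₃ e) : ℝ) : ℂ)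
        - z * ((∫ x, ‖U e x‖ ^ 2 ∂(edgeVolume a₁ a₂ a₃ e) : ℝ) : ℂ) := by
  have hlt := e.lo_lt_hi ha₁ ha₂ ha₃
  have i1 : Integrable (fun x => ((‖U e x‖ ^ 2 : ℝ) : ℂ)) (edgeVolume a₁ a₂ a₃ e) :=
    ((h.h2.sq.1 e).integrable_norm_pow (p := 2) (by norm_num)).ofReal
  have i2 : Integrable (fun x => ((‖V e x‖ ^ 2 : ℝ) : ℂ)) (edgeVolume a₁ a₂ a₃ e) :=
    ((h.h2.sq_deriv.1 e).integrable_norm_pow (p := 2) (by norm_num)).ofReal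
  rw [(h.h2.edge e).energy hlt.le, intervalIntegral.integral_of_le hlt.le,
    ← integral_Icc_eq_integral_Ioc]
  change ∫ t, _ ∂(edgeVolume a₁ a₂ a₃ e) = _
  rw [← integral_complex_ofReal, ← integral_complex_ofReal, ← integral_const_mul,
    ← integral_sub i2 (i1.const_mul z)]
  refine integral_congr_ae ?_
  filter_upwards [hG e] with x hx
  rw [hx, Complex.mul_conj, Complex.normSq_eq_norm_sq, mul_assoc, Complex.mul_conj,
    Complex.normSq_eq_norm_sq]
  ring

end Energy

theorem eq_zero_of_shift_invariant {p : ℤ × ℤ → ℂ} (hp : Summable fun x => ‖p x‖ ^ 2)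
    (h : ∀ k l : ℤ, p (k + 1, l) = p (k, l)) (x : ℤ × ℤ) : p x = 0 := by
  have hinj : Function.Injective fun n : ℕ => (x.1 + (n : ℤ), x.2) := fun m n hmn => by
    simpa using hmn
  have hc : ∀ n : ℕ, p (x.1 + (n : ℤ), x.2) = p x := by
    intro n
    induction n with
    | zero => simp
    | succ n ih => rw [Nat.cast_succ, ← add_assoc, h, ih]
  have hs := hp.comp_injective hinj
  have h1 := hs.tendsto_atTop_zero
  have h2 : Tendsto (fun _ : ℕ => ‖p x‖ ^ 2) atTop (𝓝 0) :=
    h1.congr fun n => by simp only [Function.comp_apply, hc]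
  have h3 := tendsto_nhds_unique h2 tendsto_const_nhds
  exact norm_eq_zero.1 ((pow_eq_zero_iff two_ne_zero).1 h3.symm)

/-- An eigenvalue, together with an eigenfunction, is given by a positive frequency. -/
theorem exists_frequency (ha₁ : 0 < a₁) (ha₂ : 0 < a₂) (ha₃ : 0 < a₃) (hμ : 0 < μ) {z : ℂ}
    (hz : UnboundedOp.IsEigenvalue (limitOp a₁ a₂ a₃ β μ) z) :
    ∃ ω : ℝ, 0 < ω ∧ z = ((ω ^ 2 : ℝ) : ℂ) ∧ ∃ (u : L2G a₁ a₂ a₃ μ) (U V G : Edge → ℝ → ℂ), u ≠ 0 ∧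
      IsInDomain a₁ a₂ a₃ β μ U V G ∧ (∀ e, (u e : ℝ → ℂ) =ᵐ[edgeMeasure a₁ a₂ a₃ μ e] U e) ∧
      ∀ e, residualSq a₁ a₂ a₃ ω U G e = 0 := by
  obtain ⟨v, hv0, hv⟩ := hz
  obtain ⟨U, V, G, hd, hu, hf⟩ := isOpPair_of_domain hμ v
  have hvne : (v : L2G a₁ a₂ a₃ μ) ≠ 0 := fun h => hv0 (Subtype.ext h)
  have hG : ∀ e, G e =ᵐ[edgeVolume a₁ a₂ a₃ e] fun x => -z * U e x := fun e => by
    have h1 := hf e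
    rw [hv] at h1
    have h2 : (fun x => -G e x) =ᵐ[edgeMeasure a₁ a₂ a₃ μ e] fun x => z * U e x := by
      refine h1.symm.trans ?_
      filter_upwards [hu e, Lp.coeFn_smul z ((v : L2G a₁ a₂ a₃ μ) e)] with x h3 h4
      have h5 : ((z • (v : L2G a₁ a₂ a₃ μ)) e : ℝ → ℂ) x = z • ((v : L2G a₁ a₂ a₃ μ) e : ℝ → ℂ) x :=
        h4
      rw [h5, h3, smul_eq_mul]
    rw [EventuallyEq, ae_edgeMeasure hμ] at h2
    filter_upwards [h2] with x hx
    linear_combination -hx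
  have hm := hasSum_norm_sq hμ (v : L2G a₁ a₂ a₃ μ) hu
  obtain ⟨w, hw⟩ := exists_L2G hμ hd.h2.sq_deriv
  have hn := hasSum_norm_sq hμ w hw
  have hen := hd.energy_edge ha₁ ha₂ ha₃ hG
  have hsum : HasSum (fun e : Edge => (e.weight μ : ℂ) * (V e (e.hi a₁ a₂ a₃)
      * conj (U e (e.hi a₁ a₂ a₃)) - V e (e.lo a₁ a₂ a₃) * conj (U e (e.lo a₁ a₂ a₃))))
      (((‖w‖ ^ 2 : ℝ) : ℂ) - z * ((‖(v : L2G a₁ a₂ a₃ μ)‖ ^ 2 : ℝ) : ℂ)) := by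
    refine ((Complex.hasSum_ofReal.2 hn).sub ((Complex.hasSum_ofReal.2 hm).mul_left z)).congr_fun
      fun e => ?_
    rw [hen e]
    push_cast
    ring
  have hz0 := hsum.unique (hd.hasSum_boundary ha₁ ha₂ ha₃ hsum.summable)
  have hvp : 0 < ‖(v : L2G a₁ a₂ a₃ μ)‖ ^ 2 := by
    have := norm_pos_iff.2 hvne
    positivity
  have hvc : ((‖(v : L2G a₁ a₂ a₃ μ)‖ ^ 2 : ℝ) : ℂ) ≠ 0 := by exact_mod_cast hvp.ne'
  -- The eigenvalue is the Rayleigh quotient `‖u'‖² / ‖u‖²`, hence real and nonnegative.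
  set r := ‖w‖ ^ 2 / ‖(v : L2G a₁ a₂ a₃ μ)‖ ^ 2 with hr
  have hzr : z = (r : ℂ) := by
    rw [hr, Complex.ofReal_div, eq_div_iff hvc]
    exact (sub_eq_zero.1 hz0).symm
  -- Zero is excluded: a function constant on every edge has translation invariant vertex values,
  -- and these are square summable only if they vanish.
  have hw0 : w ≠ 0 := by
    intro h0
    have hV0 : ∀ e, EqOn (V e) 0 (Icc (e.lo a₁ a₂ a₃) (e.hi a₁ a₂ a₃)) := fun e => by
      have h1 : V e =ᵐ[edgeMeasure a₁ a₂ a₃ μ e] 0 := by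
        refine (hw e).symm.trans ?_
        rw [h0]
        exact Lp.coeFn_zero _ _ _
      rw [EventuallyEq, ae_edgeMeasure hμ] at h1
      exact Measure.eqOn_Icc_of_ae_eq _ (e.lo_lt_hi ha₁ ha₂ ha₃).ne h1 (hd.h2.edge e).cont_deriv
        continuousOn_const
    have hUc : ∀ e, ∀ x ∈ Icc (e.lo a₁ a₂ a₃) (e.hi a₁ a₂ a₃), U e x = U e (e.lo a₁ a₂ a₃) := by
      intro e x hx
      rw [(hd.h2.edge e).eq_integral x hx, intervalIntegral.integral_congr (g := fun _ => (0 : ℂ))]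
      · simp
      · intro t ht
        rw [uIcc_of_le hx.1] at ht
        exact hV0 e ⟨ht.1, ht.2.trans hx.2⟩
    have hp0 : ∀ x, vertexValue U x = 0 := by
      refine eq_zero_of_shift_invariant (hd.h2.summable_vertexValue ha₁ ha₂ ha₃) fun k l => ?_
      rw [← hd.h2.e₁_hi, ← hd.h2.e₁_lo]
      exact hUc (.e₁ k l) _ (right_mem_Icc.2 ((Edge.e₁ k l).lo_lt_hi ha₁ ha₂ ha₃).le)
    have hU0 : ∀ e, ∀ x ∈ Icc (e.lo a₁ a₂ a₃) (e.hi a₁ a₂ a₃), U e x = 0 := by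
      intro e x hx
      rw [hUc e x hx]
      cases e with
      | e₁ k l => exact (hd.h2.e₁_lo k l).trans (hp0 _)
      | e₂ k l => exact (hd.h2.e₂_lo k l).trans (hp0 _)
      | ePlus k l => exact hp0 (k, l)
      | eMinus k l =>
        rw [← hUc (.eMinus k l) 0 (right_mem_Icc.2 ((Edge.eMinus k l).lo_lt_hi ha₁ ha₂ ha₃).le)]
        exact (hd.h2.eMinus_hi k l).trans (hp0 _)
    refine hvne (lp.ext (funext fun e => Lp.ext ((hu e).trans ?_)))
    have h2 : U e =ᵐ[edgeMeasure a₁ a₂ a₃ μ e] 0 := by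
      rw [EventuallyEq, ae_edgeMeasure hμ, edgeVolume, ae_restrict_iff' measurableSet_Icc]
      exact Eventually.of_forall (hU0 e)
    exact h2.trans (Lp.coeFn_zero ℂ 2 (edgeMeasure a₁ a₂ a₃ μ e)).symm
  have hr0 : 0 < r := by
    have := norm_pos_iff.2 hw0
    positivity
  refine ⟨Real.sqrt r, Real.sqrt_pos.2 hr0, by rw [Real.sq_sqrt hr0.le, hzr], v, U, V, G, hvne, hd,
    hu, fun e => ?_⟩
  unfold residualSq
  refine integral_eq_zero_of_ae ?_
  filter_upwards [hG e] with x hx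
  have h1 : ((Real.sqrt r : ℝ) : ℂ) ^ 2 = z := by
    rw [hzr, ← Complex.ofReal_pow, Real.sq_sqrt hr0.le]
  rw [hx, h1]
  simp

end LimitGraph

/-! ### Absence of eigenvalues outside the bands for `μ > 1`. -/

namespace LimitGraph

open Lattice

variable {a₁ a₂ a₃ β μ ω : ℝ} {U V G : Edge → ℝ → ℂ}

theorem IsH2Graph.source_eq_zero (ha₁ : 0 < a₁) (ha₂ : 0 < a₂) (ha₃ : 0 < a₃)
    (h : IsH2Graph a₁ a₂ a₃ U V G) {e : Edge} (hres : residualSq a₁ a₂ a₃ ω U G e = 0) :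
    sourceSin a₁ a₂ a₃ ω U G e = 0 ∧ sourceCos a₁ a₂ a₃ ω U G e = 0 := by
  have hlt := e.lo_lt_hi ha₁ ha₂ ha₃
  have key : ∀ {φ : ℝ → ℝ}, Continuous φ → (∀ t, |φ t| ≤ 1) →
      ∫ t in e.lo a₁ a₂ a₃..e.hi a₁ a₂ a₃, (G e t + (ω : ℂ) ^ 2 * U e t) * (φ t : ℂ) = 0 := by
    intro φ hφ hφ1
    have h1 := (h.edge e).sq_norm_source_le (ω := ω) hlt (right_mem_Icc.2 hlt.le) hφ hφ1
    change _ ≤ _ * residualSq a₁ a₂ a₃ ω U G e at h1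
    rw [hres, mul_zero] at h1
    exact norm_eq_zero.1 ((pow_eq_zero_iff two_ne_zero).1 (le_antisymm h1 (sq_nonneg _)))
  exact ⟨key (by fun_prop) fun t => Real.abs_sin_le_one _,
    key (by fun_prop) fun t => Real.abs_cos_le_one _⟩

/-- The vertex values of an eigenfunction solve the vertex equation. -/
theorem IsInDomain.vertex_equation_of_residual (ha₁ : 0 < a₁) (ha₂ : 0 < a₂) (ha₃ : 0 < a₃)
    (hω : ω ≠ 0) (h : IsInDomain a₁ a₂ a₃ β μ U V G) (h1 : Real.sin (ω * a₁) ≠ 0)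
    (h2 : Real.sin (ω * a₂) ≠ 0) (hres : ∀ e, residualSq a₁ a₂ a₃ ω U G e = 0) (k l : ℤ) :
    (Real.sin (ω * a₃) : ℂ) *
        ((vertexValue U (k + 1, l) + vertexValue U (k - 1, l)
          - 2 * Real.cos (ω * a₁) * vertexValue U (k, l)) / Real.sin (ω * a₁)
        + (vertexValue U (k, l + 1) + vertexValue U (k, l - 1)
          - 2 * Real.cos (ω * a₂) * vertexValue U (k, l)) / Real.sin (ω * a₂))
      = 2 * vertexWeight μ k l * (Real.cos (ω * a₃) - Real.cos β : ℝ) * vertexValue U (k, l) := by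
  have hω' : (ω : ℂ) ≠ 0 := by exact_mod_cast hω
  have hz := fun e => h.h2.source_eq_zero ha₁ ha₂ ha₃ (hres e)
  have := h.vertex_equation (ω := ω) ha₁ ha₂ ha₃ h1 h2 k l
  simp only [sourceFlux, sourceUp, sourceDown, (hz _).1, (hz _).2, mul_zero, sub_zero, add_zero,
    zero_div] at this
  exact sub_eq_zero.1 ((mul_eq_zero.1 this).resolve_left hω')

/-- A defect of strength at least one produces no square summable solution outside the bands. -/
theorem vertexValue_eq_zero (ha₁ : 0 < a₁) (ha₂ : 0 < a₂) (ha₃ : 0 < a₃) (hμ : 1 < μ)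
    (hω : ω ≠ 0) (h : IsInDomain a₁ a₂ a₃ β μ U V G) (h1 : Real.sin (ω * a₁) ≠ 0)
    (h2 : Real.sin (ω * a₂) ≠ 0) (hres : ∀ e, residualSq a₁ a₂ a₃ ω U G e = 0)
    (hband : |Real.sin (ω * a₃)| * bandRadius a₁ a₂ ω
      < |Real.cos (ω * a₃) - Real.cos β + Real.sin (ω * a₃) * bandCenter a₁ a₂ ω|)
    (x : ℤ × ℤ) : vertexValue U x = 0 := by
  have heq := h.vertex_equation_of_residual ha₁ ha₂ ha₃ hω h1 h2 hres
  have hw0 : ∀ k l, ((vertexWeight μ k l : ℝ) : ℂ) ≠ 0 := fun k l => by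
    exact_mod_cast (vertexWeight_pos (zero_lt_one.trans hμ) k l).ne'
  by_cases h3 : Real.sin (ω * a₃) = 0
  -- When `sin (ω a₃) = 0` the hopping terms disappear and the equation is diagonal with nonzero
  -- coefficient.
  · obtain ⟨k, l⟩ := x
    have hkl := heq k l
    rw [h3, Complex.ofReal_zero, zero_mul] at hkl
    have hD : ((Real.cos (ω * a₃) - Real.cos β : ℝ) : ℂ) ≠ 0 := by
      norm_cast
      intro hD
      rw [h3, hD] at hband
      simp at hband
    exact (mul_eq_zero.1 hkl.symm).resolve_left
      (mul_ne_zero (mul_ne_zero two_ne_zero (hw0 k l)) hD)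
  · have h3' : ((Real.sin (ω * a₃) : ℝ) : ℂ) ≠ 0 := by exact_mod_cast h3
    set g := verticalTerm a₃ β ω with hg
    set C := bandCenter a₁ a₂ ω with hC
    set R := bandRadius a₁ a₂ ω with hR
    have hgE : R < |g + C| := by
      refine lt_of_mul_lt_mul_left ?_ (abs_nonneg (Real.sin (ω * a₃)))
      rw [← abs_mul, mul_add, hg, verticalTerm, mul_div_cancel₀ _ h3]
      exact hband
    have hCR : |C| < R := abs_bandCenter_lt h1 h2
    obtain ⟨p, hp⟩ := exists_L2Z (h.h2.summable_vertexValue ha₁ ha₂ ha₃)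
    have hvec : hop ℂ (1 / Real.sin (ω * a₁)) (1 / Real.sin (ω * a₂)) p
        = ((2 * (g + C) : ℝ) : ℂ) • p
          + ((2 * (μ - 1) * g : ℝ) : ℂ) • lp.single 2 ((0, 0) : ℤ × ℤ) (p (0, 0)) := by
      refine lp.ext (funext fun y => ?_)
      obtain ⟨k, l⟩ := y
      change hop ℂ (1 / Real.sin (ω * a₁)) (1 / Real.sin (ω * a₂)) p (k, l)
        = ((2 * (g + C) : ℝ) : ℂ) * p (k, l)
          + ((2 * (μ - 1) * g : ℝ) : ℂ) * (lp.single 2 ((0, 0) : ℤ × ℤ) (p (0, 0)) : L2Z ℂ) (k, l)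
      have hs : ((lp.single 2 ((0, 0) : ℤ × ℤ) (p (0, 0)) : L2Z ℂ) (k, l) : ℂ)
          = if k = 0 ∧ l = 0 then p (k, l) else 0 := by
        by_cases hkl : k = 0 ∧ l = 0
        · obtain ⟨rfl, rfl⟩ := hkl
          rw [if_pos ⟨rfl, rfl⟩]
          exact lp.single_apply_self _ _ _
        · rw [if_neg hkl]
          exact lp.single_apply_ne _ _ _ (by simpa [Prod.ext_iff] using hkl)
      have hkl := heq k l
      replace hkl := eq_div_of_mul_eq h3' ((mul_comm _ _).trans hkl)
      rw [hs, hop_apply, hp, hp, hp, hp, hp]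
      simp only [hg, hC, verticalTerm, bandCenter, vertexWeight] at hkl ⊢
      split_ifs at hkl ⊢ <;>
      · simp only [Complex.coe_algebraMap, Complex.ofReal_div, Complex.ofReal_mul,
          Complex.ofReal_add, Complex.ofReal_sub, Complex.ofReal_ofNat, Complex.ofReal_one] at hkl ⊢
        linear_combination hkl
    have hin : RCLike.re (inner ℂ p (hop ℂ (1 / Real.sin (ω * a₁)) (1 / Real.sin (ω * a₂)) p))
        = 2 * (g + C) * ‖p‖ ^ 2 + 2 * (μ - 1) * g * ‖p (0, 0)‖ ^ 2 := by
      have e1 : inner ℂ p p = ((‖p‖ ^ 2 : ℝ) : ℂ) := by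
        rw [inner_self_eq_norm_sq_to_K]; simp
      have e2 : inner ℂ (p (0, 0)) (p (0, 0)) = ((‖p (0, 0)‖ ^ 2 : ℝ) : ℂ) := by
        rw [inner_self_eq_norm_sq_to_K]; simp
      rw [hvec, inner_add_right, inner_smul_right, inner_smul_right, lp.inner_single_right,
        e1, e2, ← Complex.ofReal_mul, ← Complex.ofReal_mul, ← Complex.ofReal_add]
      exact Complex.ofReal_re _
    have hle : |RCLike.re (inner ℂ p (hop ℂ (1 / Real.sin (ω * a₁)) (1 / Real.sin (ω * a₂)) p))|
        ≤ 2 * R * ‖p‖ ^ 2 := by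
      refine (RCLike.abs_re_le_norm _).trans ((norm_inner_le_norm _ _).trans ?_)
      have := norm_hop_le (𝕜 := ℂ) (1 / Real.sin (ω * a₁)) (1 / Real.sin (ω * a₂)) p
      rw [abs_div, abs_div, abs_one, ← mul_add, ← bandRadius, ← hR] at this
      nlinarith [norm_nonneg p]
    rw [hin, abs_le] at hle
    -- `g` and `g + C` have the same sign, so for `μ > 1` the defect term adds to `2 (g + C) ‖p‖²`,
    -- whose modulus already exceeds `2 R ‖p‖²` unless `p = 0`.
    have hp2 : ‖p‖ ^ 2 = 0 := by
      obtain ⟨c1, c2⟩ := abs_lt.1 hCR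
      have q0 := sq_nonneg ‖p (0, 0)‖
      have q1 := sq_nonneg ‖p‖
      by_contra hne
      have q2 : 0 < ‖p‖ ^ 2 := lt_of_le_of_ne q1 (Ne.symm hne)
      rcases lt_abs.1 hgE with hE | hE
      · have hgp : 0 < g := by linarith
        have t1 : 0 ≤ (μ - 1) * g * ‖p (0, 0)‖ ^ 2 :=
          mul_nonneg (mul_nonneg (by linarith) hgp.le) q0
        nlinarith [hle.2]
      · have hgp : g < 0 := by linarith
        have t1 : 0 ≤ (μ - 1) * (-g) * ‖p (0, 0)‖ ^ 2 :=
          mul_nonneg (mul_nonneg (by linarith) (by linarith)) q0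
        nlinarith [hle.1]
    have hp0 : p = 0 := norm_eq_zero.1 ((pow_eq_zero_iff two_ne_zero).1 hp2)
    rw [← hp, hp0]
    rfl

/-- For `μ > 1` every eigenvalue lies in a band. -/
theorem band_of_isEigenvalue (ha₁ : 0 < a₁) (ha₂ : 0 < a₂) (ha₃ : 0 < a₃) (hμ : 1 < μ) {z : ℂ}
    (hz : UnboundedOp.IsEigenvalue (limitOp a₁ a₂ a₃ β μ) z) :
    ∃ ω : ℝ, 0 < ω ∧ z = ((ω ^ 2 : ℝ) : ℂ) ∧ (Real.sin (ω * a₁) = 0 ∨ Real.sin (ω * a₂) = 0 ∨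
      |Real.cos (ω * a₃) - Real.cos β + Real.sin (ω * a₃) * bandCenter a₁ a₂ ω|
        ≤ |Real.sin (ω * a₃)| * bandRadius a₁ a₂ ω) := by
  have hμ0 : 0 < μ := zero_lt_one.trans hμ
  obtain ⟨ω, hω, hzω, u, U, V, G, hu0, hd, hu, hres⟩ := exists_frequency ha₁ ha₂ ha₃ hμ0 hz
  refine ⟨ω, hω, hzω, ?_⟩
  by_contra! hcon
  obtain ⟨h1, h2, h3⟩ := hcon
  have h4 : Real.sin (ω * a₃) ≠ 0 ∨ Real.cos (ω * a₃) - Real.cos β ≠ 0 := by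
    by_contra! h0
    rw [h0.1, h0.2] at h3
    simp at h3
  exact hu0 (eq_zero_of_vertexValue_eq_zero ha₁ ha₂ ha₃ hμ0 hω.ne' h1 h2 h4 hd hres
    (vertexValue_eq_zero ha₁ ha₂ ha₃ hμ hω.ne' hd h1 h2 hres h3) hu)

end LimitGraph

/-! ### End points of gaps, and the conclusion. -/

namespace LimitGraph

variable {a₁ a₂ a₃ β μ x τ α ω₀ ωb ωt : ℝ}

/-- The dispersion relation holds at the frequency `x`. -/
def IsBandFrequency (a₁ a₂ a₃ β x : ℝ) : Prop :=
  |Real.cos (x * a₃) - Real.cos β + Real.sin (x * a₃) * bandCenter a₁ a₂ x|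
    ≤ |Real.sin (x * a₃)| * bandRadius a₁ a₂ x

theorem isBandFrequency_iff (h3 : Real.sin (x * a₃) ≠ 0) : IsBandFrequency a₁ a₂ a₃ β x ↔
    |verticalTerm a₃ β x + bandCenter a₁ a₂ x| ≤ bandRadius a₁ a₂ x := by
  have h : Real.cos (x * a₃) - Real.cos β + Real.sin (x * a₃) * bandCenter a₁ a₂ x
      = Real.sin (x * a₃) * (verticalTerm a₃ β x + bandCenter a₁ a₂ x) := by
    rw [mul_add, verticalTerm, mul_div_cancel₀ _ h3]
  rw [IsBandFrequency, h, abs_mul, mul_le_mul_iff_right₀ (abs_pos.2 h3)]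

theorem isBandFrequency_neg : IsBandFrequency a₁ a₂ a₃ β (-x) ↔ IsBandFrequency a₁ a₂ a₃ β x := by
  simp only [IsBandFrequency, bandCenter, bandRadius, neg_mul, Real.sin_neg, Real.cos_neg, div_neg,
    abs_neg, ← neg_add, mul_neg, neg_neg]

theorem mem_sigmaSet_iff {a : ℝ} (ha : 0 < a) : x ^ 2 ∈ sigmaSet a ↔ Real.sin (x * a) = 0 := by
  rw [Real.sin_eq_zero_iff]
  constructor
  · rintro ⟨n, hn⟩
    rcases sq_eq_sq_iff_eq_or_eq_neg.1 hn with h | h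
    · exact ⟨n, by rw [h]; field_simp⟩
    · exact ⟨-n, by rw [h]; push_cast; field_simp⟩
  · rintro ⟨n, hn⟩
    refine ⟨n, ?_⟩
    congr 1
    rw [eq_div_iff ha.ne', ← hn]
    ring

theorem sin_eq_zero_of_mem_W (ha₃ : 0 < a₃) (h : x ∈ W a₃ β) : Real.sin (x * a₃) = 0 := by
  rw [Real.sin_eq_zero_iff]
  rcases h with ⟨-, -, n, -, hn⟩ | ⟨rfl | rfl, n, hn⟩
  · exact ⟨n, by rw [hn]; push_cast; field_simp⟩
  · exact ⟨2 * n + 1, by rw [hn]; push_cast; field_simp; ring⟩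
  · exact ⟨2 * n + 2, by rw [hn]; push_cast; field_simp; ring⟩

/-- If `β` is `0` or `π`, every other zero of `sin (x a₃)` has `cos (x a₃) = cos β`; these are
excluded by `hc`, and `W` lists the remaining ones. -/
theorem mem_W_of_sin_eq_zero (ha₃ : 0 < a₃) (hx : 0 < x) (hs : Real.sin (x * a₃) = 0)
    (hc : Real.cos (x * a₃) ≠ Real.cos β) : x ∈ W a₃ β := by
  obtain ⟨n, hn⟩ := Real.sin_eq_zero_iff.1 hs
  have hn0 : 0 < n := by
    have h1 : 0 < (n : ℝ) * Real.pi := by rw [hn]; positivity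
    exact_mod_cast pos_of_mul_pos_left h1 Real.pi_pos.le
  lift n to ℕ using hn0.le
  rw [Int.cast_natCast] at hn
  have hxn : x = n * Real.pi / a₃ := by rw [hn]; field_simp
  have hn1 : 1 ≤ n := by omega
  by_cases h0 : β = 0
  · subst h0
    refine Or.inr ⟨Or.inl rfl, ?_⟩
    rcases Nat.even_or_odd' n with ⟨m, hm | hm⟩
    · refine absurd ?_ hc
      rw [← hn, hm, Real.cos_zero]
      push_cast
      rw [show (2 : ℝ) * m * Real.pi = m * (2 * Real.pi) by ring, Real.cos_nat_mul_two_pi]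
    · refine ⟨m, ?_⟩
      rw [hxn, hm]
      push_cast
      ring
  by_cases hπ : β = Real.pi
  · subst hπ
    refine Or.inr ⟨Or.inr rfl, ?_⟩
    rcases Nat.even_or_odd' n with ⟨m, hm | hm⟩
    · obtain ⟨m, rfl⟩ : ∃ j, m = j + 1 := ⟨m - 1, by omega⟩
      refine ⟨m, ?_⟩
      rw [hxn, hm]
      push_cast
      ring
    · refine absurd ?_ hc
      rw [← hn, hm, Real.cos_pi]
      push_cast
      rw [show ((2 : ℝ) * m + 1) * Real.pi = m * (2 * Real.pi) + Real.pi by ring,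
        Real.cos_nat_mul_two_pi_add_pi]
  · exact Or.inl ⟨h0, hπ, n, hn1, by rw [hxn]; ring⟩

section Boundary

variable {S : Set ℝ}

/-- A spectral boundary point of the resolvent set lies in a band. -/
theorem isBandFrequency_of_boundary (ha₁ : 0 < a₁) (ha₂ : 0 < a₂) (ha₃ : 0 < a₃) (hτ : τ ≠ 0)
    (h1 : Real.sin (τ * a₁) ≠ 0) (h2 : Real.sin (τ * a₂) ≠ 0) [(𝓝[S] τ).NeBot]
    (hS : ∀ x ∈ S, ((x ^ 2 : ℝ) : ℂ) ∉ UnboundedOp.spectrum (limitOp a₁ a₂ a₃ β 1))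
    (hs : ((τ ^ 2 : ℝ) : ℂ) ∈ UnboundedOp.spectrum (limitOp a₁ a₂ a₃ β 1)) :
    IsBandFrequency a₁ a₂ a₃ β τ := by
  by_contra hband
  obtain ⟨K, hK⟩ := exists_norm_le ha₁ ha₂ ha₃ hτ h1 h2 (not_le.1 hband)
  refine hs (UnboundedOp.mem_resolventSet_of_approx _ hK fun ε hε => ?_)
  have hc : Tendsto (fun x : ℝ => ((x ^ 2 : ℝ) : ℂ)) (𝓝[S] τ) (𝓝 ((τ ^ 2 : ℝ) : ℂ)) :=
    (Continuous.tendsto (by fun_prop) τ).mono_left nhdsWithin_le_nhds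
  obtain ⟨x, hx1, hx2⟩ := ((hc.eventually (Metric.ball_mem_nhds _ hε)).and
    self_mem_nhdsWithin).exists
  exact ⟨_, not_not.1 (hS x hx2), by rwa [← dist_eq_norm]⟩

/-- At a boundary point between a gap and a band `sin (τ a₃)` does not vanish. -/
theorem sin_ne_zero_of_boundary (h1 : Real.sin (τ * a₁) ≠ 0) (h2 : Real.sin (τ * a₂) ≠ 0)
    [(𝓝[S] τ).NeBot] (hS : ∀ x ∈ S, ¬IsBandFrequency a₁ a₂ a₃ β x)
    (hτ : IsBandFrequency a₁ a₂ a₃ β τ) : Real.sin (τ * a₃) ≠ 0 := by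
  intro h3
  have hD : Real.cos (τ * a₃) = Real.cos β := by
    rw [IsBandFrequency, h3, zero_mul, add_zero, abs_zero, zero_mul] at hτ
    exact sub_eq_zero.1 (abs_nonpos_iff.1 hτ)
  have hσ : Real.cos β ^ 2 = 1 := by
    have := Real.sin_sq_add_cos_sq (τ * a₃)
    rw [h3, hD] at this
    linarith
  have hev : ∀ᶠ x in 𝓝[S] τ, 0 < Real.cos β * Real.cos (x * a₃) := by
    have hc : Tendsto (fun x : ℝ => Real.cos β * Real.cos (x * a₃)) (𝓝[S] τ)
        (𝓝 (Real.cos β * Real.cos (τ * a₃))) :=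
      (Continuous.tendsto (by fun_prop) τ).mono_left nhdsWithin_le_nhds
    exact hc.eventually (lt_mem_nhds (by rw [hD, ← sq, hσ]; exact one_pos))
  -- Otherwise `cos (τ a₃) = cos β = ±1`, and `|cos (x a₃) - cos β| ≤ sin² (x a₃)` near `τ`. Being
  -- outside the bands then gives `R ≤ |sin (x a₃)| + |C|`, whose limit `R ≤ |C|` is impossible.
  have hlt : ∀ᶠ x in 𝓝[S] τ,
      bandRadius a₁ a₂ x ≤ |Real.sin (x * a₃)| + |bandCenter a₁ a₂ x| := by
    filter_upwards [hev, self_mem_nhdsWithin] with x hx hxS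
    have hb := not_le.1 (hS x hxS)
    have hq := Real.sin_sq_add_cos_sq (x * a₃)
    have hDle : |Real.cos (x * a₃) - Real.cos β| ≤ |Real.sin (x * a₃)| ^ 2 := by
      have e1 : |Real.cos (x * a₃) - Real.cos β| * |1 + Real.cos β * Real.cos (x * a₃)|
          = |Real.sin (x * a₃)| ^ 2 := by
        have hβ : |Real.cos β| = 1 := by
          rw [← sq_eq_sq₀ (abs_nonneg _) zero_le_one, sq_abs, hσ, one_pow]
        have e2 : Real.cos β * (Real.cos (x * a₃) - Real.cos β)
            * (1 + Real.cos β * Real.cos (x * a₃)) = -Real.sin (x * a₃) ^ 2 := by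
          linear_combination (Real.cos (x * a₃) ^ 2 - 1 - Real.cos β * Real.cos (x * a₃)) * hσ + hq
        have e3 := congrArg abs e2
        rwa [abs_mul, abs_mul, hβ, one_mul, abs_neg, abs_pow] at e3
      rw [← e1]
      refine le_mul_of_one_le_right (abs_nonneg _) ?_
      rw [abs_of_pos (by linarith)]
      linarith
    have h4 := (hb.trans_le (abs_add_le _ _)).trans_le (add_le_add_left hDle _)
    rw [abs_mul] at h4
    by_contra! h5
    nlinarith [abs_nonneg (Real.sin (x * a₃))]
  have l1 := (continuousAt_bandRadius h1 h2).tendsto.mono_left (nhdsWithin_le_nhds (s := S))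
  have l2 : Tendsto (fun x => |Real.sin (x * a₃)| + |bandCenter a₁ a₂ x|) (𝓝[S] τ)
      (𝓝 (|Real.sin (τ * a₃)| + |bandCenter a₁ a₂ τ|)) := by
    refine Tendsto.mono_left ?_ (nhdsWithin_le_nhds (s := S))
    exact ((Continuous.tendsto (by fun_prop) τ).abs).add (continuousAt_bandCenter h1 h2).tendsto.abs
  have := le_of_tendsto_of_tendsto l1 l2 hlt
  rw [h3, abs_zero, zero_add] at this
  exact absurd (abs_bandCenter_lt h1 h2) (not_lt.2 this)

end Boundary

/-- Frequencies at which the vertex equation is regular and outside the bands. -/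
def IsGapFrequency (a₁ a₂ a₃ β x : ℝ) : Prop :=
  Real.sin (x * a₁) ≠ 0 ∧ Real.sin (x * a₂) ≠ 0 ∧ ¬IsBandFrequency a₁ a₂ a₃ β x

/-- Singular end points, at which the vertex equation degenerates. -/
def IsSingularFrequency (a₁ a₂ a₃ β α : ℝ) : Prop :=
  Real.sin (α * a₁) = 0 ∨ Real.sin (α * a₂) = 0 ∨
    (Real.sin (α * a₃) = 0 ∧ Real.cos (α * a₃) ≠ Real.cos β)

theorem exists_vertexEquation_Ioo (ha₁ : 0 < a₁) (ha₂ : 0 < a₂) (ha₃ : 0 < a₃) (hμ0 : 0 < μ)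
    (hμ1 : μ < 1) (hατ : α < τ) (hgap : ∀ x ∈ Ioo α τ, IsGapFrequency a₁ a₂ a₃ β x)
    (h3 : ∀ x ∈ Ioo α τ, Real.sin (x * a₃) ≠ 0)
    (h1τ : Real.sin (τ * a₁) ≠ 0) (h2τ : Real.sin (τ * a₂) ≠ 0)
    (h3τ : Real.sin (τ * a₃) ≠ 0) (hτ : IsBandFrequency a₁ a₂ a₃ β τ)
    (hα : IsSingularFrequency a₁ a₂ a₃ β α) :
    ∃ ω ∈ Ioo α τ, ∃ p : ℤ × ℤ → ℝ, p ≠ 0 ∧ (Summable fun x => ‖p x‖ ^ 2) ∧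
      VertexEquation a₁ a₂ a₃ β μ ω p := by
  have hend : ∀ {a : ℝ}, (∀ x ∈ Ioo α τ, Real.sin (x * a) ≠ 0) → Real.sin (τ * a) ≠ 0 →
      ∀ x ∈ Ioc α τ, Real.sin (x * a) ≠ 0 := fun hin he x hx => by
    rcases hx.2.lt_or_eq with h | h
    · exact hin x ⟨hx.1, h⟩
    · rwa [h]
  refine exists_vertexEquation ha₁ ha₂ ha₃ hμ0 hμ1 hατ (hend (fun x hx => (hgap x hx).1) h1τ)
    (hend (fun x hx => (hgap x hx).2.1) h2τ) (hend h3 h3τ) (fun x hx => ?_)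
    ((isBandFrequency_iff h3τ).1 hτ) hα
  exact not_le.1 ((isBandFrequency_iff (h3 x hx)).not.1 (hgap x hx).2.2)

/-- A gap with a singular lower end and a regular upper end contains an eigenvalue. -/
theorem exists_isEigenvalue_of_singular_left (ha₁ : 0 < a₁) (ha₂ : 0 < a₂) (ha₃ : 0 < a₃)
    (hμ0 : 0 < μ) (hμ1 : μ < 1) (hατ : α < τ)
    (hgap : ∀ x ∈ Ioo α τ, IsGapFrequency a₁ a₂ a₃ β x)
    (h3 : ∀ x ∈ Ioo α τ, Real.sin (x * a₃) ≠ 0)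
    (h1τ : Real.sin (τ * a₁) ≠ 0) (h2τ : Real.sin (τ * a₂) ≠ 0)
    (h3τ : Real.sin (τ * a₃) ≠ 0) (hτ : IsBandFrequency a₁ a₂ a₃ β τ)
    (hα : IsSingularFrequency a₁ a₂ a₃ β α) :
    ∃ ω ∈ Ioo α τ, UnboundedOp.IsEigenvalue (limitOp a₁ a₂ a₃ β μ) ((ω ^ 2 : ℝ) : ℂ) := by
  obtain ⟨ω, hω, p, hp0, hps, hp⟩ := exists_vertexEquation_Ioo ha₁ ha₂ ha₃ hμ0 hμ1 hατ hgap h3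
    h1τ h2τ h3τ hτ hα
  exact ⟨ω, hω, isEigenvalue_of_vertexEquation ha₁ ha₂ ha₃ hμ0 (hgap ω hω).1 (hgap ω hω).2.1
    (h3 ω hω) hp0 hps hp⟩

theorem sin_neg_mul_ne_zero {a : ℝ} : Real.sin (-x * a) ≠ 0 ↔ Real.sin (x * a) ≠ 0 := by
  rw [neg_mul, Real.sin_neg, neg_ne_zero]

/-- A gap with a regular lower end and a singular upper end contains an eigenvalue. -/
theorem exists_isEigenvalue_of_singular_right (ha₁ : 0 < a₁) (ha₂ : 0 < a₂) (ha₃ : 0 < a₃)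
    (hμ0 : 0 < μ) (hμ1 : μ < 1) (hτα : τ < α)
    (hgap : ∀ x ∈ Ioo τ α, IsGapFrequency a₁ a₂ a₃ β x)
    (h3 : ∀ x ∈ Ioo τ α, Real.sin (x * a₃) ≠ 0)
    (h1τ : Real.sin (τ * a₁) ≠ 0) (h2τ : Real.sin (τ * a₂) ≠ 0)
    (h3τ : Real.sin (τ * a₃) ≠ 0) (hτ : IsBandFrequency a₁ a₂ a₃ β τ)
    (hα : IsSingularFrequency a₁ a₂ a₃ β α) :
    ∃ ω ∈ Ioo τ α, UnboundedOp.IsEigenvalue (limitOp a₁ a₂ a₃ β μ) ((ω ^ 2 : ℝ) : ℂ) := by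
  have hneg : ∀ x ∈ Ioo (-α) (-τ), -x ∈ Ioo τ α := fun x hx =>
    ⟨lt_neg.1 hx.2, neg_lt.1 hx.1⟩
  -- The reflection `x ↦ -x` preserves the bands and the vertex equation, and exchanges the two
  -- ends.
  obtain ⟨ω, hω, p, hp0, hps, hp⟩ := exists_vertexEquation_Ioo (β := β) ha₁ ha₂ ha₃ hμ0 hμ1
    (neg_lt_neg hτα)
    (fun x hx => by
      obtain ⟨g1, g2, g3⟩ := hgap _ (hneg x hx)
      exact ⟨sin_neg_mul_ne_zero.1 g1, sin_neg_mul_ne_zero.1 g2, isBandFrequency_neg.not.1 g3⟩)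
    (fun x hx => sin_neg_mul_ne_zero.1 (h3 _ (hneg x hx)))
    (sin_neg_mul_ne_zero.2 h1τ) (sin_neg_mul_ne_zero.2 h2τ) (sin_neg_mul_ne_zero.2 h3τ)
    (isBandFrequency_neg.2 hτ) (by
      simpa only [IsSingularFrequency, neg_mul, Real.sin_neg, Real.cos_neg, neg_eq_zero] using hα)
  have hω' := hneg ω hω
  refine ⟨-ω, hω', isEigenvalue_of_vertexEquation ha₁ ha₂ ha₃ hμ0 (hgap _ hω').1 (hgap _ hω').2.1
    (h3 _ hω') hp0 hps (vertexEquation_neg ?_)⟩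
  rwa [neg_neg]

section Gap

theorem notMem_spectrum_of_gap {H : Type*} [NormedAddCommGroup H] [InnerProductSpace ℂ H]
    {T : H →ₗ.[ℂ] H} (hb : 0 ≤ ωb)
    (hgap : UnboundedOp.IsSpectralGap T (ωb ^ 2) (ωt ^ 2)) (hx : x ∈ Ioo ωb ωt) :
    ((x ^ 2 : ℝ) : ℂ) ∉ UnboundedOp.spectrum T := by
  intro hs
  have h1 : ωb ^ 2 < x ^ 2 := pow_lt_pow_left₀ hx.1 hb two_ne_zero
  have h2 : x ^ 2 < ωt ^ 2 := pow_lt_pow_left₀ hx.2 (hb.trans hx.1.le) two_ne_zero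
  have h3 : x ^ 2 ∈ ({ωb ^ 2, ωt ^ 2} : Set ℝ) := by
    rw [← hgap.2]
    exact ⟨⟨h1.le, h2.le⟩, hs⟩
  rcases h3 with h | h
  · exact h1.ne' h
  · exact h2.ne h

theorem isGapFrequency_of_notMem_spectrum (ha₁ : 0 < a₁) (ha₂ : 0 < a₂) (ha₃ : 0 < a₃)
    (hx : x ≠ 0) (h : ((x ^ 2 : ℝ) : ℂ) ∉ UnboundedOp.spectrum (limitOp a₁ a₂ a₃ β 1)) :
    IsGapFrequency a₁ a₂ a₃ β x := by
  have h' := fun hb => h (UnboundedOp.essSpectrum_subset_spectrum _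
    (mem_essSpectrum_of_band (μ := 1) ha₁ ha₂ ha₃ one_pos hx hb))
  exact ⟨fun h1 => h' (Or.inl h1), fun h2 => h' (Or.inr (Or.inl h2)),
    fun h3 => h' (Or.inr (Or.inr h3))⟩

theorem IsGapFrequency.cos_ne (h : IsGapFrequency a₁ a₂ a₃ β x) (h3 : Real.sin (x * a₃) = 0) :
    Real.cos (x * a₃) ≠ Real.cos β := by
  intro hc
  refine h.2.2 ?_
  rw [IsBandFrequency, h3, hc]
  simp

/-- Regularity of the end points of a gap. -/
theorem regular_of_boundary {S : Set ℝ} (ha₁ : 0 < a₁) (ha₂ : 0 < a₂) (ha₃ : 0 < a₃)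
    (hτ0 : 0 ≤ τ) (hτ : τ ^ 2 ∉ sigmaSet a₁ ∪ sigmaSet a₂) [(𝓝[S] τ).NeBot]
    (hS : ∀ x ∈ S, ((x ^ 2 : ℝ) : ℂ) ∉ UnboundedOp.spectrum (limitOp a₁ a₂ a₃ β 1))
    (hS' : ∀ x ∈ S, IsGapFrequency a₁ a₂ a₃ β x)
    (hs : ((τ ^ 2 : ℝ) : ℂ) ∈ UnboundedOp.spectrum (limitOp a₁ a₂ a₃ β 1)) :
    Real.sin (τ * a₁) ≠ 0 ∧ Real.sin (τ * a₂) ≠ 0 ∧ Real.sin (τ * a₃) ≠ 0 ∧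
      IsBandFrequency a₁ a₂ a₃ β τ := by
  have h1 : Real.sin (τ * a₁) ≠ 0 := fun h => hτ (Or.inl ((mem_sigmaSet_iff ha₁).2 h))
  have h2 : Real.sin (τ * a₂) ≠ 0 := fun h => hτ (Or.inr ((mem_sigmaSet_iff ha₂).2 h))
  have hne : τ ≠ 0 := by
    rintro rfl
    simp at h1
  have hband := isBandFrequency_of_boundary ha₁ ha₂ ha₃ hne h1 h2 hS hs
  exact ⟨h1, h2, sin_ne_zero_of_boundary h1 h2 (fun x hx => (hS' x hx).2.2) hband, hband⟩

theorem isSingularFrequency_of_mem_sigmaSet (ha₁ : 0 < a₁) (ha₂ : 0 < a₂)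
    (h : α ^ 2 ∈ sigmaSet a₁ ∪ sigmaSet a₂) : IsSingularFrequency a₁ a₂ a₃ β α := by
  rcases h with h | h
  · exact Or.inl ((mem_sigmaSet_iff ha₁).1 h)
  · exact Or.inr (Or.inl ((mem_sigmaSet_iff ha₂).1 h))

end Gap

end LimitGraph

theorem lemma4 (a₁ a₂ a₃ β μ : ℝ) (ha₁ : 0 < a₁) (ha₂ : 0 < a₂) (ha₃ : 0 < a₃) :
    (1 < μ → ∀ z : ℂ, UnboundedOp.IsEigenvalue (LimitGraph.limitOp a₁ a₂ a₃ β μ) z →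
      z ∈ UnboundedOp.essSpectrum (LimitGraph.limitOp a₁ a₂ a₃ β μ) ∧
      z ∈ UnboundedOp.spectrum (LimitGraph.limitOp a₁ a₂ a₃ β 1)) ∧
    (0 < μ → μ < 1 → ∀ ωb ωt : ℝ, 0 ≤ ωb → 0 ≤ ωt →
      UnboundedOp.IsSpectralGap (LimitGraph.limitOp a₁ a₂ a₃ β 1) (ωb ^ 2) (ωt ^ 2) →
      (∀ ω₀ : ℝ, LimitGraph.IsTypeI a₁ a₂ a₃ β ωb ωt ω₀ →
        ∃ ω₁ ω₂ : ℝ, ωb < ω₁ ∧ ω₁ < ω₀ ∧ ω₀ < ω₂ ∧ ω₂ < ωt ∧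
          UnboundedOp.IsEigenvalue (LimitGraph.limitOp a₁ a₂ a₃ β μ) ((ω₁ ^ 2 : ℝ) : ℂ) ∧
          UnboundedOp.IsEigenvalue (LimitGraph.limitOp a₁ a₂ a₃ β μ) ((ω₂ ^ 2 : ℝ) : ℂ)) ∧
      (LimitGraph.IsTypeII a₁ a₂ a₃ β ωb ωt ∨ LimitGraph.IsTypeIII a₁ a₂ a₃ β ωb ωt →
        ∃ ω₁ : ℝ, ωb < ω₁ ∧ ω₁ < ωt ∧
          UnboundedOp.IsEigenvalue (LimitGraph.limitOp a₁ a₂ a₃ β μ) ((ω₁ ^ 2 : ℝ) : ℂ))) := by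
  open LimitGraph in
  refine ⟨fun hμ z hz => ?_, fun hμ0 hμ1 ωb ωt hb ht hgap => ?_⟩
  · obtain ⟨ω, hω, rfl, hband⟩ := band_of_isEigenvalue ha₁ ha₂ ha₃ hμ hz
    -- The band condition does not involve the weight, so it applies to the perturbed and to the
    -- unperturbed operator.
    exact ⟨mem_essSpectrum_of_band ha₁ ha₂ ha₃ (zero_lt_one.trans hμ) hω.ne' hband,
      UnboundedOp.essSpectrum_subset_spectrum _
        (mem_essSpectrum_of_band ha₁ ha₂ ha₃ one_pos hω.ne' hband)⟩
  have hbt : ωb < ωt := lt_of_pow_lt_pow_left₀ 2 ht hgap.1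
  have hnot : ∀ x ∈ Ioo ωb ωt, ((x ^ 2 : ℝ) : ℂ) ∉ UnboundedOp.spectrum (limitOp a₁ a₂ a₃ β 1) :=
    fun x hx => notMem_spectrum_of_gap hb hgap hx
  have hin : ∀ x ∈ Ioo ωb ωt, IsGapFrequency a₁ a₂ a₃ β x := fun x hx =>
    isGapFrequency_of_notMem_spectrum ha₁ ha₂ ha₃ (hb.trans_lt hx.1).ne' (hnot x hx)
  -- Inside the gap a zero of `sin (x a₃)` with `cos (x a₃) = cos β` would be a band frequency, so
  -- the poles of the vertical term are exactly the points listed by `W`.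
  have hW : ∀ x ∈ Ioo ωb ωt, Real.sin (x * a₃) = 0 → x ∈ W a₃ β := fun x hx h3 =>
    mem_W_of_sin_eq_zero ha₃ (hb.trans_lt hx.1) h3 ((hin x hx).cos_ne h3)
  have hmem : ∀ y ∈ ({ωb ^ 2, ωt ^ 2} : Set ℝ),
      (y : ℂ) ∈ UnboundedOp.spectrum (limitOp a₁ a₂ a₃ β 1) := fun y hy => by
    rw [← hgap.2] at hy
    exact hy.2
  have hst : ((ωt ^ 2 : ℝ) : ℂ) ∈ UnboundedOp.spectrum (limitOp a₁ a₂ a₃ β 1) :=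
    hmem _ (Or.inr rfl)
  have hsb : ((ωb ^ 2 : ℝ) : ℂ) ∈ UnboundedOp.spectrum (limitOp a₁ a₂ a₃ β 1) :=
    hmem _ (Or.inl rfl)
  have : (𝓝[Ioo ωb ωt] ωt).NeBot := right_nhdsWithin_Ioo_neBot hbt
  have : (𝓝[Ioo ωb ωt] ωb).NeBot := left_nhdsWithin_Ioo_neBot hbt
  refine ⟨fun ω₀ hI => ?_, ?_⟩
  · obtain ⟨hIb, hIt, hI0⟩ := hI
    have h0 : ω₀ ∈ Ioo ωb ωt ∩ W a₃ β := by rw [hI0]; rfl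
    obtain ⟨⟨h0b, h0t⟩, h0W⟩ := h0
    have hs0 := sin_eq_zero_of_mem_W ha₃ h0W
    -- The pole `ω₀` is a singular end for both halves of the gap, whose outer ends are regular band
    -- edges.
    have hsing : IsSingularFrequency a₁ a₂ a₃ β ω₀ :=
      Or.inr (Or.inr ⟨hs0, (hin ω₀ ⟨h0b, h0t⟩).cos_ne hs0⟩)
    have h3 : ∀ x ∈ Ioo ωb ωt, x ≠ ω₀ → Real.sin (x * a₃) ≠ 0 := fun x hx hne h3 => by
      have : x ∈ Ioo ωb ωt ∩ W a₃ β := ⟨hx, hW x hx h3⟩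
      rw [hI0] at this
      exact hne this
    obtain ⟨t1, t2, t3, t4⟩ := regular_of_boundary ha₁ ha₂ ha₃ ht hIt hnot hin hst
    obtain ⟨b1, b2, b3, b4⟩ := regular_of_boundary ha₁ ha₂ ha₃ hb hIb hnot hin hsb
    have subl : ∀ x ∈ Ioo ωb ω₀, x ∈ Ioo ωb ωt := fun x hx => ⟨hx.1, hx.2.trans h0t⟩
    have subr : ∀ x ∈ Ioo ω₀ ωt, x ∈ Ioo ωb ωt := fun x hx => ⟨h0b.trans hx.1, hx.2⟩
    obtain ⟨ω₁, hω₁, he₁⟩ := exists_isEigenvalue_of_singular_right ha₁ ha₂ ha₃ hμ0 hμ1 h0b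
      (fun x hx => hin x (subl x hx)) (fun x hx => h3 x (subl x hx) hx.2.ne) b1 b2 b3 b4 hsing
    obtain ⟨ω₂, hω₂, he₂⟩ := exists_isEigenvalue_of_singular_left ha₁ ha₂ ha₃ hμ0 hμ1 h0t
      (fun x hx => hin x (subr x hx)) (fun x hx => h3 x (subr x hx) hx.1.ne') t1 t2 t3 t4 hsing
    exact ⟨ω₁, ω₂, hω₁.1, hω₁.2, hω₂.1, hω₂.2, he₁, he₂⟩
  · have h3 : W a₃ β ∩ Ioo ωb ωt = ∅ → ∀ x ∈ Ioo ωb ωt, Real.sin (x * a₃) ≠ 0 :=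
      fun hempty x hx h3 => by
        have : x ∈ W a₃ β ∩ Ioo ωb ωt := ⟨hW x hx h3, hx⟩
        rw [hempty] at this
        exact this
    rintro (⟨hIb, hIt, hempty⟩ | ⟨hIb, hIt, hempty⟩)
    · obtain ⟨t1, t2, t3, t4⟩ := regular_of_boundary ha₁ ha₂ ha₃ ht hIt hnot hin hst
      obtain ⟨ω₁, hω₁, he₁⟩ := exists_isEigenvalue_of_singular_left ha₁ ha₂ ha₃ hμ0 hμ1 hbt hin
        (h3 hempty) t1 t2 t3 t4 (isSingularFrequency_of_mem_sigmaSet ha₁ ha₂ hIb)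
      exact ⟨ω₁, hω₁.1, hω₁.2, he₁⟩
    · obtain ⟨b1, b2, b3, b4⟩ := regular_of_boundary ha₁ ha₂ ha₃ hb hIb hnot hin hsb
      obtain ⟨ω₁, hω₁, he₁⟩ := exists_isEigenvalue_of_singular_right ha₁ ha₂ ha₃ hμ0 hμ1 hbt hin
        (h3 hempty) b1 b2 b3 b4 (isSingularFrequency_of_mem_sigmaSet ha₁ ha₂ hIt)
      exact ⟨ω₁, hω₁.1, hω₁.2, he₁⟩
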